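/- **Setting.** Let $Y=(0,1]^3$ be the unit period cell, let $D\subseteq Y$ be measurable (the inclusions) and $H=Y\setminus D$ (the host), and let $\alpha\in Y^*=(-\pi,\pi]^3$. A field $u$ is $\alpha$-quasiperiodic if $u(x+n)=e^{i\alpha\cdot n}u(x)$ for $n\in\mathbb Z^3$; such fields are identified with their restrictions to $Y$. Let $L^2_\#$ be the space of square integrable $\alpha$-quasiperiodic fields with values in $\mathbb C^3$, with $(u,v)=\int_Y u\cdot\overline v$, and let $J_\#$ be the space of $u\in H^1_{\rm loc}$ that are $\alpha$-quasiperiodic with $\nabla\cdot u=0$ (and $\int_Y u=0$ if $\alpha=0$), a Hilbert space with $\langle u,v\rangle=\int_Y\nabla\times u\cdot\overline{\nabla\times v}$. Put $W_1=\{u\in J_\#:\nabla\times u=0\text{ in }D\}$, $W_2=\{u\in J_\#:\nabla\times u=0\text{ in }H\}$, $W_3=(W_1\oplus W_2)^\perp$. Let $T^\alpha:W_3\to W_3$ be the self-adjoint operator with $$\langle T^\alpha u,w\rangle=\tfrac12\int_H\nabla\times u\cdot\overline{\nabla\times w}-\tfrac12\int_D\nabla\times u\cdot\overline{\nabla\times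 w},\qquad u,w\in W_3,$$ and put $\mu^-(\alpha)=\inf\sigma(T^\alpha;W_3)$ and $z^*(\alpha)=\dfrac{\mu^-(\alpha)+1/2}{\mu^-(\alpha)-1/2}$. For $k\in\mathbb C$ let $T_k$ be the operator on $J_\#$ with $$\langle T_ku,w\rangle=k\int_H\nabla\times u\cdot\overline{\nabla\times w}+\int_D\nabla\times u\cdot\overline{\nabla\times w},$$ and let $(-\Delta_\alpha)^{-1}:L^2_\#\to J_\#$ be given by $\langle(-\Delta_\alpha)^{-1}f,v\rangle=(f,v)$ for all $v\in J_\#$. Define operators on $L^2_\#$ by $A^\alpha(z)=T_{1/z}^{-1}(-\Delta_\alpha)^{-1}$ for $z\neq0$ (whenever $T_{1/z}$ is invertible) and $A^\alpha(0)=P_2(-\Delta_\alpha)^{-1}$, where $P_2$ is the orthogonal projection of $J_\#$ onto $W_2$. Near $z=0$ one has $A^\alpha(z)=A^\alpha(0)+\sum_{n\ge1}z^nA_n$. Let $\beta_0\ne0$ be an eigenvalue of $A^\alpha(0)$ and let $\Gamma\subset\mathbb C$ be a closed, piecewise $C^1$ contour that avoids $\sigma(A^\alpha(0))$, winds once counterclockwise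 around $\beta_0$, and has winding number $0$ about every other point of $\sigma(A^\alpha(0))$. Put $d=\inf_{\zeta\in\Gamma}\operatorname{dist}(\zeta,\sigma(A^\alpha(0)))$, $R(\zeta,z)=(A^\alpha(z)-\zeta)^{-1}$, $P(z)=-\frac1{2\pi i}\oint_\Gamma R(\zeta,z)\,d\zeta$, $m=\dim\operatorname{ran}P(0)$. Let $$\hat\beta^\alpha(z)=\frac1m\operatorname{tr}\big(A^\alpha(z)P(z)\big)$$ be the weighted mean of the eigenvalue group of $A^\alpha(z)$ that splits from $\beta_0$, and for $n\ge1$ let $$\beta_n=\frac1{2\pi i\,m}\operatorname{tr}\sum_{\substack{q\ge1,\ k_1+\dots+k_q=n\\ k_j\ge1}}\frac{(-1)^q}{q}\oint_\Gamma A_{k_1}R(\zeta,0)A_{k_2}R(\zeta,0)\cdots A_{k_q}R(\zeta,0)\,d\zeta .$$ **Theorem.** Assume $-\frac12<\mu^-(\alpha)<0$. Put $$r^*=\frac{|\alpha|^2\,d\,|z^*(\alpha)|}{\frac1{1/2-\mu^-(\alpha)}+|\alpha|^2d}\ \text{ if }\alpha\neq0,\qquad r^*=\frac{4\pi^2\,d\,|z^*(0)|}{\frac1{1/2-\mu^-(0)}+4\pi^2d}\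 \text{ if }\alpha=0 .$$ Then, both for $\alpha\neq0$ and for $\alpha=0$, for every $z\in\mathbb C$ with $|z|<r^*$ and every integer $p\ge0$, $$\Big|\hat\beta^\alpha(z)-\sum_{n=0}^{p}z^n\beta_n\Big|\le\frac{d\,|z|^{p+1}}{(r^*)^p\,(r^*-|z|)} .$$ -/

import Mathlib

open MeasureTheory
open scoped ContDiff InnerProductSpace

noncomputable section
namespace PhotonicCrystal

abbrev R3 : Type := EuclideanSpace ℝ (Fin 3)
abbrev C3 : Type := EuclideanSpace ℂ (Fin 3)

/-- The period cell `Y = (0,1]³`. -/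
def unitCell : Set R3 := {x | ∀ i, x i ∈ Set.Ioc (0 : ℝ) 1}

abbrev cellMeasure : Measure R3 := volume.restrict unitCell

/-- The space `L²_#(α,Y,ℂ³)`: an `α`-quasiperiodic field in `L²_loc(ℝ³,ℂ³)` is identified with its
restriction to the period cell, and every element of `L²(Y,ℂ³)` has exactly one `α`-quasiperiodic
extension to `ℝ³`. The inner product `inner ℂ v u` is `∫_Y u · conj v`. -/
abbrev L2Cell : Type := Lp C3 2 cellMeasure

def latticeVec (n : Fin 3 → ℤ) : R3 := WithLp.toLp 2 fun i => (n i : ℝ)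

/-- `φ (x + n) = e^{i α·n} φ x` for all `n ∈ ℤ³`. -/
def IsQuasiperiodic (α : R3) (φ : R3 → C3) : Prop :=
  ∀ (x : R3) (n : Fin 3 → ℤ),
    φ (x + latticeVec n) = Complex.exp (Complex.I * (inner ℝ α (latticeVec n) : ℝ)) • φ x

/-- `g` is the weak partial derivative `∂_j u` of the `α`-quasiperiodic field `u`: integration by parts
on the period cell against smooth `α`-quasiperiodic fields `φ` (the boundary terms cancel, since
`u · conj φ` is periodic). For quasiperiodic fields this is the distributional derivative on `ℝ³`. -/
def HasWeakPartial (α : R3) (j : Fin 3) (u g : L2Cell) : Prop :=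
  ∀ φ : R3 → C3, ContDiff ℝ ∞ φ → IsQuasiperiodic α φ →
    ∫ x in unitCell, inner ℂ (fderiv ℝ φ x (EuclideanSpace.single j 1)) (u x) =
      -∫ x in unitCell, inner ℂ (φ x) (g x)

/-- The vector `2πn + α`. -/
def waveVec (α : R3) (n : Fin 3 → ℤ) : R3 := (2 * Real.pi) • latticeVec n + α

/-- The plane wave `e^{i(2πn+α)·x}`. -/
def planeWave (α : R3) (n : Fin 3 → ℤ) (x : R3) : ℂ :=
  Complex.exp (Complex.I * (inner ℝ (waveVec α n) x : ℝ))

/-- The Fourier coefficient `∫_Y e^{-i(2πn+α)·x} u(x) dx`. -/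
def fourierCoef (α : R3) (n : Fin 3 → ℤ) (u : L2Cell) : C3 :=
  ∫ x in unitCell, (starRingEnd ℂ) (planeWave α n x) • u x

theorem measurableSet_unitCell : MeasurableSet unitCell := by
  have : unitCell = ⋂ i, (fun x : R3 => x i) ⁻¹' Set.Ioc (0:ℝ) 1 := by ext; simp [unitCell]
  rw [this]
  exact MeasurableSet.iInter fun i => (by fun_prop : Measurable fun x : R3 => x i) measurableSet_Ioc

theorem map_cell :
    MeasurePreserving (fun x : R3 => (fun i => ((x i : ℝ) : UnitAddCircle)))
      cellMeasure (Measure.pi fun _ : Fin 3 => (AddCircle.haarAddCircle : Measure UnitAddCircle)) := by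
  have h1 : MeasurePreserving (WithLp.ofLp : R3 → Fin 3 → ℝ) cellMeasure
      (volume.restrict {x : Fin 3 → ℝ | ∀ i, x i ∈ Set.Ioc (0:ℝ) 1}) := by
    have hm : MeasurableSet {x : Fin 3 → ℝ | ∀ i, x i ∈ Set.Ioc (0:ℝ) 1} := ?_
    · exact (PiLp.volume_preserving_ofLp (Fin 3)).restrict_preimage hm
    have : {x : Fin 3 → ℝ | ∀ i, x i ∈ Set.Ioc (0:ℝ) 1} = Set.univ.pi fun _ => Set.Ioc (0:ℝ) 1 := by
      ext; simp
    rw [this]; exact MeasurableSet.univ_pi fun _ => measurableSet_Ioc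
  have h2 : MeasurePreserving (fun (x : Fin 3 → ℝ) => (fun i => ((x i : ℝ) : UnitAddCircle)))
      (volume.restrict {x : Fin 3 → ℝ | ∀ i, x i ∈ Set.Ioc (0:ℝ) 1})
      (Measure.pi fun _ : Fin 3 => (AddCircle.haarAddCircle : Measure UnitAddCircle)) := by
    have e : (volume.restrict {x : Fin 3 → ℝ | ∀ i, x i ∈ Set.Ioc (0:ℝ) 1}) =
      Measure.pi fun _ : Fin 3 => (volume : Measure ℝ).restrict (Set.Ioc (0:ℝ) (0+1)) := by
      rw [← Measure.restrict_pi_pi]; 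
      congr 1
      ext; simp
    rw [e]
    refine measurePreserving_pi _ _ fun i => ?_
    have := AddCircle.measurePreserving_mk 1 (0:ℝ)
    simpa [AddCircle.volume_eq_smul_haarAddCircle] using this
  exact h2.comp h1


abbrev torusMeasure : Measure (Fin 3 → UnitAddCircle) :=
  Measure.pi fun _ => (AddCircle.haarAddCircle : Measure UnitAddCircle)

def torusSection (y : Fin 3 → UnitAddCircle) : R3 :=
  WithLp.toLp 2 fun i => (AddCircle.equivIoc 1 0 (y i) : ℝ)

theorem measurePreserving_torusSection :
    MeasurePreserving torusSection torusMeasure cellMeasure := by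
  have hm : Measurable torusSection := by
    refine (WithLp.measurable_toLp 2 (Fin 3 → ℝ)).comp (measurable_pi_lambda _ fun i => ?_)
    exact measurable_subtype_coe.comp
      ((AddCircle.measurableEquivIoc 1 0).measurable.comp (measurable_pi_apply i))
  refine ⟨hm, ?_⟩
  rw [torusMeasure, ← map_cell.map_eq, Measure.map_map hm map_cell.measurable]
  conv_rhs => rw [← Measure.map_id (μ := cellMeasure)]
  refine Measure.map_congr ?_
  filter_upwards [ae_restrict_mem measurableSet_unitCell] with x hx
  ext i
  have h := hx i
  simp only [Function.comp, torusSection, id]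
  exact AddCircle.equivIoc_coe_of_mem (by simpa using h)

theorem coe_torusSection (y : Fin 3 → UnitAddCircle) (i : Fin 3) :
    ((torusSection y i : ℝ) : UnitAddCircle) = y i :=
  AddCircle.coe_equivIoc ..

theorem norm_planeWave (α : R3) (n : Fin 3 → ℤ) (x : R3) : ‖planeWave α n x‖ = 1 := by
  rw [planeWave, mul_comm, Complex.norm_exp_ofReal_mul_I]

theorem continuous_planeWave (α : R3) (n : Fin 3 → ℤ) : Continuous (planeWave α n) := by
  unfold planeWave; fun_prop

theorem integral_torusSection {E : Type*} [NormedAddCommGroup E] [NormedSpace ℝ E]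
    (F : R3 → E) (hF : AEStronglyMeasurable F cellMeasure) :
    ∫ y, F (torusSection y) ∂torusMeasure = ∫ x in unitCell, F x := by
  have hs := measurePreserving_torusSection
  change _ = ∫ x, F x ∂cellMeasure
  rw [← hs.map_eq, integral_map hs.measurable.aemeasurable]
  rwa [hs.map_eq]

theorem planeWave_torusSection (α : R3) (n : Fin 3 → ℤ) (y : UnitAddTorus (Fin 3)) :
    (starRingEnd ℂ) (planeWave α n (torusSection y)) =
      UnitAddTorus.mFourier (-n) y * (starRingEnd ℂ) (planeWave α 0 (torusSection y)) := by
  rw [UnitAddTorus.mFourier_neg, ← map_mul]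
  congr 1
  have : UnitAddTorus.mFourier n y =
      Complex.exp (∑ i, 2 * Real.pi * Complex.I * n i * (torusSection y i : ℝ)) := by
    rw [Complex.exp_sum, UnitAddTorus.mFourier, ContinuousMap.coe_mk]
    refine Finset.prod_congr rfl fun i _ => ?_
    rw [← coe_torusSection y i, fourier_coe_apply]
    simp
  rw [this, planeWave, planeWave, ← Complex.exp_add]
  congr 1
  simp only [waveVec, latticeVec, PiLp.inner_apply, Fin.sum_univ_three]
  simp
  ring

section
local instance : MeasureSpace UnitAddCircle := ⟨AddCircle.haarAddCircle⟩

theorem parseval_scalar (α : R3) (f : R3 → ℂ) (hf : MemLp f 2 cellMeasure) :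
    HasSum (fun n : Fin 3 → ℤ =>
      ‖∫ x in unitCell, (starRingEnd ℂ) (planeWave α n x) * f x‖ ^ 2)
      (∫ x in unitCell, ‖f x‖ ^ 2) := by
  set g : R3 → ℂ := fun x => (starRingEnd ℂ) (planeWave α 0 x) * f x with hg
  have hpm (n) : AEStronglyMeasurable (fun x => (starRingEnd ℂ) (planeWave α n x)) cellMeasure :=
    (Complex.continuous_conj.comp (continuous_planeWave α n)).aestronglyMeasurable
  have hgm : MemLp g 2 cellMeasure := by
    refine hf.of_le ((hpm 0).mul hf.1) (Filter.Eventually.of_forall fun x => ?_)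
    simp [hg, norm_planeWave]
  have hs := measurePreserving_torusSection
  have hh : MemLp (fun y => g (torusSection y)) 2 (volume : Measure (UnitAddTorus (Fin 3))) :=
    hgm.comp_measurePreserving hs
  have key := UnitAddTorus.hasSum_sq_mFourierCoeff (hh.toLp)
  have e1 : ∫ y, ‖(hh.toLp) y‖ ^ 2 = ∫ x in unitCell, ‖f x‖ ^ 2 := by
    rw [integral_congr_ae (g := fun y => ‖g (torusSection y)‖ ^ 2)]
    · refine (integral_torusSection (fun x => ‖g x‖ ^ 2) (hgm.1.norm.pow 2)).trans ?_
      simp [hg, norm_planeWave]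
    · filter_upwards [hh.coeFn_toLp] with y hy
      rw [hy]
  rw [e1] at key
  refine key.congr_fun fun n => ?_
  congr 2
  rw [UnitAddTorus.mFourierCoeff,
    ← integral_torusSection (fun x => (starRingEnd ℂ) (planeWave α n x) * f x) ((hpm n).mul hf.1)]
  refine integral_congr_ae ?_
  filter_upwards [hh.coeFn_toLp] with y hy
  rw [hy, planeWave_torusSection, hg, smul_eq_mul, mul_assoc]
end

theorem isFiniteMeasure_cell : IsFiniteMeasure cellMeasure := by
  refine ⟨?_⟩
  rw [← measurePreserving_torusSection.map_eq,
    Measure.map_apply measurePreserving_torusSection.measurable MeasurableSet.univ]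
  exact measure_lt_top _ _

theorem memLp_planeWave_smul (α : R3) (n : Fin 3 → ℤ) (u : L2Cell) :
    MemLp (fun x => (starRingEnd ℂ) (planeWave α n x) • u x) 2 cellMeasure := by
  refine (Lp.memLp u).of_le ?_ (Filter.Eventually.of_forall fun x => ?_)
  · exact ((Complex.continuous_conj.comp
      (continuous_planeWave α n)).aestronglyMeasurable).smul (Lp.memLp u).1
  · simp [norm_smul, norm_planeWave]

theorem integrable_planeWave_smul (α : R3) (n : Fin 3 → ℤ) (u : L2Cell) :
    Integrable (fun x => (starRingEnd ℂ) (planeWave α n x) • u x) cellMeasure :=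
  haveI := isFiniteMeasure_cell
  (memLp_planeWave_smul α n u).integrable (by norm_num)

theorem fourierCoef_apply (α : R3) (n : Fin 3 → ℤ) (u : L2Cell) (i : Fin 3) :
    fourierCoef α n u i = ∫ x in unitCell, (starRingEnd ℂ) (planeWave α n x) * u x i := by
  have := (EuclideanSpace.proj (𝕜 := ℂ) i).integral_comp_comm (integrable_planeWave_smul α n u)
  simpa [fourierCoef] using this.symm

theorem parseval (α : R3) (u : L2Cell) :
    HasSum (fun n : Fin 3 → ℤ => ‖fourierCoef α n u‖ ^ 2) (‖u‖ ^ 2) := by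
  have hu (i : Fin 3) : MemLp (fun x => u x i) 2 cellMeasure :=
    (EuclideanSpace.proj (𝕜 := ℂ) i).comp_memLp' (Lp.memLp u)
  have h := hasSum_sum (s := Finset.univ) fun i _ => parseval_scalar α _ (hu i)
  have e : ‖u‖ ^ 2 = ∑ i, ∫ x in unitCell, ‖u x i‖ ^ 2 := by
    have h1 : ‖u‖ ^ 2 = ∫ x in unitCell, ‖u x‖ ^ 2 := by
      have := congrArg Complex.re (inner_self_eq_norm_sq_to_K (𝕜 := ℂ) u)
      rw [L2.inner_def] at this
      have h2 : ∫ x, inner ℂ (u x) (u x) ∂cellMeasure = ((∫ x in unitCell, ‖u x‖ ^ 2 : ℝ) : ℂ) := by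
        rw [← integral_complex_ofReal]
        refine integral_congr_ae (Filter.Eventually.of_forall fun x => ?_)
        simp
      rw [h2] at this
      rw [Complex.ofReal_re] at this
      rw [this]
      norm_cast
    rw [h1, ← integral_finsetSum]
    · simp [EuclideanSpace.norm_sq_eq]
    · intro i _
      exact (hu i).integrable_norm_pow (by norm_num)
  rw [e]
  refine h.congr_fun fun n => ?_
  rw [EuclideanSpace.norm_sq_eq]
  simp [fourierCoef_apply]

theorem fourierCoef_add (α : R3) (n : Fin 3 → ℤ) (u v : L2Cell) :
    fourierCoef α n (u + v) = fourierCoef α n u + fourierCoef α n v := by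
  rw [fourierCoef, fourierCoef, fourierCoef,
    ← integral_add (integrable_planeWave_smul α n u) (integrable_planeWave_smul α n v)]
  refine integral_congr_ae ?_
  filter_upwards [Lp.coeFn_add u v] with x hx
  rw [hx, Pi.add_apply, smul_add]

theorem fourierCoef_compLpL (α : R3) (n : Fin 3 → ℤ) (L : C3 →L[ℂ] C3) (u : L2Cell) :
    fourierCoef α n (L.compLpL 2 cellMeasure u) = L (fourierCoef α n u) := by
  rw [fourierCoef, fourierCoef, ← L.integral_comp_comm (integrable_planeWave_smul α n u)]
  refine integral_congr_ae ?_
  filter_upwards [L.coeFn_compLpL u] with x hx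
  rw [hx, map_smul]

theorem ext_fourierCoef (α : R3) {u v : L2Cell}
    (h : ∀ n, fourierCoef α n u = fourierCoef α n v) : u = v := by
  have h0 (n) : fourierCoef α n (u - v) = 0 := by
    have := fourierCoef_add α n (u - v) v
    rw [sub_add_cancel, h n] at this
    simpa using this
  have hz : HasSum (fun n => ‖fourierCoef α n (u - v)‖ ^ 2) 0 := by
    simp only [h0, norm_zero, ne_eq, OfNat.ofNat_ne_zero, not_false_eq_true, zero_pow]
    exact hasSum_zero
  have := (parseval α (u - v)).unique hz
  rw [← sub_eq_zero, ← norm_eq_zero]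
  exact pow_eq_zero_iff (two_ne_zero) |>.1 this

theorem HasWeakPartial.fourierCoef_eq {α : R3} {j : Fin 3} {u g : L2Cell}
    (h : HasWeakPartial α j u g) (n : Fin 3 → ℤ) :
    fourierCoef α n g = (Complex.I * (waveVec α n j : ℝ)) • fourierCoef α n u := by
  have aux (v : C3) (w : L2Cell) :
      ∫ x in unitCell, inner ℂ (planeWave α n x • v) (w x) = inner ℂ v (fourierCoef α n w) := by
    rw [fourierCoef, ← integral_inner (integrable_planeWave_smul α n w)]
    refine integral_congr_ae (Filter.Eventually.of_forall fun x => ?_)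
    simp [inner_smul_right, mul_comm]
  have hd (x : R3) : HasFDerivAt (planeWave α n)
      ((planeWave α n x * Complex.I) • (Complex.ofRealCLM.comp (innerSL ℝ (waveVec α n)))) x := by
    have h1 : HasFDerivAt (fun x : R3 => Complex.I * (inner ℝ (waveVec α n) x : ℝ))
        (Complex.I • (Complex.ofRealCLM.comp (innerSL ℝ (waveVec α n)))) x :=
      ((Complex.ofRealCLM.comp (innerSL ℝ (waveVec α n))).hasFDerivAt).const_mul Complex.I
    have := h1.cexp
    rw [smul_smul] at this
    exact this
  refine ext_inner_left ℂ fun v => ?_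
  have hq : IsQuasiperiodic α fun x => planeWave α n x • v := by
    intro x m
    change planeWave α n (x + latticeVec m) • v = _ • planeWave α n x • v
    rw [smul_smul, planeWave, planeWave, ← Complex.exp_add]
    congr 1
    rw [Complex.exp_eq_exp_iff_exists_int]
    refine ⟨∑ i, n i * m i, ?_⟩
    simp only [waveVec, latticeVec, PiLp.inner_apply, Fin.sum_univ_three]
    simp
    ring
  have hc : ContDiff ℝ ∞ fun x => planeWave α n x • v := by
    have : ContDiff ℝ ∞ (planeWave α n) := by
      unfold planeWave
      exact (contDiff_const.mul ((Complex.ofRealCLM.comp (innerSL ℝ (waveVec α n))).contDiff)).cexp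
    exact this.smul contDiff_const
  have key := h _ hc hq
  rw [aux] at key
  have h2 (x : R3) : fderiv ℝ (fun x => planeWave α n x • v) x (EuclideanSpace.single j 1) =
      planeWave α n x • ((Complex.I * (waveVec α n j : ℝ)) • v) := by
    rw [((hd x).smul_const v).fderiv]
    simp [smul_smul, mul_assoc, EuclideanSpace.inner_single_right]
  simp_rw [h2] at key
  rw [aux, inner_smul_left] at key
  rw [inner_smul_right, ← neg_eq_iff_eq_neg.2 key]
  simp

theorem memLp_of_continuous {φ : R3 → C3} (hφ : Continuous φ) : MemLp φ 2 cellMeasure := by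
  have := isFiniteMeasure_cell
  obtain ⟨C, hC⟩ := (isCompact_closedBall (0 : R3) 2).exists_bound_of_continuousOn
    hφ.continuousOn
  refine MemLp.of_bound hφ.aestronglyMeasurable C ?_
  filter_upwards [ae_restrict_mem measurableSet_unitCell] with x hx
  refine hC x ?_
  rw [mem_closedBall_zero_iff, EuclideanSpace.norm_eq, Real.sqrt_le_left (by norm_num),
    Fin.sum_univ_three]
  have h (i) : ‖x i‖ ^ 2 ≤ 1 := by
    rw [Real.norm_of_nonneg (hx i).1.le]
    exact pow_le_one₀ (hx i).1.le (hx i).2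
  linarith [h 0, h 1, h 2]

theorem integral_inner_eq {φ : R3 → C3} (hφ : Continuous φ) (u : L2Cell) :
    ∫ x in unitCell, inner ℂ (φ x) (u x) = inner ℂ ((memLp_of_continuous hφ).toLp φ) u := by
  rw [L2.inner_def]
  refine integral_congr_ae ?_
  filter_upwards [(memLp_of_continuous hφ).coeFn_toLp] with x hx
  rw [hx]

theorem continuous_partial {φ : R3 → C3} (hφ : ContDiff ℝ ∞ φ) (j : Fin 3) :
    Continuous fun x => fderiv ℝ φ x (EuclideanSpace.single j 1) :=
  (hφ.continuous_fderiv (by simp)).clm_apply continuous_const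

theorem hasWeakPartial_iff {α : R3} {j : Fin 3} {u g : L2Cell} :
    HasWeakPartial α j u g ↔ ∀ (φ : R3 → C3) (hφ : ContDiff ℝ ∞ φ), IsQuasiperiodic α φ →
      inner ℂ ((memLp_of_continuous (continuous_partial hφ j)).toLp _) u =
        -inner ℂ ((memLp_of_continuous hφ.continuous).toLp φ) g := by
  refine forall_congr' fun φ => forall_congr' fun hφ => ?_
  rw [integral_inner_eq (continuous_partial hφ j), integral_inner_eq hφ.continuous]

theorem HasWeakPartial.zero (α : R3) (j : Fin 3) : HasWeakPartial α j 0 0 := by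
  rw [hasWeakPartial_iff]; intro φ hφ hq; simp

theorem HasWeakPartial.add {α : R3} {j : Fin 3} {u v g h : L2Cell}
    (hu : HasWeakPartial α j u g) (hv : HasWeakPartial α j v h) :
    HasWeakPartial α j (u + v) (g + h) := by
  rw [hasWeakPartial_iff] at *
  intro φ hφ hq
  rw [inner_add_right, inner_add_right, hu φ hφ hq, hv φ hφ hq]; ring

theorem HasWeakPartial.smul {α : R3} {j : Fin 3} {u g : L2Cell} (c : ℂ)
    (hu : HasWeakPartial α j u g) : HasWeakPartial α j (c • u) (c • g) := by
  rw [hasWeakPartial_iff] at *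
  intro φ hφ hq
  rw [inner_smul_right, inner_smul_right, hu φ hφ hq]; ring

theorem HasWeakPartial.unique {α : R3} {j : Fin 3} {u g h : L2Cell}
    (hg : HasWeakPartial α j u g) (hh : HasWeakPartial α j u h) : g = h :=
  ext_fourierCoef α fun n => by rw [hg.fourierCoef_eq, hh.fourierCoef_eq]

theorem isClosed_hasWeakPartial (α : R3) (j : Fin 3) :
    IsClosed {p : L2Cell × L2Cell | HasWeakPartial α j p.1 p.2} := by
  simp only [hasWeakPartial_iff, Set.ofPred_forall]
  refine isClosed_iInter fun φ => isClosed_iInter fun hφ => isClosed_iInter fun hq => ?_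
  exact isClosed_eq (by fun_prop) (by fun_prop)

/-- `div u = ∑_j (∂_j u)_j`, as a function of the gradient `(∂_1 u, ∂_2 u, ∂_3 u)`. -/
def divergence : (Fin 3 → L2Cell) →L[ℂ] Lp ℂ 2 cellMeasure :=
  ∑ j, ((EuclideanSpace.proj (𝕜 := ℂ) j).compLpL 2 cellMeasure).comp
    (ContinuousLinearMap.proj (R := ℂ) (φ := fun _ : Fin 3 => L2Cell) j)

theorem divergence_apply (G : Fin 3 → L2Cell) : divergence G =
    ∑ j, (EuclideanSpace.proj (𝕜 := ℂ) j).compLpL 2 cellMeasure (G j) := by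
  simp only [divergence, Fin.sum_univ_three]; rfl

/-- The map `v ↦ e_j × v`. -/
def crossE (j : Fin 3) : C3 →L[ℂ] C3 :=
  LinearMap.toContinuousLinearMap
    ((WithLp.linearEquiv 2 ℂ (Fin 3 → ℂ)).symm.toLinearMap ∘ₗ
      crossProduct (Pi.single j (1 : ℂ)) ∘ₗ (WithLp.linearEquiv 2 ℂ (Fin 3 → ℂ)).toLinearMap)

/-- `∇ × u = ∑_j e_j × ∂_j u`, as a function of the gradient `(∂_1 u, ∂_2 u, ∂_3 u)`. -/
def curlOfGrad : (Fin 3 → L2Cell) →L[ℂ] L2Cell :=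
  ∑ j, ((crossE j).compLpL 2 cellMeasure).comp
    (ContinuousLinearMap.proj (R := ℂ) (φ := fun _ : Fin 3 => L2Cell) j)

theorem integral_eq_zero_iff (u : L2Cell) : ∫ x in unitCell, u x = 0 ↔
    ∀ v : C3, inner ℂ ((memLp_of_continuous (continuous_const (y := v))).toLp _) u = 0 := by
  have := isFiniteMeasure_cell
  have hi : Integrable u cellMeasure := (Lp.memLp u).integrable (by norm_num)
  have h (v : C3) : inner ℂ ((memLp_of_continuous (continuous_const (y := v))).toLp _) u =
      inner ℂ v (∫ x in unitCell, u x) := by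
    rw [← integral_inner_eq continuous_const, ← integral_inner hi]
  simp only [h]
  exact ⟨fun h v => by rw [h, inner_zero_right], fun h => inner_self_eq_zero.1 (h _)⟩

/-- The `α`-quasiperiodic fields with all first weak derivatives in `L²(Y)` (that is, in
`H¹_loc(ℝ³,ℂ³)`) whose divergence vanishes and, if `α = 0`, whose mean over `Y` vanishes. -/
def solenoidal (α : R3) : Submodule ℂ L2Cell where
  carrier := {u | (∃ G : Fin 3 → L2Cell, (∀ j, HasWeakPartial α j u (G j)) ∧
    divergence G = 0) ∧ (α = 0 → ∫ x in unitCell, u x = 0)}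
  zero_mem' := ⟨⟨0, fun j => .zero α j, map_zero _⟩, fun _ => by
    rw [integral_eq_zero_iff]; simp⟩
  add_mem' := by
    rintro u v ⟨⟨G, hG, hd⟩, hu⟩ ⟨⟨G', hG', hd'⟩, hv⟩
    refine ⟨⟨G + G', fun j => (hG j).add (hG' j), by rw [map_add, hd, hd', add_zero]⟩, fun h => ?_⟩
    simp only [integral_eq_zero_iff] at *
    intro w
    rw [inner_add_right, hu h, hv h, add_zero]
  smul_mem' := by
    rintro c u ⟨⟨G, hG, hd⟩, hu⟩
    refine ⟨⟨c • G, fun j => (hG j).smul c, by rw [map_smul, hd, smul_zero]⟩, fun h => ?_⟩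
    simp only [integral_eq_zero_iff] at *
    intro w
    rw [inner_smul_right, hu h, mul_zero]

/-- The weak gradient `(∂_1 u, ∂_2 u, ∂_3 u)`; it is unique by `HasWeakPartial.unique`. -/
def weakGrad (α : R3) : solenoidal α →ₗ[ℂ] (Fin 3 → L2Cell) where
  toFun u := u.2.1.choose
  map_add' u v := funext fun j => ((u + v).2.1.choose_spec.1 j).unique
    ((u.2.1.choose_spec.1 j).add (v.2.1.choose_spec.1 j))
  map_smul' c u := funext fun j => ((c • u).2.1.choose_spec.1 j).unique
    ((u.2.1.choose_spec.1 j).smul c)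

theorem weakGrad_spec {α : R3} (u : solenoidal α) (j : Fin 3) :
    HasWeakPartial α j u (weakGrad α u j) := u.2.1.choose_spec.1 j

theorem divergence_weakGrad {α : R3} (u : solenoidal α) : divergence (weakGrad α u) = 0 :=
  u.2.1.choose_spec.2

theorem fourierCoef_sum (α : R3) (n : Fin 3 → ℤ) (g : Fin 3 → L2Cell) :
    fourierCoef α n (∑ j, g j) = ∑ j, fourierCoef α n (g j) := by
  simp only [Fin.sum_univ_three, fourierCoef_add]

theorem fourierCoef_curl {α : R3} (u : solenoidal α) (n : Fin 3 → ℤ) :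
    fourierCoef α n (curlOfGrad (weakGrad α u)) =
      ∑ j, (Complex.I * (waveVec α n j : ℝ)) • crossE j (fourierCoef α n (u : L2Cell)) := by
  simp only [curlOfGrad, sum_apply, ContinuousLinearMap.comp_apply,
    ContinuousLinearMap.proj_apply]
  rw [fourierCoef_sum]
  simp only [fourierCoef_compLpL, (weakGrad_spec u _).fourierCoef_eq, map_smul]

theorem waveVec_dot_fourierCoef {α : R3} (u : solenoidal α) (n : Fin 3 → ℤ) :
    ∑ j, (waveVec α n j : ℂ) * fourierCoef α n (u : L2Cell) j = 0 := by
  have h1 : ∑ j, fourierCoef α n (weakGrad α u j) j = 0 := by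
    simp only [fourierCoef_apply]
    have hi (j : Fin 3) : Integrable
        (fun x => (starRingEnd ℂ) (planeWave α n x) * weakGrad α u j x j) cellMeasure := by
      have := (EuclideanSpace.proj (𝕜 := ℂ) j).integrable_comp
        (integrable_planeWave_smul α n (weakGrad α u j))
      simpa using this
    rw [← integral_finsetSum _ fun j _ => hi j]
    refine integral_eq_zero_of_ae ?_
    have hd := divergence_weakGrad u
    rw [divergence_apply, Fin.sum_univ_three] at hd
    have e := (Lp.ext_iff.1 hd)
    filter_upwards [e, Lp.coeFn_zero ℂ 2 cellMeasure, Lp.coeFn_add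
      ((EuclideanSpace.proj (𝕜 := ℂ) (0 : Fin 3)).compLpL 2 cellMeasure (weakGrad α u 0) +
        (EuclideanSpace.proj (𝕜 := ℂ) (1 : Fin 3)).compLpL 2 cellMeasure (weakGrad α u 1))
      ((EuclideanSpace.proj (𝕜 := ℂ) (2 : Fin 3)).compLpL 2 cellMeasure (weakGrad α u 2)),
      Lp.coeFn_add
      ((EuclideanSpace.proj (𝕜 := ℂ) (0 : Fin 3)).compLpL 2 cellMeasure (weakGrad α u 0))
      ((EuclideanSpace.proj (𝕜 := ℂ) (1 : Fin 3)).compLpL 2 cellMeasure (weakGrad α u 1)),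
      (EuclideanSpace.proj (𝕜 := ℂ) (0 : Fin 3)).coeFn_compLpL (weakGrad α u 0),
      (EuclideanSpace.proj (𝕜 := ℂ) (1 : Fin 3)).coeFn_compLpL (weakGrad α u 1),
      (EuclideanSpace.proj (𝕜 := ℂ) (2 : Fin 3)).coeFn_compLpL (weakGrad α u 2)]
      with x h0 hz h1 h2 h3 h4 h5
    rw [h1, Pi.add_apply, h2, Pi.add_apply, h3, h4, h5, hz] at h0
    rw [← Finset.mul_sum, Fin.sum_univ_three]
    have h0' : weakGrad α u 0 x 0 + weakGrad α u 1 x 1 + weakGrad α u 2 x 2 = 0 := h0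
    rw [h0', mul_zero, Pi.zero_apply]
  simp only [(weakGrad_spec u _).fourierCoef_eq, PiLp.smul_apply, smul_eq_mul, mul_assoc] at h1
  rw [← Finset.mul_sum] at h1
  exact (mul_eq_zero.1 h1).resolve_left Complex.I_ne_zero

theorem norm_sq_cross (k : R3) (v : C3) (h : ∑ j, (k j : ℂ) * v j = 0) :
    ‖∑ j, (Complex.I * (k j : ℝ)) • crossE j v‖ ^ 2 = ‖k‖ ^ 2 * ‖v‖ ^ 2 := by
  simp only [Fin.sum_univ_three] at h
  have hr := congrArg Complex.re h
  have hi := congrArg Complex.im h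
  simp at hr hi
  simp only [EuclideanSpace.norm_sq_eq, Fin.sum_univ_three, crossE]
  simp [crossProduct, Complex.sq_norm, Complex.normSq_apply]
  linear_combination -(k 0 * (v 0).re + k 1 * (v 1).re + k 2 * (v 2).re) * hr -
    (k 0 * (v 0).im + k 1 * (v 1).im + k 2 * (v 2).im) * hi

/-- The first Brillouin zone `Y* = (-π,π]³`. -/
abbrev BrillouinZone : Type := {α : R3 // ∀ i, α i ∈ Set.Ioc (-Real.pi) Real.pi}

/-- The constant of the Poincaré inequality on the divergence-free fields. -/
def poincareConst (α : R3) : ℝ := if α = 0 then 4 * Real.pi ^ 2 else ‖α‖ ^ 2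

theorem poincareConst_pos (α : R3) : 0 < poincareConst α := by
  unfold poincareConst
  split_ifs with h
  · positivity
  · have := norm_pos_iff.2 h
    positivity

theorem poincareConst_le (α : BrillouinZone) (n : Fin 3 → ℤ) (h : α.1 = 0 → n ≠ 0) :
    poincareConst α ≤ ‖waveVec α n‖ ^ 2 := by
  have hp := Real.pi_pos
  unfold poincareConst
  simp only [EuclideanSpace.norm_sq_eq, Fin.sum_univ_three, Real.norm_eq_abs, sq_abs]
  have hw (i) : waveVec α.1 n i = 2 * Real.pi * n i + α.1 i := by simp [waveVec, latticeVec]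
  simp only [hw]
  split_ifs with h0
  · have hz (i) : α.1 i = 0 := by simp [h0]
    simp only [hz, add_zero, mul_pow]
    have : (1 : ℝ) ≤ (n 0 : ℝ) ^ 2 + (n 1 : ℝ) ^ 2 + (n 2 : ℝ) ^ 2 := by
      have hn := h h0
      have : 0 < n 0 ^ 2 + n 1 ^ 2 + n 2 ^ 2 := by
        by_contra hc
        refine hn (funext fun i => ?_)
        have h0 := sq_nonneg (n 0)
        have h1 := sq_nonneg (n 1)
        have h2 := sq_nonneg (n 2)
        have z0 : n 0 = 0 := pow_eq_zero_iff two_ne_zero |>.1 (by omega)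
        have z1 : n 1 = 0 := pow_eq_zero_iff two_ne_zero |>.1 (by omega)
        have z2 : n 2 = 0 := pow_eq_zero_iff two_ne_zero |>.1 (by omega)
        fin_cases i
        exacts [z0, z1, z2]
      exact_mod_cast this
    nlinarith [sq_pos_of_pos hp]
  · have hi (i) : (α.1 i) ^ 2 ≤ (2 * Real.pi * n i + α.1 i) ^ 2 := by
      have h1 := (α.2 i).1
      have h2 := (α.2 i).2
      rcases lt_trichotomy (n i) 0 with hn | hn | hn
      · have : (n i : ℝ) ≤ -1 := by exact_mod_cast (by omega : n i ≤ -1)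
        nlinarith [mul_le_mul_of_nonneg_left this hp.le]
      · simp [hn]
      · have : (1 : ℝ) ≤ n i := by exact_mod_cast hn
        nlinarith [mul_le_mul_of_nonneg_left this hp.le]
    linarith [hi 0, hi 1, hi 2]

theorem norm_sq_fourierCoef_curl {α : R3} (u : solenoidal α) (n : Fin 3 → ℤ) :
    ‖fourierCoef α n (curlOfGrad (weakGrad α u))‖ ^ 2 =
      ‖waveVec α n‖ ^ 2 * ‖fourierCoef α n (u : L2Cell)‖ ^ 2 := by
  rw [fourierCoef_curl, norm_sq_cross _ _ (waveVec_dot_fourierCoef u n)]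

theorem poincare (α : BrillouinZone) (u : solenoidal α.1) :
    poincareConst α * ‖(u : L2Cell)‖ ^ 2 ≤ ‖curlOfGrad (weakGrad α.1 u)‖ ^ 2 := by
  refine hasSum_le (fun n => ?_) ((parseval α.1 (u : L2Cell)).mul_left (poincareConst α))
    (parseval α.1 _)
  rw [norm_sq_fourierCoef_curl]
  by_cases h : α.1 = 0 ∧ n = 0
  · have : fourierCoef α.1 n (u : L2Cell) = 0 := by
      have := u.2.2 h.1
      rw [← this, fourierCoef]
      have hz : waveVec α.1 n = 0 := by ext i; simp [waveVec, latticeVec, h.1, h.2]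
      simp [planeWave, hz]
    simp [this]
  · exact mul_le_mul_of_nonneg_right (poincareConst_le α n fun h0 hn => h ⟨h0, hn⟩) (sq_nonneg _)

theorem norm_weakGrad_le {α : R3} (u : solenoidal α) (j : Fin 3) :
    ‖weakGrad α u j‖ ≤ ‖curlOfGrad (weakGrad α u)‖ := by
  refine le_of_sq_le_sq ?_ (norm_nonneg _)
  refine hasSum_le (fun n => ?_) (parseval α _) (parseval α _)
  rw [norm_sq_fourierCoef_curl, (weakGrad_spec u j).fourierCoef_eq, norm_smul, mul_pow]
  refine mul_le_mul_of_nonneg_right ?_ (sq_nonneg _)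
  rw [norm_mul, Complex.norm_I, one_mul, Complex.norm_real, EuclideanSpace.norm_sq_eq]
  exact Finset.single_le_sum (f := fun i => ‖waveVec α n i‖ ^ 2) (fun i _ => sq_nonneg _)
    (Finset.mem_univ j)

/-- The Hilbert space `J_#(α,Y,ℂ³)` of divergence-free fields of class `H¹` (see `solenoidal`), with the
inner product `⟨u,v⟩ = ∫_Y (∇×u) · conj (∇×v)`, written `inner ℂ v u`. -/
def J (α : BrillouinZone) : Type := solenoidal α.1

namespace J

variable (α : BrillouinZone)

instance : AddCommGroup (J α) := inferInstanceAs (AddCommGroup (solenoidal α.1))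
instance : Module ℂ (J α) := inferInstanceAs (Module ℂ (solenoidal α.1))

/-- The field itself, as an element of `L²(Y,ℂ³)`. -/
def toL2 : J α →ₗ[ℂ] L2Cell := (solenoidal α.1).subtype

/-- The curl `∇ × u ∈ L²(Y,ℂ³)`. -/
def curl : J α →ₗ[ℂ] L2Cell := curlOfGrad.toLinearMap ∘ₗ weakGrad α.1

theorem poincare_toL2 (u : J α) : poincareConst α * ‖toL2 α u‖ ^ 2 ≤ ‖curl α u‖ ^ 2 :=
  PhotonicCrystal.poincare α u

theorem curl_injective {u : J α} (h : curl α u = 0) : u = 0 := by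
  have h1 := poincare_toL2 α u
  rw [h, norm_zero] at h1
  have h2 : ‖toL2 α u‖ ^ 2 = 0 := by
    have := poincareConst_pos α.1
    nlinarith [sq_nonneg ‖toL2 α u‖]
  have h3 : toL2 α u = 0 := norm_eq_zero.1 (pow_eq_zero_iff two_ne_zero |>.1 h2)
  exact Subtype.ext h3

instance core : InnerProductSpace.Core ℂ (J α) where
  inner u v := inner ℂ (curl α u) (curl α v)
  conj_inner_symm u v := inner_conj_symm _ _
  re_inner_nonneg u := inner_self_nonneg
  add_left u v w := by rw [map_add, inner_add_left]
  smul_left u v c := by rw [map_smul, inner_smul_left]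
  definite u h := curl_injective α (inner_self_eq_zero.1 h)

instance : NormedAddCommGroup (J α) := (core α).toNormedAddCommGroup
instance : InnerProductSpace ℂ (J α) := InnerProductSpace.ofCore (core α).toCore

theorem inner_def (u v : J α) : inner ℂ u v = inner ℂ (curl α u) (curl α v) := rfl

theorem norm_def (u : J α) : ‖u‖ = ‖curl α u‖ := by
  rw [norm_eq_sqrt_re_inner (𝕜 := ℂ), norm_eq_sqrt_re_inner (𝕜 := ℂ) (curl α u), inner_def]

theorem norm_toL2_le (u : J α) : ‖toL2 α u‖ ≤ (√(poincareConst α))⁻¹ * ‖u‖ := by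
  have hc := poincareConst_pos α.1
  have h := Real.sqrt_le_sqrt (poincare_toL2 α u)
  rw [Real.sqrt_mul hc.le, Real.sqrt_sq (norm_nonneg _), Real.sqrt_sq (norm_nonneg _),
    ← norm_def] at h
  rw [inv_mul_eq_div, le_div_iff₀ (Real.sqrt_pos.2 hc), mul_comm]
  exact h

instance : CompleteSpace (J α) := by
  refine Metric.complete_of_cauchySeq_tendsto fun u hu => ?_
  have hG (j : Fin 3) : CauchySeq fun m => weakGrad α.1 (u m) j := by
    let Dj : J α →ₗ[ℂ] L2Cell := LinearMap.proj j ∘ₗ weakGrad α.1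
    have := (Dj.mkContinuous 1 fun v => by
      rw [one_mul, norm_def]; exact norm_weakGrad_le (α := α.1) v j).uniformContinuous
    exact hu.map this
  have hU : CauchySeq fun m => toL2 α (u m) :=
    hu.map ((toL2 α).mkContinuous _ (norm_toL2_le α)).uniformContinuous
  choose G hG' using fun j => cauchySeq_tendsto_of_complete (hG j)
  obtain ⟨w, hw⟩ := cauchySeq_tendsto_of_complete hU
  have hGt : Filter.Tendsto (fun m => weakGrad α.1 (u m)) Filter.atTop (nhds G) :=
    tendsto_pi_nhds.2 hG'
  have hwG (j) : HasWeakPartial α.1 j w (G j) :=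
    (isClosed_hasWeakPartial α.1 j).mem_of_tendsto (hw.prodMk_nhds (hG' j))
      (Filter.Eventually.of_forall fun m => weakGrad_spec (α := α.1) (u m) j)
  have hmem : w ∈ solenoidal α.1 := by
    refine ⟨⟨G, hwG, ?_⟩, fun h => ?_⟩
    · refine tendsto_nhds_unique ((divergence.continuous.tendsto G).comp hGt) ?_
      refine tendsto_const_nhds.congr fun m => ?_
      exact (divergence_weakGrad (α := α.1) (u m)).symm
    · rw [integral_eq_zero_iff]
      intro v
      refine tendsto_nhds_unique (tendsto_const_nhds.inner hw) ?_
      refine tendsto_const_nhds.congr fun m => ?_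
      exact ((integral_eq_zero_iff _).1 ((u m).2.2 h) v).symm
  let W : J α := (⟨w, hmem⟩ : solenoidal α.1)
  refine ⟨W, ?_⟩
  have hg : weakGrad α.1 W = G :=
    funext fun j => (weakGrad_spec (α := α.1) ⟨w, hmem⟩ j).unique (hwG j)
  rw [tendsto_iff_norm_sub_tendsto_zero]
  simp only [norm_def, map_sub]
  rw [← tendsto_iff_norm_sub_tendsto_zero]
  have := (curlOfGrad.continuous.tendsto G).comp hGt
  rw [← hg] at this
  exact this

end J

section Operators

variable (D : Set R3) (α : BrillouinZone)

/-- The embedding of `J_#(α,Y,ℂ³)` into `L²_#(α,Y,ℂ³)`. -/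
def embedL2 : J α →L[ℂ] L2Cell := (J.toL2 α).mkContinuous _ (J.norm_toL2_le α)

/-- The curl as a bounded operator. -/
def curlL : J α →L[ℂ] L2Cell := (J.curl α).mkContinuous 1 fun u => by rw [one_mul, J.norm_def]

/-- The operator `(-Δ_α)⁻¹ : L²_# → J_#`, characterized by `⟨(-Δ_α)⁻¹ f, v⟩ = (f, v)_{L²}` for all
`v ∈ J_#`; see `inner_invLaplacian`. -/
def invLaplacian : L2Cell →L[ℂ] J α := ContinuousLinearMap.adjoint (embedL2 α)

theorem inner_invLaplacian (f : L2Cell) (v : J α) :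
    inner ℂ v (invLaplacian α f) = ∫ x in unitCell, inner ℂ (J.toL2 α v x) (f x) := by
  rw [invLaplacian, ContinuousLinearMap.adjoint_inner_right, L2.inner_def]; rfl

/-- The curl restricted to a subset `S` of the period cell. -/
def curlOn (S : Set R3) : J α →L[ℂ] Lp C3 2 (cellMeasure.restrict S) :=
  (LpToLpRestrictCLM R3 C3 ℂ cellMeasure 2 S).comp (curlL α)

/-- The operator on `J_#` with `⟨E_S u, w⟩ = ∫_S (∇×u) · conj (∇×w)`; see `inner_energyOp`. -/
def energyOp (S : Set R3) : J α →L[ℂ] J α :=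
  (ContinuousLinearMap.adjoint (curlOn α S)).comp (curlOn α S)

theorem inner_energyOp (S : Set R3) (u w : J α) :
    inner ℂ w (energyOp α S u) =
      ∫ x in S, inner ℂ (J.curl α w x) (J.curl α u x) ∂cellMeasure := by
  rw [energyOp, ContinuousLinearMap.comp_apply, ContinuousLinearMap.adjoint_inner_right,
    L2.inner_def]
  refine integral_congr_ae ?_
  filter_upwards [LpToLpRestrictCLM_coeFn ℂ S (curlL α u),
    LpToLpRestrictCLM_coeFn ℂ S (curlL α w)] with x h1 h2
  simp only [curlOn, ContinuousLinearMap.comp_apply]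
  rw [h1, h2]; rfl

/-- The operator `T_k` associated with the sesquilinear form
`B_k(u,w) = k ∫_H (∇×u)·conj(∇×w) + ∫_D (∇×u)·conj(∇×w)`, where `H = Y \ D`. -/
def contrastOp (k : ℂ) : J α →L[ℂ] J α := k • energyOp α (unitCell \ D) + energyOp α D

/-- The fields of `J_#` with `∇×u = 0` in `D`. -/
abbrev W1 : Submodule ℂ (J α) := LinearMap.ker (curlOn α D).toLinearMap
/-- The fields of `J_#` with `∇×u = 0` in `H = Y \ D`. -/
abbrev W2 : Submodule ℂ (J α) := LinearMap.ker (curlOn α (unitCell \ D)).toLinearMap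
/-- The orthogonal complement of `W₁ ⊕ W₂` in `J_#`. -/
abbrev W3 : Submodule ℂ (J α) := (W1 D α ⊔ W2 D α)ᗮ

instance : CompleteSpace (W2 D α) := (curlOn α (unitCell \ D)).completeSpace_ker

/-- The operator with `⟨T u, w⟩ = ½ ∫_H (∇×u)·conj(∇×w) - ½ ∫_D (∇×u)·conj(∇×w)`. -/
def structuralOp : J α →L[ℂ] J α :=
  (1 / 2 : ℂ) • energyOp α (unitCell \ D) - (1 / 2 : ℂ) • energyOp α D

/-- The operator `T^α : W₃ → W₃` given by the form of `structuralOp` on the invariant subspace `W₃`. -/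
def structuralOpW3 : W3 D α →L[ℂ] W3 D α :=
  (W3 D α).orthogonalProjectionOnto.comp ((structuralOp D α).comp (W3 D α).subtypeL)

/-- The quasiperiodic resonance values `{μ_i(α)} = σ(T^α; W₃)`, which are real. -/
def structuralSpectrum : Set ℝ := {μ | (μ : ℂ) ∈ spectrum ℂ (structuralOpW3 D α)}

/-- The lowest resonance value `μ⁻(α)`. -/
def muMinus : ℝ := sInf (structuralSpectrum D α)

/-- `z*(α) = (μ⁻(α) + 1/2) / (μ⁻(α) - 1/2)`. -/
def zStar : ℝ := (muMinus D α + 1 / 2) / (muMinus D α - 1 / 2)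

/-- The operator family `A^α(z)` on `L²_#`: `A^α(z) = T_k⁻¹ (-Δ_α)⁻¹` with `k = 1/z` for `z ≠ 0`, and
`A^α(0) = P₂ (-Δ_α)⁻¹`, where `P₂` is the orthogonal projection of `J_#` onto `W₂`. -/
def solutionOp (z : ℂ) : L2Cell →L[ℂ] L2Cell :=
  if z = 0 then (embedL2 α).comp ((W2 D α).starProjection.comp (invLaplacian α))
  else (embedL2 α).comp ((Ring.inverse (contrastOp D α z⁻¹)).comp (invLaplacian α))

end Operators

/-- A closed, piecewise continuously differentiable curve `γ : [0,1] → ℂ`. -/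
structure IsContour (γ : ℝ → ℂ) : Prop where
  continuousOn : ContinuousOn γ (Set.Icc 0 1)
  closed : γ 0 = γ 1
  piecewise : ∃ F : Finset ℝ, (∀ t ∈ Set.Ioo (0 : ℝ) 1 \ F, DifferentiableAt ℝ γ t) ∧
    ContinuousOn (deriv γ) (Set.Ioo 0 1 \ F) ∧ ∃ C, ∀ t ∈ Set.Ioo (0 : ℝ) 1 \ F, ‖deriv γ t‖ ≤ C

/-- `∮_γ f(ζ) dζ`. -/
def contourIntegral {E : Type*} [NormedAddCommGroup E] [NormedSpace ℂ E]
    (γ : ℝ → ℂ) (f : ℂ → E) : E := ∫ t in (0 : ℝ)..1, deriv γ t • f (γ t)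

/-- The winding number of `γ` about `w`. -/
def windingNumber (γ : ℝ → ℂ) (w : ℂ) : ℂ :=
  (2 * Real.pi * Complex.I)⁻¹ * contourIntegral γ fun ζ => (ζ - w)⁻¹

/-- `γ` is a closed contour that avoids `σ`, winds once (counterclockwise) about `β`, and does not wind
about any other point of `σ`. -/
structure Isolates (γ : ℝ → ℂ) (β : ℂ) (σ : Set ℂ) : Prop where
  isContour : IsContour γ
  disjoint : Disjoint (γ '' Set.Icc 0 1) σ
  inside : windingNumber γ β = 1
  outside : ∀ w ∈ σ, w ≠ β → windingNumber γ w = 0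

/-- The distance `inf_{ζ ∈ γ} dist(ζ, σ)` between the contour and `σ`. -/
def contourGap (γ : ℝ → ℂ) (σ : Set ℂ) : ℝ :=
  sInf ((fun ζ => Metric.infDist ζ σ) '' (γ '' Set.Icc 0 1))

/-- The trace of a finite rank operator: the trace of its restriction to its range. -/
def finiteRankTrace (T : L2Cell →L[ℂ] L2Cell) : ℂ :=
  LinearMap.trace ℂ T.range (T.toLinearMap.rangeRestrict ∘ₗ T.range.subtype)

section EigenvalueGroup

variable (D : Set R3) (α : BrillouinZone)

/-- The resolvent `R(ζ,z) = (A^α(z) - ζ)⁻¹`. -/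
def resolventOp (ζ z : ℂ) : L2Cell →L[ℂ] L2Cell :=
  Ring.inverse (solutionOp D α z - ζ • ContinuousLinearMap.id ℂ L2Cell)

/-- The spectral projection `P(z) = -(2πi)⁻¹ ∮_γ R(ζ,z) dζ`. -/
def spectralProj (γ : ℝ → ℂ) (z : ℂ) : L2Cell →L[ℂ] L2Cell :=
  (-(2 * Real.pi * Complex.I)⁻¹ : ℂ) • contourIntegral γ fun ζ => resolventOp D α ζ z

/-- The dimension `m` of the range of `P(0)`. -/
def groupDim (γ : ℝ → ℂ) : ℕ := Module.finrank ℂ (spectralProj D α γ 0).range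

/-- The weighted mean `m⁻¹ tr (A^α(z) P(z))` of the eigenvalue group. -/
def weightedMean (γ : ℝ → ℂ) (z : ℂ) : ℂ :=
  (groupDim D α γ : ℂ)⁻¹ * finiteRankTrace ((solutionOp D α z).comp (spectralProj D α γ z))

/-- The Taylor coefficient `A_n` in `A^α(z) = A^α(0) + ∑_{n ≥ 1} zⁿ A_n`. -/
def opCoef (n : ℕ) : L2Cell →L[ℂ] L2Cell :=
  (n.factorial : ℂ)⁻¹ • iteratedDeriv n (solutionOp D α) 0

/-- The coefficients of the eigenvalue series `β₀ + ∑_{n ≥ 1} zⁿ β_n`, with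
`β_n = (2πi m)⁻¹ tr ∑_{k₁+⋯+k_p=n} (-1)^p / p ∮_γ A_{k₁} R(ζ,0) A_{k₂} R(ζ,0) ⋯ A_{k_p} R(ζ,0) dζ`,
the sum running over all ordered partitions of `n` into positive integers. -/
def seriesCoef (β₀ : ℂ) (γ : ℝ → ℂ) (n : ℕ) : ℂ :=
  if n = 0 then β₀ else
    (2 * Real.pi * Complex.I * (groupDim D α γ : ℂ))⁻¹ *
      finiteRankTrace (∑ c : Composition n, ((-1 : ℂ) ^ c.length / (c.length : ℂ)) •
        contourIntegral γ fun ζ => (c.blocks.map fun k => opCoef D α k * resolventOp D α ζ 0).prod)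

/-- `r* = c d |z*(α)| / (1 / (1/2 - μ⁻(α)) + c d)`. -/
def convRadius (c d : ℝ) : ℝ :=
  c * d * |zStar D α| / (1 / (1 / 2 - muMinus D α) + c * d)

end EigenvalueGroup

end PhotonicCrystal

end

open PhotonicCrystal

/-! Let `E` be the energy operator of the host, `Q` the projection onto `W2`, `e` the embedding of
`J` into `L2Cell`, `c` the Poincaré constant and `s = μ⁻ + 1/2`. Since host and inclusions fill the
cell, the contrast operator is `z⁻¹ E + (1 - E)`. It is the identity on `W2`, where `E = 0`; on the
complement of `W2` one has `s ≤ E ≤ 1`, so `E + z (1 - E)` has real part at least `s - |z| (1 - s)`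
there. Hence the inverse is `Q + z S(z)` with `S` holomorphic for `|z| < s / (1 - s) = |z*|` and
`‖S(z)‖ ≤ 1 / (s - |z| (1 - s))` (`GappedForm.ringInverse_contrast`, `GappedForm.norm_reduced_le`).
Sandwiching between `e` and its adjoint costs a factor `1 / c`, and the resulting bound on `‖A(z) -
A(0)‖` is below `d` exactly for `|z| < r*`. This is where the radius comes from
(`GappedForm.holomorphicFamily`).

As `A(0)` is self-adjoint, its resolvent on the contour has norm at most `1 / d`, so the resolvent
of `A(z)` exists on the contour for `|z| < r*` and the projection `P(z)` is holomorphic there. Every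
spectral point of `A(z)` is closer than `d` to some spectral point of `A(0)`, and winding numbers do
not change over that distance; so the eigenvalues selected by `P(z)` lie within `d` of `β₀`
(`HolomorphicFamily.norm_opTrace_sub_mul_proj_le`). The weighted mean minus `β₀` is therefore
holomorphic, bounded by `d` and zero at the origin. Cauchy's estimates and a geometric tail give the
error bound (`norm_sub_taylor_le`).

It remains to identify the Taylor coefficients. Up to the factor `-1 / (2πi)`, the operator `(A(z) -
β₀) P(z)` is the contour integral of `(ζ - β₀) R(ζ, z)`, and the coefficients of `R` are alternating
sums of words over compositions (`HolomorphicFamily.taylorCoef_resolvent`). Integrating a word of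
length `q` by parts gives `q` terms, which under the trace are the rotations of one cyclic word;
this produces the weight `(-1)^q / q` (`IsolatedPoint.trace_sum_composition`).

Moving factors cyclically under the trace needs care, because the integrands are not of finite rank.
Integrands are treated as elements of the Banach algebra of continuous paths and split into a
principal part at `β₀` with finite rank coefficients and a regular part with vanishing integral
(`IsolatedPoint.trace_contourCLM_mul_comm`). The contour is known only through its winding numbers,
so Cauchy's theorem enters through primitives, partial fractions and uniform approximation. -/

namespace PhotonicCrystal

/-! ### Contour integration as a bounded linear map on continuous paths. -/

section Contour

variable {E F : Type*} [NormedAddCommGroup E] [NormedSpace ℂ E]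
  [NormedAddCommGroup F] [NormedSpace ℂ F]

theorem IsContour.exists_bound {γ : ℝ → ℂ} (hγ : IsContour γ) :
    ∃ C, 0 ≤ C ∧ ∀ᵐ t ∂(volume.restrict (Set.uIoc (0 : ℝ) 1)), ‖deriv γ t‖ ≤ C := by
  obtain ⟨F, -, -, C, hC⟩ := hγ.piecewise
  refine ⟨max C 0, le_max_right _ _, ?_⟩
  rw [Set.uIoc_of_le zero_le_one, ae_restrict_iff' measurableSet_Ioc]
  have hF : ∀ᵐ t : ℝ, t ∉ (F : Set ℝ) := F.finite_toSet.countable.ae_notMem _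
  have h1 : ∀ᵐ t : ℝ, t ∉ ({1} : Set ℝ) := (Set.countable_singleton 1).ae_notMem _
  filter_upwards [hF, h1] with t h1 h2 h3
  exact (hC t ⟨⟨h3.1, lt_of_le_of_ne h3.2 h2⟩, h1⟩).trans (le_max_left _ _)

theorem IsContour.intervalIntegrable {γ : ℝ → ℂ} (hγ : IsContour γ) {f : ℝ → E}
    (hf : ContinuousOn f (Set.Icc 0 1)) :
    IntervalIntegrable (fun t => deriv γ t • f t) volume 0 1 := by
  obtain ⟨C, -, hC⟩ := hγ.exists_bound
  have h1 : IntervalIntegrable f volume 0 1 := by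
    apply ContinuousOn.intervalIntegrable
    rwa [Set.uIcc_of_le zero_le_one]
  rw [intervalIntegrable_iff] at h1 ⊢
  exact h1.bdd_smul (C := C) (measurable_deriv γ).aestronglyMeasurable hC

/-- The integral `∫₀¹ γ'(t) F(t) dt` along a contour, as a continuous linear functional of `F`. -/
noncomputable def contourCLM {γ : ℝ → ℂ} (hγ : IsContour γ) : C(unitInterval, E) →L[ℂ] E :=
  LinearMap.mkContinuousOfExistsBound
    { toFun := fun F => ∫ t in (0 : ℝ)..1, deriv γ t • F (Set.projIcc 0 1 zero_le_one t)
      map_add' := fun F G => by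
        simp only [ContinuousMap.add_apply, smul_add]
        refine intervalIntegral.integral_add ?_ ?_ <;>
        exact hγ.intervalIntegrable (by fun_prop)
      map_smul' := fun c F => by
        simp only [ContinuousMap.smul_apply, RingHom.id_apply]
        rw [← intervalIntegral.integral_smul]
        exact intervalIntegral.integral_congr fun t _ => smul_comm _ _ _ }
    (by
      obtain ⟨C, hC0, hC⟩ := hγ.exists_bound
      refine ⟨C, fun F => ?_⟩
      have := intervalIntegral.norm_integral_le_of_norm_le_const_ae
        (f := fun t => deriv γ t • F (Set.projIcc 0 1 zero_le_one t)) (a := 0) (b := 1)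
        (C := C * ‖F‖) ?_
      · simpa using this
      · rw [ae_restrict_iff' measurableSet_uIoc] at hC
        filter_upwards [hC] with t ht h
        rw [norm_smul]
        exact mul_le_mul (ht h) (F.norm_coe_le_norm _) (norm_nonneg _) hC0)

theorem contourCLM_eq {γ : ℝ → ℂ} (hγ : IsContour γ) (F : C(unitInterval, E)) {f : ℂ → E}
    (h : ∀ t : unitInterval, F t = f (γ t)) : contourCLM hγ F = contourIntegral γ f := by
  refine intervalIntegral.integral_congr fun t ht => ?_
  rw [Set.uIcc_of_le zero_le_one] at ht
  simp only [Set.projIcc_of_mem _ ht, h]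

theorem contourCLM_comp [CompleteSpace E] [CompleteSpace F] {γ : ℝ → ℂ} (hγ : IsContour γ)
    (L : E →L[ℂ] F) (f : C(unitInterval, E)) :
    contourCLM hγ ((L : C(E, F)).comp f) = L (contourCLM hγ f) := by
  change _ = L (∫ t in (0 : ℝ)..1, _)
  rw [← L.intervalIntegral_comp_comm]
  · refine intervalIntegral.integral_congr fun t _ => ?_
    simp
  · exact hγ.intervalIntegrable (by fun_prop)

/-- The path of a contour as a continuous function on the unit interval. -/
def IsContour.path {γ : ℝ → ℂ} (hγ : IsContour γ) : C(unitInterval, ℂ) :=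
  ⟨fun t => γ t, hγ.continuousOn.domRestrict⟩

@[simp] theorem IsContour.path_apply {γ : ℝ → ℂ} (hγ : IsContour γ) (t : unitInterval) :
    hγ.path t = γ t := rfl

/-- The fundamental theorem of calculus tolerates the finitely many corners, and the endpoints
coincide. This is the basic form of Cauchy's theorem used here; the other vanishing results are
reduced to it. -/
theorem contourIntegral_deriv_eq_zero [CompleteSpace E] {γ : ℝ → ℂ} (hγ : IsContour γ)
    {f f' : ℂ → E} (hf : ∀ t ∈ Set.Icc (0 : ℝ) 1, HasDerivAt f (f' (γ t)) (γ t))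
    (hc : ContinuousOn (fun t => f' (γ t)) (Set.Icc 0 1)) : contourIntegral γ f' = 0 := by
  obtain ⟨F, hF, -, -⟩ := hγ.piecewise
  have := integral_eq_of_hasDerivAt_off_countable (fun t => f (γ t))
    (fun t => deriv γ t • f' (γ t)) (a := 0) (b := 1) F.countable_toSet ?_ ?_ ?_
  · rw [contourIntegral, this, hγ.closed, sub_self]
  · rw [Set.uIcc_of_le zero_le_one]
    intro t ht
    exact (hf t ht).continuousAt.comp_continuousWithinAt (hγ.continuousOn t ht)
  · rw [min_eq_left zero_le_one, max_eq_right zero_le_one]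
    intro t ht
    have := (hf t ⟨ht.1.1.le, ht.1.2.le⟩).scomp t (hF t ht).hasDerivAt
    exact this
  · exact hγ.intervalIntegrable hc

end Contour

/-! ### Winding numbers and integrals of products of Cauchy kernels. -/

section Winding

variable {γ : ℝ → ℂ}

/-- The function `t ↦ (γ t - w)⁻¹` for a point `w` off the contour. -/
noncomputable def cauchyKernel (hγ : IsContour γ) (w : ℂ) (hw : w ∉ γ '' Set.Icc 0 1) : C(unitInterval, ℂ) :=
  ⟨fun t => (γ t - w)⁻¹, (hγ.path.continuous.sub continuous_const).inv₀
    fun t h => hw ⟨t, t.2, sub_eq_zero.1 h⟩⟩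

@[simp] theorem cauchyKernel_apply (hγ : IsContour γ) (w : ℂ) (hw : w ∉ γ '' Set.Icc 0 1)
    (t : unitInterval) : cauchyKernel hγ w hw t = (γ t - w)⁻¹ := rfl

theorem contourCLM_cauchyKernel (hγ : IsContour γ) (w : ℂ) (hw : w ∉ γ '' Set.Icc 0 1) :
    contourCLM hγ (cauchyKernel hγ w hw) = 2 * Real.pi * Complex.I * windingNumber γ w := by
  rw [contourCLM_eq (f := fun ζ => (ζ - w)⁻¹) hγ _ fun t => rfl, windingNumber,
    mul_inv_cancel_left₀ Complex.two_pi_I_ne_zero]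

/-- A pole of order at least two has a single-valued primitive. -/
theorem contourCLM_cauchyKernel_pow (hγ : IsContour γ) (w : ℂ) (hw : w ∉ γ '' Set.Icc 0 1)
    (k : ℕ) : contourCLM hγ (cauchyKernel hγ w hw ^ (k + 2)) = 0 := by
  rw [contourCLM_eq (f := fun ζ => (ζ - w)⁻¹ ^ (k + 2)) hγ _ fun t => by simp]
  refine contourIntegral_deriv_eq_zero hγ (f := fun ζ => -(k + 1 : ℂ)⁻¹ * (ζ - w)⁻¹ ^ (k + 1))
    (fun t ht => ?_) ?_
  · have h0 : γ t - w ≠ 0 := fun h => hw ⟨t, ht, sub_eq_zero.1 h⟩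
    have hk : (k + 1 : ℂ) ≠ 0 := by exact_mod_cast k.succ_ne_zero
    have h1 := (((hasDerivAt_id (γ t)).sub_const w).inv h0).pow (k + 1) |>.const_mul
      (-(k + 1 : ℂ)⁻¹)
    refine h1.congr_deriv ?_
    simp only [id, Nat.add_sub_cancel, Pi.inv_apply, inv_pow]
    push_cast
    field_simp
    ring
  · intro t ht
    have h0 : γ t - w ≠ 0 := fun h => hw ⟨t, ht, sub_eq_zero.1 h⟩
    exact (((hγ.continuousOn t ht).sub continuousWithinAt_const).inv₀ h0).pow _

theorem contourCLM_one {E : Type*} [NormedRing E] [NormedAlgebra ℂ E] [CompleteSpace E]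
    (hγ : IsContour γ) :
    contourCLM hγ (1 : C(unitInterval, E)) = 0 := by
  rw [contourCLM_eq (f := fun _ => (1 : E)) hγ _ fun t => rfl]
  refine contourIntegral_deriv_eq_zero hγ (f := fun ζ => ζ • (1 : E)) (fun t _ => ?_)
    continuousOn_const
  simpa using (hasDerivAt_id (γ t)).smul_const (1 : E)

/-- The geometric series of `1 / (ζ - w)` in powers of `(w - x) / (ζ - x)` converges uniformly on
the contour, and all its terms but the first are higher poles with integral zero. No homotopy
argument and no integrality of winding numbers is needed. -/
theorem windingNumber_eq_of_dist_lt (hγ : IsContour γ) {x w : ℂ} {δ : ℝ}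
    (hx : ∀ t ∈ Set.Icc (0 : ℝ) 1, δ ≤ ‖γ t - x‖) (hw : ‖w - x‖ < δ) :
    windingNumber γ w = windingNumber γ x := by
  have hδ : 0 < δ := (norm_nonneg _).trans_lt hw
  have hx' : x ∉ γ '' Set.Icc 0 1 := by
    rintro ⟨t, ht, rfl⟩
    have := hx t ht
    rw [sub_self, norm_zero] at this
    linarith
  have hw' : w ∉ γ '' Set.Icc 0 1 := by
    rintro ⟨t, ht, rfl⟩
    exact absurd (hx t ht) (not_le.2 hw)
  set v := cauchyKernel hγ x hx'
  have hv : ‖(w - x) • v‖ < 1 := by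
    rw [norm_smul]
    have : ‖v‖ ≤ δ⁻¹ := by
      rw [ContinuousMap.norm_le _ (by positivity)]
      intro t
      rw [cauchyKernel_apply, norm_inv]
      exact inv_anti₀ hδ (hx t t.2)
    calc ‖w - x‖ * ‖v‖ ≤ ‖w - x‖ * δ⁻¹ := by gcongr
      _ < δ * δ⁻¹ := by gcongr
      _ = 1 := mul_inv_cancel₀ hδ.ne'
  have hs : HasSum (fun k : ℕ => v * ((w - x) • v) ^ k) (cauchyKernel hγ w hw') := by
    have h1 := (summable_geometric_of_norm_lt_one hv).hasSum.mul_left v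
    have h2 := mul_neg_geom_series ((w - x) • v) hv
    have h3 : cauchyKernel hγ w hw' * (1 - (w - x) • v) = v := by
      ext t
      have h0 : γ t - w ≠ 0 := fun h => hw' ⟨t, t.2, sub_eq_zero.1 h⟩
      have h0' : γ t - x ≠ 0 := fun h => hx' ⟨t, t.2, sub_eq_zero.1 h⟩
      simp only [ContinuousMap.mul_apply, ContinuousMap.sub_apply, ContinuousMap.one_apply,
        ContinuousMap.smul_apply, cauchyKernel_apply, v, smul_eq_mul]
      field_simp
      ring
    have h4 : v * ∑' i : ℕ, ((w - x) • v) ^ i = cauchyKernel hγ w hw' := by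
      conv_lhs => rw [← h3, mul_assoc]
      rw [h3, h2, mul_one]
    rwa [h4] at h1
  have h4 := hs.mapL (contourCLM hγ)
  have h5 : HasSum (fun k : ℕ => contourCLM hγ (v * ((w - x) • v) ^ k)) (contourCLM hγ v) := by
    convert hasSum_single 0 fun k hk => ?_
    · simp
    · obtain ⟨k, rfl⟩ := Nat.exists_eq_succ_of_ne_zero hk
      rw [smul_pow, mul_smul_comm, map_smul, ← pow_succ', contourCLM_cauchyKernel_pow, smul_zero]
  have h6 := h4.unique h5
  rw [contourCLM_cauchyKernel, contourCLM_cauchyKernel] at h6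
  exact mul_left_cancel₀ Complex.two_pi_I_ne_zero h6

/-- A product of Cauchy kernels whose poles all have winding number zero has integral zero. -/
theorem contourCLM_prod_eq_zero (hγ : IsContour γ) (K : Set ℂ)
    (hK : ∀ w ∈ K, w ∉ γ '' Set.Icc 0 1) (h0 : ∀ w ∈ K, windingNumber γ w = 0) :
    ∀ (l : List K), contourCLM hγ (l.map fun w : K => cauchyKernel hγ w (hK w w.2)).prod = 0 := by
  intro l
  induction hn : l.length using Nat.strong_induction_on generalizing l with
  | _ n ih =>
  -- If all poles agree, the product is a power of one kernel: the empty power and the higher powers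
  -- have primitives, and the first power gives the winding number. Two distinct poles are separated
  -- by partial fractions, and each of the two terms has one factor fewer.
  by_cases hc : ∀ a ∈ l, ∀ b ∈ l, a = b
  · rcases l with _ | ⟨a, l⟩
    · simpa using contourCLM_one hγ
    · have : (a :: l) = List.replicate (l.length + 1) a :=
        List.eq_replicate_iff.2 ⟨rfl, fun b hb => hc b hb a (by simp)⟩
      rw [this, List.map_replicate, List.prod_replicate]
      rcases l with _ | ⟨b, l⟩
      · simp [contourCLM_cauchyKernel, h0 a a.2]
      · exact contourCLM_cauchyKernel_pow hγ _ _ _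
  · push Not at hc
    obtain ⟨a, ha, b, hb, hab⟩ := hc
    obtain ⟨l', hl'⟩ : ∃ l', l.Perm (a :: b :: l') := by
      have h1 := List.perm_cons_erase ha
      have hb' : b ∈ l.erase a := (List.mem_erase_of_ne (Ne.symm hab)).2 hb
      exact ⟨_, h1.trans ((List.perm_cons_erase hb').cons a)⟩
    have hlen := hl'.length_eq
    simp only [List.length_cons] at hlen
    rw [(hl'.map _).prod_eq]
    have key : cauchyKernel hγ a (hK a a.2) * cauchyKernel hγ b (hK b b.2) =
        ((a : ℂ) - b)⁻¹ • (cauchyKernel hγ a (hK a a.2) - cauchyKernel hγ b (hK b b.2)) := by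
      have hab' : (a : ℂ) - b ≠ 0 := sub_ne_zero.2 fun h => hab (Subtype.ext h)
      ext t
      have h1 : γ t - a ≠ 0 := fun h => hK a a.2 ⟨t, t.2, sub_eq_zero.1 h⟩
      have h2 : γ t - b ≠ 0 := fun h => hK b b.2 ⟨t, t.2, sub_eq_zero.1 h⟩
      simp only [ContinuousMap.mul_apply, ContinuousMap.sub_apply, ContinuousMap.smul_apply,
        cauchyKernel_apply, smul_eq_mul]
      field_simp
      ring
    have e1 := ih (l'.length + 1) (by omega) (a :: l') rfl
    have e2 := ih (l'.length + 1) (by omega) (b :: l') rfl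
    simp only [List.map_cons, List.prod_cons] at e1 e2 ⊢
    rw [← mul_assoc, key, smul_mul_assoc, sub_mul, map_smul, map_sub, e1, e2, sub_zero, smul_zero]

end Winding
/-- A continuous map from a compact space into a normed space is uniformly approximated by finite
sums of continuous functions times values of the map. -/
theorem exists_sum_smul_approx {X V : Type*} [TopologicalSpace X] [CompactSpace X] [T2Space X]
    [NormedAddCommGroup V] [NormedSpace ℂ V] (F : C(X, V)) {ε : ℝ} (hε : 0 < ε) :
    ∃ (ι : Type) (_ : Fintype ι) (φ : ι → C(X, ℂ)) (x : ι → X),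
      ∀ y, ‖F y - ∑ i, φ i y • F (x i)‖ ≤ ε := by
  obtain ⟨s, -, hs⟩ := isCompact_univ.elim_nhds_subcover (fun x => F ⁻¹' Metric.ball (F x) ε)
    fun x _ => (F.continuous.continuousAt).preimage_mem_nhds (Metric.ball_mem_nhds _ hε)
  -- The coefficient functions form a partition of unity subordinate to sets on which `F` stays
  -- within `ε` of a sample value.
  obtain ⟨f, hf⟩ := PartitionOfUnity.exists_isSubordinate (ι := s) isClosed_univ
    (fun i => F ⁻¹' Metric.ball (F i) ε) (fun i => Metric.isOpen_ball.preimage F.continuous)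
    (by
      intro y hy
      have := hs hy
      simp only [Set.mem_iUnion] at this ⊢
      obtain ⟨i, hi, h⟩ := this
      exact ⟨⟨i, hi⟩, h⟩)
  refine ⟨Fin s.card, inferInstance, fun i => (Complex.ofRealCLM : C(ℝ, ℂ)).comp (f (s.equivFin.symm i)),
    fun i => s.equivFin.symm i, fun y => ?_⟩
  have h1 : ∑ i, f i y = 1 := by
    have := f.sum_eq_one (Set.mem_univ y)
    rwa [finsum_eq_sum_of_fintype] at this
  have e : ∑ i, ((Complex.ofRealCLM : C(ℝ, ℂ)).comp (f (s.equivFin.symm i))) y • F (s.equivFin.symm i) =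
      ∑ i : s, (f i y : ℂ) • F i :=
    Equiv.sum_comp s.equivFin.symm (fun i : s => (f i y : ℂ) • F i)
  rw [e]
  have h2 : F y = ∑ i : s, (f i y : ℂ) • F y := by
    rw [← Finset.sum_smul, ← Complex.ofReal_sum, h1, Complex.ofReal_one, one_smul]
  rw [h2, ← Finset.sum_sub_distrib]
  calc ‖∑ i : s, ((f i y : ℂ) • F y - (f i y : ℂ) • F i)‖
      ≤ ∑ i : s, ‖(f i y : ℂ) • F y - (f i y : ℂ) • F i‖ := norm_sum_le _ _
    _ ≤ ∑ i : s, f i y * ε := by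
        refine Finset.sum_le_sum fun i _ => ?_
        rw [← smul_sub, norm_smul, Complex.norm_real, Real.norm_of_nonneg (f.nonneg i y)]
        by_cases h : f i y = 0
        · simp [h]
        · refine mul_le_mul_of_nonneg_left ?_ (f.nonneg i y)
          have : y ∈ F ⁻¹' Metric.ball (F i) ε := hf i (subset_tsupport _ h)
          exact (mem_ball_iff_norm.1 this).le
    _ = ε := by rw [← Finset.sum_mul, h1, one_mul]

/-! ### The Banach algebra of paths: constants and scalar functions. -/

section Paths

variable {A : Type*} [NormedRing A] [NormedAlgebra ℂ A]

/-- The constant paths. -/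
def constPath : A →ₐ[ℂ] C(unitInterval, A) where
  toFun a := ContinuousMap.const _ a
  map_one' := rfl
  map_mul' _ _ := rfl
  map_zero' := rfl
  map_add' _ _ := rfl
  commutes' _ := rfl

@[simp] theorem constPath_apply (a : A) (t : unitInterval) : constPath a t = a := rfl

/-- The paths of scalars. -/
noncomputable def scalarPath : C(unitInterval, ℂ) →ₐ[ℂ] C(unitInterval, A) :=
  AlgHom.compLeftContinuous ℂ (Algebra.ofId ℂ A) (algebraMapCLM ℂ A).continuous

@[simp] theorem scalarPath_apply (f : C(unitInterval, ℂ)) (t : unitInterval) :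
    (scalarPath f : C(unitInterval, A)) t = algebraMap ℂ A (f t) := rfl

theorem scalarPath_mul_comm (f : C(unitInterval, ℂ)) (F : C(unitInterval, A)) :
    scalarPath f * F = F * scalarPath f := by
  ext t; exact Algebra.commutes _ _

theorem contourCLM_scalarPath_mul_constPath [CompleteSpace A] {γ : ℝ → ℂ} (hγ : IsContour γ)
    (f : C(unitInterval, ℂ)) (a : A) :
    contourCLM hγ (scalarPath f * constPath a) = contourCLM hγ f • a := by
  rw [show contourCLM hγ f • a = (ContinuousLinearMap.toSpanSingleton ℂ a) (contourCLM hγ f) from rfl,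
    ← contourCLM_comp]
  congr 1
  ext t
  simp [Algebra.smul_def]

theorem contourCLM_constPath_mul [CompleteSpace A] {γ : ℝ → ℂ} (hγ : IsContour γ)
    (a : A) (F : C(unitInterval, A)) :
    contourCLM hγ (constPath a * F) = a * contourCLM hγ F :=
  contourCLM_comp hγ (ContinuousLinearMap.mul ℂ A a) F

theorem contourCLM_mul_constPath [CompleteSpace A] {γ : ℝ → ℂ} (hγ : IsContour γ)
    (a : A) (F : C(unitInterval, A)) :
    contourCLM hγ (F * constPath a) = contourCLM hγ F * a :=
  contourCLM_comp hγ ((ContinuousLinearMap.mul ℂ A).flip a) F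

end Paths

/-! ### The resolvent of a normal element through the functional calculus. -/

section Resolvent

variable {A : Type*} [CStarAlgebra A] {a : A}

/-- The function `(t, x) ↦ (x - γ t)⁻¹` on the spectrum of `a`. -/
noncomputable def spectralKernel {γ : ℝ → ℂ} (hγ : IsContour γ)
    (hd : Disjoint (γ '' Set.Icc 0 1) (spectrum ℂ a)) :
    C(unitInterval, C(spectrum ℂ a, ℂ)) :=
  ContinuousMap.curry ⟨fun p => ((p.2 : ℂ) - γ p.1)⁻¹,
    ((continuous_subtype_val.comp continuous_snd).sub
      (hγ.path.continuous.comp continuous_fst)).inv₀ fun p h =>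
        Set.disjoint_left.1 hd ⟨p.1, p.1.2, rfl⟩ (by
          have h' : (p.2 : ℂ) = γ p.1 := sub_eq_zero.1 h
          rw [← h']; exact p.2.2)⟩

@[simp] theorem spectralKernel_apply {γ : ℝ → ℂ} (hγ : IsContour γ)
    (hd : Disjoint (γ '' Set.Icc 0 1) (spectrum ℂ a)) (t : unitInterval) (x : spectrum ℂ a) :
    spectralKernel hγ hd t x = ((x : ℂ) - γ t)⁻¹ := rfl

/-- The continuous functional calculus as a continuous linear map. -/
noncomputable def cfcCLM (ha : IsStarNormal a) : C(spectrum ℂ a, ℂ) →L[ℂ] A :=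
  ⟨(cfcHom (R := ℂ) ha).toAlgHom.toLinearMap, cfcHom_continuous ha⟩

theorem cfcCLM_mul (ha : IsStarNormal a) (f g : C(spectrum ℂ a, ℂ)) :
    cfcCLM ha (f * g) = cfcCLM ha f * cfcCLM ha g := map_mul (cfcHom ha) f g

theorem cfcCLM_id (ha : IsStarNormal a) :
    cfcCLM ha ((ContinuousMap.id ℂ).restrict (spectrum ℂ a)) = a := cfcHom_id ha

theorem norm_cfcCLM (ha : IsStarNormal a) (f : C(spectrum ℂ a, ℂ)) : ‖cfcCLM ha f‖ = ‖f‖ :=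
  norm_cfcHom a f

/-- Pathwise functional calculus. -/
noncomputable def cfcPath (ha : IsStarNormal a) :
    C(unitInterval, C(spectrum ℂ a, ℂ)) →ₐ[ℂ] C(unitInterval, A) :=
  AlgHom.compLeftContinuous ℂ (cfcHom (R := ℂ) ha).toAlgHom (cfcHom_continuous ha)

theorem cfcPath_apply (ha : IsStarNormal a) (F : C(unitInterval, C(spectrum ℂ a, ℂ)))
    (t : unitInterval) : cfcPath ha F t = cfcCLM ha (F t) := rfl

theorem cfcPath_constPath (ha : IsStarNormal a) (f : C(spectrum ℂ a, ℂ)) :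
    cfcPath ha (constPath f) = constPath (cfcCLM ha f) := rfl

theorem cfcPath_scalarPath (ha : IsStarNormal a) (f : C(unitInterval, ℂ)) :
    cfcPath ha (scalarPath f) = scalarPath f := by
  ext t
  exact (cfcHom (R := ℂ) ha).toAlgHom.commutes (f t)

/-- The resolvent of a normal element along a contour. -/
noncomputable def resolventPath (ha : IsStarNormal a) {γ : ℝ → ℂ} (hγ : IsContour γ)
    (hd : Disjoint (γ '' Set.Icc 0 1) (spectrum ℂ a)) : C(unitInterval, A) :=
  cfcPath ha (spectralKernel hγ hd)

theorem sub_mul_resolventPath (ha : IsStarNormal a) {γ : ℝ → ℂ} (hγ : IsContour γ)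
    (hd : Disjoint (γ '' Set.Icc 0 1) (spectrum ℂ a)) :
    (constPath a - scalarPath hγ.path) * resolventPath ha hγ hd = 1 := by
  have e : (constPath a - scalarPath hγ.path : C(unitInterval, A)) =
      cfcPath ha (constPath ((ContinuousMap.id ℂ).restrict (spectrum ℂ a)) -
        scalarPath hγ.path) := by
    rw [map_sub, cfcPath_constPath, cfcCLM_id, cfcPath_scalarPath]
  rw [e, resolventPath, ← map_mul, ← map_one (cfcPath ha)]
  congr 1
  ext t x
  have : (x : ℂ) - γ t ≠ 0 := fun h => Set.disjoint_left.1 hd ⟨t, t.2, rfl⟩ (by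
    rw [sub_eq_zero] at h; rw [← h]; exact x.2)
  exact mul_inv_cancel₀ this

theorem resolventPath_mul_sub (ha : IsStarNormal a) {γ : ℝ → ℂ} (hγ : IsContour γ)
    (hd : Disjoint (γ '' Set.Icc 0 1) (spectrum ℂ a)) :
    resolventPath ha hγ hd * (constPath a - scalarPath hγ.path) = 1 := by
  have e : (constPath a - scalarPath hγ.path : C(unitInterval, A)) =
      cfcPath ha (constPath ((ContinuousMap.id ℂ).restrict (spectrum ℂ a)) -
        scalarPath hγ.path) := by
    rw [map_sub, cfcPath_constPath, cfcCLM_id, cfcPath_scalarPath]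
  rw [← sub_mul_resolventPath ha hγ hd, e, resolventPath, ← map_mul, ← map_mul, mul_comm]

/-- The functional calculus of a normal element is isometric, so the resolvent is no larger than the
reciprocal distance to the spectrum. Without normality the gap `δ` would not control it. -/
theorem norm_resolventPath_le (ha : IsStarNormal a) {γ : ℝ → ℂ} (hγ : IsContour γ)
    (hd : Disjoint (γ '' Set.Icc 0 1) (spectrum ℂ a)) {δ : ℝ} (hδ : 0 < δ)
    (h : ∀ t ∈ Set.Icc (0 : ℝ) 1, ∀ x ∈ spectrum ℂ a, δ ≤ ‖γ t - x‖) :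
    ‖resolventPath ha hγ hd‖ ≤ δ⁻¹ := by
  rw [ContinuousMap.norm_le _ (by positivity)]
  intro t
  rw [resolventPath, cfcPath_apply, norm_cfcCLM, ContinuousMap.norm_le _ (by positivity)]
  intro x
  rw [spectralKernel_apply, norm_inv, norm_sub_rev]
  exact inv_anti₀ hδ (h t t.2 x x.2)

/-- The integral of the resolvent is the functional calculus of the winding number. -/
theorem contourCLM_resolventPath (ha : IsStarNormal a) {γ : ℝ → ℂ} (hγ : IsContour γ)
    (hd : Disjoint (γ '' Set.Icc 0 1) (spectrum ℂ a)) :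
    ∃ w : C(spectrum ℂ a, ℂ), (∀ x, w x = windingNumber γ x) ∧
      (-(2 * Real.pi * Complex.I)⁻¹ : ℂ) • contourCLM hγ (resolventPath ha hγ hd) =
        cfcCLM ha w := by
  refine ⟨(-(2 * Real.pi * Complex.I)⁻¹ : ℂ) • contourCLM hγ (spectralKernel hγ hd),
    fun x => ?_, ?_⟩
  · have hx : (x : ℂ) ∉ γ '' Set.Icc 0 1 := fun h => Set.disjoint_left.1 hd h x.2
    -- Evaluation at a spectral point is bounded, so it passes under the integral and leaves a
    -- scalar Cauchy integral.
    have h1 := contourCLM_comp hγ (ContinuousMap.evalCLM ℂ x) (spectralKernel hγ hd)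
    have h2 : ((ContinuousMap.evalCLM ℂ x : C(spectrum ℂ a, ℂ) →L[ℂ] ℂ) :
        C(C(spectrum ℂ a, ℂ), ℂ)).comp (spectralKernel hγ hd) = -cauchyKernel hγ x hx := by
      ext t
      change ((x : ℂ) - γ t)⁻¹ = -(γ t - x)⁻¹
      rw [← inv_neg, neg_sub]
    rw [h2, map_neg, contourCLM_cauchyKernel] at h1
    change (-(2 * Real.pi * Complex.I)⁻¹ : ℂ) *
      (ContinuousMap.evalCLM ℂ x : C(spectrum ℂ a, ℂ) →L[ℂ] ℂ) (contourCLM hγ (spectralKernel hγ hd)) = _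
    rw [← h1, neg_mul_neg, inv_mul_cancel_left₀ Complex.two_pi_I_ne_zero]
  · rw [map_smul, ← contourCLM_comp]
    rfl

end Resolvent

/-! ### Laurent decomposition of the resolvent at an isolated spectral point. -/

section Laurent

variable {A : Type*} [CStarAlgebra A] {a : A}

/-- The indicator of an isolated point of the spectrum. -/
noncomputable def pointIndicator {β : ℂ} {δ : ℝ} (hδ : 0 < δ)
    (hiso : ∀ w ∈ spectrum ℂ a, w ≠ β → δ ≤ ‖w - β‖) : C(spectrum ℂ a, ℂ) :=
  open Classical in
  ⟨fun x => if (x : ℂ) = β then 1 else 0, by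
    have hc : IsClopen {x : spectrum ℂ a | (x : ℂ) = β} := by
      refine ⟨isClosed_eq continuous_subtype_val continuous_const, ?_⟩
      have : {x : spectrum ℂ a | (x : ℂ) = β} = {x : spectrum ℂ a | ‖(x : ℂ) - β‖ < δ} := by
        ext x
        refine ⟨fun h => ?_, fun h => by_contra fun h' => ?_⟩
        · have h : (x : ℂ) = β := h
          simpa [h] using hδ
        · exact absurd (hiso x x.2 h') (not_le.2 h)
      rw [this]
      exact isOpen_lt (by fun_prop) continuous_const
    exact continuous_const.if (fun x hx => by
      rw [hc.frontier_eq] at hx; exact hx.elim) continuous_const⟩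

open Classical in
theorem pointIndicator_apply {β : ℂ} {δ : ℝ} (hδ : 0 < δ)
    (hiso : ∀ w ∈ spectrum ℂ a, w ≠ β → δ ≤ ‖w - β‖) (x : spectrum ℂ a) :
    pointIndicator hδ hiso x = if (x : ℂ) = β then 1 else 0 := rfl

/-- The data of an isolated point `β` of the spectrum of a normal element `a`, enclosed by a contour. -/
structure IsolatedPoint (γ : ℝ → ℂ) (β : ℂ) (a : A) (δ : ℝ) : Prop where
  normal : IsStarNormal a
  mem : β ∈ spectrum ℂ a
  pos : 0 < δ
  isContour : IsContour γ
  disjoint : Disjoint (γ '' Set.Icc 0 1) (spectrum ℂ a)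
  inside : windingNumber γ β = 1
  outside : ∀ w ∈ spectrum ℂ a, w ≠ β → windingNumber γ w = 0
  isolated : ∀ w ∈ spectrum ℂ a, w ≠ β → δ ≤ ‖w - β‖

namespace IsolatedPoint

variable {γ : ℝ → ℂ} {β : ℂ} {δ : ℝ} (h : IsolatedPoint γ β a δ)

/-- The indicator function of the isolated point. -/
noncomputable abbrev ind : C(spectrum ℂ a, ℂ) := pointIndicator h.pos h.isolated

theorem notMem_of_mem (h : IsolatedPoint γ β a δ) {x : ℂ} (hx : x ∈ spectrum ℂ a) : x ∉ γ '' Set.Icc 0 1 :=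
  fun hn => Set.disjoint_left.1 h.disjoint hn hx

/-- The spectral projection onto the isolated point. -/
noncomputable def proj : A := cfcCLM h.normal h.ind

theorem contourCLM_resolventPath :
    (-(2 * Real.pi * Complex.I)⁻¹ : ℂ) •
      contourCLM h.isContour (resolventPath h.normal h.isContour h.disjoint) = h.proj := by
  obtain ⟨w, hw, e⟩ := PhotonicCrystal.contourCLM_resolventPath h.normal h.isContour h.disjoint
  rw [e, proj]
  congr 1
  ext x
  rw [hw, pointIndicator_apply]
  split_ifs with hx
  · rw [hx, h.inside]
  · exact h.outside x x.2 hx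

/-- On the support of the indicator the coordinate function equals `β`: a normal element has no
nilpotent part at an isolated point of its spectrum. -/
theorem mul_proj : a * h.proj = β • h.proj := by
  refine (congrArg (· * h.proj) (cfcCLM_id h.normal).symm).trans ?_
  rw [proj, ← cfcCLM_mul, ← map_smul]
  congr 1
  ext x
  simp only [ContinuousMap.mul_apply, ContinuousMap.smul_apply, pointIndicator_apply]
  split_ifs with hx
  · simp [hx]
  · simp

/-- The kernel `(t, x) ↦ (x - γ t)⁻¹` with the isolated point removed. -/
noncomputable def reducedKernel : C(unitInterval, C(spectrum ℂ a, ℂ)) :=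
  constPath (1 - h.ind) * spectralKernel h.isContour h.disjoint

/-- The reduced resolvent along the contour. -/
noncomputable def reducedPath : C(unitInterval, A) := cfcPath h.normal h.reducedKernel

/-- The Cauchy kernel at a point of the spectrum. -/
noncomputable abbrev kernelAt (x : spectrum ℂ a) : C(unitInterval, ℂ) :=
  cauchyKernel h.isContour x (h.notMem_of_mem x.2)

noncomputable abbrev pole : C(unitInterval, ℂ) :=
  cauchyKernel h.isContour β (h.notMem_of_mem h.mem)

/-- The kernel is split into its value at the spectral point `β` and the rest. The pole is simple,
and the sign comes from passing from `β - ζ` to `ζ - β`. -/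
theorem resolventPath_eq :
    resolventPath h.normal h.isContour h.disjoint =
      -(scalarPath h.pole * constPath h.proj) + h.reducedPath := by
  rw [proj, ← cfcPath_constPath, ← cfcPath_scalarPath h.normal, ← map_mul, ← map_neg, reducedPath,
    ← map_add, resolventPath]
  congr 1
  ext t x
  change ((x : ℂ) - γ t)⁻¹ = -((γ t - β)⁻¹ * h.ind x) + (1 - h.ind x) * ((x : ℂ) - γ t)⁻¹
  rw [pointIndicator_apply]
  split_ifs with hx
  · rw [hx, ← neg_sub, inv_neg]; ring
  · ring

/-- The reduced resolvent at the isolated point. -/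
noncomputable def reducedAt : A := cfcCLM h.normal ⟨fun x => (1 - h.ind x) * ((x : ℂ) - β + h.ind x)⁻¹, by
  -- Adding the indicator makes the denominator `1` at the point `β`, where the prefactor vanishes
  -- anyway.
  refine (by fun_prop : Continuous fun x => (1 - h.ind x)).mul
    (Continuous.inv₀ (by fun_prop) fun x hx => ?_)
  rw [pointIndicator_apply] at hx
  split_ifs at hx with h1
  · simp [h1] at hx
  · rw [add_zero, sub_eq_zero] at hx; exact h1 hx⟩

/-- The path `t ↦ γ t - β`. -/
noncomputable def shift : C(unitInterval, ℂ) := h.isContour.path - ContinuousMap.const _ β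

theorem pole_mul_shift : h.pole * h.shift = 1 := by
  ext t
  exact inv_mul_cancel₀ fun h0 => h.notMem_of_mem h.mem ⟨t, t.2, sub_eq_zero.1 h0⟩

/-- The first resolvent identity between the points `β` and `γ t`. Iterating it yields Taylor
expansions at `β` of any order with explicit remainders, without integrating over a small circle. -/
theorem reducedPath_eq : h.reducedPath =
    constPath h.reducedAt + scalarPath h.shift * (constPath h.reducedAt * h.reducedPath) := by
  rw [reducedAt, ← cfcPath_constPath, ← cfcPath_scalarPath h.normal, reducedPath, ← map_mul,
    ← map_mul, ← map_add]
  congr 1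
  ext t x
  change (1 - h.ind x) * ((x : ℂ) - γ t)⁻¹ = (1 - h.ind x) * ((x : ℂ) - β + h.ind x)⁻¹ +
    (γ t - β) * (((1 - h.ind x) * ((x : ℂ) - β + h.ind x)⁻¹) * ((1 - h.ind x) * ((x : ℂ) - γ t)⁻¹))
  rw [pointIndicator_apply]
  split_ifs with hx
  · simp
  · have h1 : (x : ℂ) - γ t ≠ 0 := fun h0 => h.notMem_of_mem x.2 ⟨t, t.2, (sub_eq_zero.1 h0).symm⟩
    have h2 : (x : ℂ) - β ≠ 0 := sub_ne_zero.2 hx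
    simp only [sub_zero, one_mul, add_zero]
    field_simp
    ring

/-- Sums of constants times products of Cauchy kernels at the rest of the spectrum. -/
noncomputable def rational : Submodule ℂ C(unitInterval, A) :=
  Submodule.span ℂ {X | ∃ (b : A) (l : List {x : ℂ | x ∈ spectrum ℂ a ∧ x ≠ β}),
    X = scalarPath (l.map fun x : {x : ℂ | x ∈ spectrum ℂ a ∧ x ≠ β} =>
      cauchyKernel h.isContour x (h.notMem_of_mem x.2.1)).prod * constPath b}

theorem constPath_mem_rational (b : A) : constPath b ∈ h.rational :=
  Submodule.subset_span ⟨b, [], by simp⟩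

theorem mul_mem_rational {X Y : C(unitInterval, A)} (hX : X ∈ h.rational) (hY : Y ∈ h.rational) :
    X * Y ∈ h.rational := by
  have : h.rational * h.rational ≤ h.rational := by
    unfold rational
    rw [Submodule.span_mul_span]
    refine Submodule.span_mono ?_
    rintro _ ⟨_, ⟨b, l, rfl⟩, _, ⟨c, l', rfl⟩, rfl⟩
    refine ⟨b * c, l ++ l', ?_⟩
    simp only [List.map_append, List.prod_append, map_mul]
    rw [mul_assoc, ← mul_assoc (constPath b), ← scalarPath_mul_comm _ (constPath b)]
    simp only [mul_assoc]
  exact this (Submodule.mul_mem_mul hX hY)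

/-- `rational` as a subalgebra. -/
noncomputable def rationalAlg : Subalgebra ℂ C(unitInterval, A) :=
  h.rational.toSubalgebra (by simpa using h.constPath_mem_rational 1)
    fun _ _ hX hY => h.mul_mem_rational hX hY

theorem contourCLM_eq_zero_of_mem_rational {X : C(unitInterval, A)} (hX : X ∈ h.rational) :
    contourCLM h.isContour X = 0 := by
  unfold rational at hX
  induction hX using Submodule.span_induction with
  | mem X hX =>
    obtain ⟨b, l, rfl⟩ := hX
    rw [contourCLM_scalarPath_mul_constPath]
    rw [contourCLM_prod_eq_zero h.isContour {x | x ∈ spectrum ℂ a ∧ x ≠ β}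
      (fun w hw => h.notMem_of_mem hw.1) (fun w hw => h.outside w hw.1 hw.2) l]
    exact zero_smul _ _
  | zero => exact map_zero _
  | add X Y _ _ hX hY => rw [map_add, hX, hY, add_zero]
  | smul c X _ hX => rw [map_smul, hX, smul_zero]

/-- Sampling the kernel at finitely many spectral points approximates it uniformly by functions with
poles only at those points. A sample at `β` contributes nothing, because the indicator has been
removed, and the isometric functional calculus carries the approximation over to the algebra. -/
theorem reducedPath_mem_closure : h.reducedPath ∈ h.rationalAlg.topologicalClosure := by
  change h.reducedPath ∈ closure (h.rational : Set C(unitInterval, A))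
  rw [Metric.mem_closure_iff]
  intro ε hε
  -- The two variables are exchanged: a scalar path for each spectral point, so that compactness of
  -- the spectrum can be used.
  let F : C(spectrum ℂ a, C(unitInterval, ℂ)) :=
    ContinuousMap.curry ((ContinuousMap.uncurry h.reducedKernel).comp ContinuousMap.prodSwap)
  have hF (x : spectrum ℂ a) (t : unitInterval) : F x t = (1 - h.ind x) * ((x : ℂ) - γ t)⁻¹ := rfl
  obtain ⟨ι, _, φ, x, hφ⟩ := exists_sum_smul_approx F (half_pos hε)
  refine ⟨∑ i, scalarPath (F (x i)) * constPath (cfcCLM h.normal (φ i)), ?_, ?_⟩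
  · refine Submodule.sum_mem _ fun i _ => ?_
    by_cases hx : (x i : ℂ) = β
    · have : F (x i) = 0 := by
        ext t
        rw [hF, pointIndicator_apply, if_pos hx]; simp
      rw [this, map_zero, zero_mul]
      exact Submodule.zero_mem _
    · have : F (x i) = -h.kernelAt (x i) := by
        ext t
        rw [hF, pointIndicator_apply, if_neg hx, sub_zero, one_mul, ← neg_sub, inv_neg]
        rfl
      rw [this, map_neg, show ∀ X Y : C(unitInterval, A), -X * Y = -(X * Y) from fun X Y => neg_mul X Y]
      exact Submodule.neg_mem _ (Submodule.subset_span ⟨cfcCLM h.normal (φ i), [⟨x i, (x i).2, hx⟩], by simp⟩)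
  · rw [dist_eq_norm]
    refine lt_of_le_of_lt ?_ (half_lt_self hε)
    have e : h.reducedPath - ∑ i, scalarPath (F (x i)) * constPath (cfcCLM h.normal (φ i)) =
        cfcPath h.normal (h.reducedKernel - ∑ i, scalarPath (F (x i)) * constPath (φ i)) := by
      rw [map_sub, map_sum]
      simp only [map_mul, cfcPath_scalarPath, cfcPath_constPath]
      rfl
    rw [e, ContinuousMap.norm_le _ (half_pos hε).le]
    intro t
    rw [cfcPath_apply, norm_cfcCLM, ContinuousMap.norm_le _ (half_pos hε).le]
    intro y
    have h1 := (ContinuousMap.norm_coe_le_norm _ t).trans (hφ y)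
    refine le_trans (le_of_eq ?_) h1
    congr 1
    simp only [ContinuousMap.sub_apply, ContinuousMap.sum_apply, ContinuousMap.smul_apply,
      ContinuousMap.mul_apply, scalarPath_apply, constPath_apply, smul_eq_mul]
    congr 1
    exact Finset.sum_congr rfl fun i _ => mul_comm _ _

/-- The algebra generated by the constants and the reduced resolvent. -/
noncomputable def regular : Subalgebra ℂ C(unitInterval, A) :=
  Algebra.adjoin ℂ (Set.range constPath ∪ {h.reducedPath})

theorem constPath_mem_regular (b : A) : constPath b ∈ h.regular :=
  Algebra.subset_adjoin (Or.inl ⟨b, rfl⟩)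

/-- Cauchy's theorem for regular integrands: they are uniform limits of rational ones whose poles
all have winding number zero, and integration is continuous. -/
theorem contourCLM_eq_zero_of_mem_regular {X : C(unitInterval, A)} (hX : X ∈ h.regular) :
    contourCLM h.isContour X = 0 := by
  have h1 : h.regular ≤ h.rationalAlg.topologicalClosure := by
    refine Algebra.adjoin_le ?_
    rintro X (⟨b, rfl⟩ | rfl)
    · exact subset_closure (h.constPath_mem_rational b)
    · exact h.reducedPath_mem_closure
  have h2 : X ∈ closure (h.rational : Set C(unitInterval, A)) := h1 hX
  have h3 : IsClosed {X : C(unitInterval, A) | contourCLM h.isContour X = 0} :=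
    isClosed_eq (contourCLM h.isContour).continuous continuous_const
  exact closure_minimal (fun X hX => h.contourCLM_eq_zero_of_mem_rational hX) h3 h2

/-- A first-order Taylor expansion at `β` whose remainder is again regular. The generators have one
by `reducedPath_eq`, and the property is stable under sums and products. -/
theorem exists_eq_add_shift_mul {X : C(unitInterval, A)} (hX : X ∈ h.regular) :
    ∃ b : A, ∃ Y ∈ h.regular, X = constPath b + scalarPath h.shift * Y := by
  have hS : h.reducedPath ∈ h.regular := Algebra.subset_adjoin (Or.inr rfl)
  unfold regular at hX
  induction hX using Algebra.adjoin_induction with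
  | mem X hX =>
    rcases hX with ⟨b, rfl⟩ | rfl
    · exact ⟨b, 0, Subalgebra.zero_mem _, by simp⟩
    · exact ⟨_, _, Subalgebra.mul_mem _ (h.constPath_mem_regular _) hS, h.reducedPath_eq⟩
  | algebraMap c => exact ⟨algebraMap ℂ A c, 0, Subalgebra.zero_mem _, by simp⟩
  | add X Y _ _ hX hY =>
    obtain ⟨b, X', hX', eX⟩ := hX
    obtain ⟨c, Y', hY', eY⟩ := hY
    refine ⟨b + c, X' + Y', Subalgebra.add_mem _ hX' hY', ?_⟩
    rw [eX, eY, map_add, mul_add]; abel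
  | mul X Y _ hY' hX hY =>
    obtain ⟨b, X', hX', eX⟩ := hX
    obtain ⟨c, Y', hY'', eY⟩ := hY
    refine ⟨b * c, constPath b * Y' + X' * Y, Subalgebra.add_mem _
      (Subalgebra.mul_mem _ (h.constPath_mem_regular b) hY'') (Subalgebra.mul_mem _ hX' hY'), ?_⟩
    rw [eX, add_mul, mul_assoc, mul_add, map_mul, ← add_assoc]
    congr 1
    nth_rw 1 [eY]
    rw [mul_add, ← mul_assoc (constPath b), ← scalarPath_mul_comm, mul_assoc]

end IsolatedPoint

end Laurent

/-! ### Trace ideals and cyclicity of the trace under the contour integral. -/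

/-- A two-sided ideal `I` on which `τ` is linear and cyclic. -/
structure IsTraceIdeal {A : Type*} [Ring A] [Algebra ℂ A] (I : Submodule ℂ A) (τ : A → ℂ) :
    Prop where
  mul_left : ∀ (b : A) {x : A}, x ∈ I → b * x ∈ I
  mul_right : ∀ (b : A) {x : A}, x ∈ I → x * b ∈ I
  map_add : ∀ {x y : A}, x ∈ I → y ∈ I → τ (x + y) = τ x + τ y
  map_smul : ∀ (c : ℂ) {x : A}, x ∈ I → τ (c • x) = c * τ x
  comm : ∀ (b : A) {x : A}, x ∈ I → τ (b * x) = τ (x * b)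

namespace IsTraceIdeal

variable {A : Type*} [Ring A] [Algebra ℂ A] {I : Submodule ℂ A} {τ : A → ℂ} (ht : IsTraceIdeal I τ)

theorem map_zero (ht : IsTraceIdeal I τ) : τ 0 = 0 := by
  have := ht.map_smul 0 I.zero_mem
  simpa using this

theorem map_sum (ht : IsTraceIdeal I τ) {ι : Type*} (s : Finset ι) (f : ι → A) (hf : ∀ i ∈ s, f i ∈ I) :
    τ (∑ i ∈ s, f i) = ∑ i ∈ s, τ (f i) := by
  classical
  induction s using Finset.induction_on with
  | empty => simpa using ht.map_zero
  | insert i s hi ih =>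
    rw [Finset.sum_insert hi, Finset.sum_insert hi, ht.map_add (hf i (by simp))
      (Submodule.sum_mem _ fun j hj => hf j (by simp [hj])), ih fun j hj => hf j (by simp [hj])]

end IsTraceIdeal

namespace IsolatedPoint

variable {A : Type*} [CStarAlgebra A] {a : A} {γ : ℝ → ℂ} {β : ℂ} {δ : ℝ}
  (h : IsolatedPoint γ β a δ) (I : Submodule ℂ A)

/-- Principal parts at `β` with coefficients in `I`. -/
noncomputable def principal : Submodule ℂ C(unitInterval, A) :=
  Submodule.span ℂ {X | ∃ (j : ℕ) (b : A), b ∈ I ∧ X = scalarPath (h.pole ^ (j + 1)) * constPath b}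

/-- The paths which are sums of a principal part with coefficients in `I` and a regular path. -/
noncomputable def laurent : Submodule ℂ C(unitInterval, A) :=
  h.principal I ⊔ Subalgebra.toSubmodule h.regular

variable {I}

theorem pole_mem_laurent {b : A} (hb : b ∈ I) (j : ℕ) :
    scalarPath (h.pole ^ (j + 1)) * constPath b ∈ h.laurent I :=
  Submodule.mem_sup_left (Submodule.subset_span ⟨j, b, hb, rfl⟩)

theorem regular_mem_laurent {X : C(unitInterval, A)} (hX : X ∈ h.regular) : X ∈ h.laurent I :=
  Submodule.mem_sup_right hX

theorem laurent_induction {p : C(unitInterval, A) → Prop}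
    (hpole : ∀ (j : ℕ) (b : A), b ∈ I → p (scalarPath (h.pole ^ (j + 1)) * constPath b))
    (hreg : ∀ X ∈ h.regular, p X)
    (hadd : ∀ X Y, X ∈ h.laurent I → Y ∈ h.laurent I → p X → p Y → p (X + Y))
    (hsmul : ∀ (c : ℂ) X, X ∈ h.laurent I → p X → p (c • X)) {X : C(unitInterval, A)}
    (hX : X ∈ h.laurent I) : p X := by
  obtain ⟨Y, hY, Z, hZ, rfl⟩ := Submodule.mem_sup.1 hX
  have hle : h.principal I ≤ h.laurent I := le_sup_left
  refine hadd _ _ (hle hY) (h.regular_mem_laurent hZ) ?_ (hreg _ hZ)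
  clear hX
  unfold principal at hY
  induction hY using Submodule.span_induction with
  | mem X hX => obtain ⟨j, b, hb, rfl⟩ := hX; exact hpole j b hb
  | zero => exact hreg 0 h.regular.zero_mem
  | add X Y hX hY h1 h2 =>
    exact hadd _ _ (hle hX) (hle hY) h1 h2
  | smul c X hX h1 => exact hsmul c X (hle hX) h1

theorem pole_pow_succ_mul_shift (j : ℕ) (X : C(unitInterval, A)) :
    scalarPath (h.pole ^ (j + 1)) * (scalarPath h.shift * X) = scalarPath (h.pole ^ j) * X := by
  rw [← mul_assoc, ← map_mul, pow_succ, mul_assoc, h.pole_mul_shift, mul_one]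

variable {τ : A → ℂ}

/-- The factor `ζ - β` in the Taylor remainder cancels one order of the pole, which drives the
inductions on the pole order. -/
theorem pole_mul_regular_eq (j : ℕ) (b : A) {c : A} {X Y : C(unitInterval, A)}
    (e : X = constPath c + scalarPath h.shift * Y) :
    scalarPath (h.pole ^ (j + 1)) * constPath b * X =
      scalarPath (h.pole ^ (j + 1)) * constPath (b * c) +
        scalarPath (h.pole ^ j) * constPath b * Y := by
  rw [e, mul_add, mul_assoc, ← map_mul, mul_assoc, ← mul_assoc (constPath b),
    ← scalarPath_mul_comm _ (constPath b), mul_assoc, h.pole_pow_succ_mul_shift, mul_assoc]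

theorem regular_mul_pole_eq (j : ℕ) (b : A) {c : A} {X Y : C(unitInterval, A)}
    (e : X = constPath c + scalarPath h.shift * Y) :
    X * (scalarPath (h.pole ^ (j + 1)) * constPath b) =
      scalarPath (h.pole ^ (j + 1)) * constPath (c * b) +
        Y * (scalarPath (h.pole ^ j) * constPath b) := by
  rw [e, add_mul, ← mul_assoc, ← scalarPath_mul_comm, mul_assoc, ← map_mul,
    ← mul_assoc (scalarPath h.shift * Y), ← scalarPath_mul_comm (h.pole ^ (j + 1)), mul_assoc,
    mul_assoc, h.pole_pow_succ_mul_shift, scalarPath_mul_comm (h.pole ^ j), ← mul_assoc Y,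
    mul_assoc Y, ← scalarPath_mul_comm (h.pole ^ j), mul_assoc Y,  scalarPath_mul_comm (h.pole ^ j)]

theorem pole_mul_regular_mem (ht : IsTraceIdeal I τ) {b : A} (hb : b ∈ I) (j : ℕ)
    {X : C(unitInterval, A)} (hX : X ∈ h.regular) :
    scalarPath (h.pole ^ j) * constPath b * X ∈ h.laurent I := by
  induction j generalizing X with
  | zero =>
    rw [pow_zero, map_one, one_mul]
    exact h.regular_mem_laurent (Subalgebra.mul_mem _ (h.constPath_mem_regular b) hX)
  | succ j ih =>
    obtain ⟨c, Y, hY, e⟩ := h.exists_eq_add_shift_mul hX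
    rw [h.pole_mul_regular_eq j b e]
    exact Submodule.add_mem _ (h.pole_mem_laurent (ht.mul_right c hb) j) (ih hY)

theorem regular_mul_pole_mem (ht : IsTraceIdeal I τ) {b : A} (hb : b ∈ I) (j : ℕ)
    {X : C(unitInterval, A)} (hX : X ∈ h.regular) :
    X * (scalarPath (h.pole ^ j) * constPath b) ∈ h.laurent I := by
  induction j generalizing X with
  | zero =>
    rw [pow_zero, map_one, one_mul]
    exact h.regular_mem_laurent (Subalgebra.mul_mem _ hX (h.constPath_mem_regular b))
  | succ j ih =>
    obtain ⟨c, Y, hY, e⟩ := h.exists_eq_add_shift_mul hX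
    rw [h.regular_mul_pole_eq j b e]
    exact Submodule.add_mem _ (h.pole_mem_laurent (ht.mul_left c hb) j) (ih hY)

theorem pole_mul_pole (j k : ℕ) (b c : A) :
    scalarPath (h.pole ^ (j + 1)) * constPath b * (scalarPath (h.pole ^ (k + 1)) * constPath c) =
      scalarPath (h.pole ^ (j + k + 1 + 1)) * constPath (b * c) := by
  rw [mul_assoc, ← mul_assoc (constPath b), ← scalarPath_mul_comm, ← mul_assoc, ← mul_assoc,
    ← map_mul, mul_assoc, ← map_mul, ← pow_add, show j + 1 + (k + 1) = j + k + 1 + 1 by omega]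

theorem mul_mem_laurent (ht : IsTraceIdeal I τ) {X Y : C(unitInterval, A)}
    (hX : X ∈ h.laurent I) (hY : Y ∈ h.laurent I) : X * Y ∈ h.laurent I := by
  refine h.laurent_induction (p := fun X => X * Y ∈ h.laurent I) (fun j b hb => ?_) (fun X hX => ?_) (fun X X' _ _ h1 h2 => ?_)
    (fun c X _ h1 => ?_) hX
  · refine h.laurent_induction (p := fun Y => _ * Y ∈ h.laurent I) (fun k c hc => ?_) (fun Y hY => ?_) (fun Y Y' _ _ h1 h2 => ?_)
      (fun c Y _ h1 => ?_) hY
    · rw [h.pole_mul_pole]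
      exact h.pole_mem_laurent (ht.mul_left b hc) _
    · exact h.pole_mul_regular_mem ht hb _ hY
    · rw [mul_add]; exact Submodule.add_mem _ h1 h2
    · rw [mul_smul_comm]; exact Submodule.smul_mem _ _ h1
  · refine h.laurent_induction (p := fun Y => _ * Y ∈ h.laurent I) (fun k c hc => ?_) (fun Y hY => ?_) (fun Y Y' _ _ h1 h2 => ?_)
      (fun c Y _ h1 => ?_) hY
    · exact h.regular_mul_pole_mem ht hc _ hX
    · exact h.regular_mem_laurent (Subalgebra.mul_mem _ hX hY)
    · rw [mul_add]; exact Submodule.add_mem _ h1 h2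
    · rw [mul_smul_comm]; exact Submodule.smul_mem _ _ h1
  · rw [add_mul]; exact Submodule.add_mem _ h1 h2
  · rw [smul_mul_assoc]; exact Submodule.smul_mem _ _ h1

theorem contourCLM_pole_pow (j : ℕ) (b : A) :
    contourCLM h.isContour (scalarPath (h.pole ^ (j + 1 + 1)) * constPath b) = 0 := by
  rw [contourCLM_scalarPath_mul_constPath, contourCLM_cauchyKernel_pow, zero_smul]

theorem contourCLM_pole (b : A) :
    contourCLM h.isContour (scalarPath (h.pole ^ (0 + 1)) * constPath b) =
      (2 * Real.pi * Complex.I : ℂ) • b := by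
  rw [contourCLM_scalarPath_mul_constPath, zero_add, pow_one, contourCLM_cauchyKernel, h.inside,
    mul_one]

theorem contourCLM_mem {X : C(unitInterval, A)} (hX : X ∈ h.laurent I) :
    contourCLM h.isContour X ∈ I := by
  refine h.laurent_induction (p := fun X => contourCLM h.isContour X ∈ I) (fun j b hb => ?_) (fun X hX => ?_) (fun X X' _ _ h1 h2 => ?_)
    (fun c X _ h1 => ?_) hX
  · rcases j with _ | j
    · rw [h.contourCLM_pole]; exact I.smul_mem _ hb
    · rw [h.contourCLM_pole_pow]; exact I.zero_mem
  · rw [h.contourCLM_eq_zero_of_mem_regular hX]; exact I.zero_mem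
  · rw [map_add]; exact I.add_mem h1 h2
  · rw [map_smul]; exact I.smul_mem _ h1

/-- Peeling off Taylor coefficients of `X` one at a time, only a simple pole leaves a residue. There
`τ (b * c) = τ (c * b)` applies, since `b` lies in the ideal; at pole order zero both integrals
vanish. -/
theorem trace_pole_mul_regular (ht : IsTraceIdeal I τ) {b : A} (hb : b ∈ I) (j : ℕ)
    {X : C(unitInterval, A)} (hX : X ∈ h.regular) :
    τ (contourCLM h.isContour (scalarPath (h.pole ^ j) * constPath b * X)) =
      τ (contourCLM h.isContour (X * (scalarPath (h.pole ^ j) * constPath b))) := by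
  induction j generalizing X with
  | zero =>
    rw [pow_zero, map_one, one_mul]
    have hc := h.constPath_mem_regular b
    rw [h.contourCLM_eq_zero_of_mem_regular (Subalgebra.mul_mem _ hX hc),
      h.contourCLM_eq_zero_of_mem_regular (Subalgebra.mul_mem _ hc hX)]
  | succ j ih =>
    obtain ⟨c, Y, hY, e⟩ := h.exists_eq_add_shift_mul hX
    rw [h.pole_mul_regular_eq j b e, h.regular_mul_pole_eq j b e, map_add, map_add,
      ht.map_add (h.contourCLM_mem (h.pole_mem_laurent (ht.mul_right c hb) j))
        (h.contourCLM_mem (h.pole_mul_regular_mem ht hb j hY)),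
      ht.map_add (h.contourCLM_mem (h.pole_mem_laurent (ht.mul_left c hb) j))
        (h.contourCLM_mem (h.regular_mul_pole_mem ht hb j hY)), ih hY]
    congr 1
    rcases j with _ | j
    · rw [h.contourCLM_pole, h.contourCLM_pole, ht.map_smul _ (ht.mul_right c hb),
        ht.map_smul _ (ht.mul_left c hb), ht.comm c hb]
    · rw [h.contourCLM_pole_pow, h.contourCLM_pole_pow]

/-- The trace of the contour integral is cyclic. -/
theorem trace_contourCLM_mul_comm (ht : IsTraceIdeal I τ) {X Y : C(unitInterval, A)}
    (hX : X ∈ h.laurent I) (hY : Y ∈ h.laurent I) :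
    τ (contourCLM h.isContour (X * Y)) = τ (contourCLM h.isContour (Y * X)) := by
  have hm {X Y} (hX : X ∈ h.laurent I) (hY : Y ∈ h.laurent I) :=
    h.contourCLM_mem (h.mul_mem_laurent ht hX hY)
  refine h.laurent_induction (p := fun X => τ (contourCLM h.isContour (X * Y)) =
    τ (contourCLM h.isContour (Y * X))) (fun j b hb => ?_) (fun X hX => ?_)
    (fun X X' hX hX' h1 h2 => ?_) (fun c X hX h1 => ?_) hX
  · have hX' := h.pole_mem_laurent hb j
    refine h.laurent_induction (p := fun Y => τ (contourCLM h.isContour (_ * Y)) =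
      τ (contourCLM h.isContour (Y * _))) (fun k c hc => ?_) (fun Y hY => ?_)
      (fun Y Y' hY hY' h1 h2 => ?_) (fun c Y hY h1 => ?_) hY
    -- The product of two principal parts has a pole of order at least two, so both sides vanish.
    · rw [h.pole_mul_pole, h.pole_mul_pole, h.contourCLM_pole_pow, h.contourCLM_pole_pow]
    · exact h.trace_pole_mul_regular ht hb _ hY
    · rw [mul_add, add_mul, map_add, map_add, ht.map_add (hm hX' hY) (hm hX' hY'),
        ht.map_add (hm hY hX') (hm hY' hX'), h1, h2]
    · rw [mul_smul_comm, smul_mul_assoc, map_smul, map_smul, ht.map_smul _ (hm hX' hY),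
        ht.map_smul _ (hm hY hX'), h1]
  · have hX' := h.regular_mem_laurent (I := I) hX
    refine h.laurent_induction (p := fun Y => τ (contourCLM h.isContour (_ * Y)) =
      τ (contourCLM h.isContour (Y * _))) (fun k c hc => ?_) (fun Y hY => ?_)
      (fun Y Y' hY hY' h1 h2 => ?_) (fun c Y hY h1 => ?_) hY
    · exact (h.trace_pole_mul_regular ht hc _ hX).symm
    · rw [h.contourCLM_eq_zero_of_mem_regular (Subalgebra.mul_mem _ hX hY),
        h.contourCLM_eq_zero_of_mem_regular (Subalgebra.mul_mem _ hY hX)]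
    · rw [mul_add, add_mul, map_add, map_add, ht.map_add (hm hX' hY) (hm hX' hY'),
        ht.map_add (hm hY hX') (hm hY' hX'), h1, h2]
    · rw [mul_smul_comm, smul_mul_assoc, map_smul, map_smul, ht.map_smul _ (hm hX' hY),
        ht.map_smul _ (hm hY hX'), h1]
  · rw [mul_add, add_mul, map_add, map_add, ht.map_add (hm hX hY) (hm hX' hY),
      ht.map_add (hm hY hX) (hm hY hX'), h1, h2]
  · rw [mul_smul_comm, smul_mul_assoc, map_smul, map_smul, ht.map_smul _ (hm hX hY),
      ht.map_smul _ (hm hY hX), h1]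

theorem constPath_mem_laurent (b : A) : constPath b ∈ h.laurent I :=
  h.regular_mem_laurent (h.constPath_mem_regular b)

theorem resolventPath_mem_laurent (hP : h.proj ∈ I) :
    resolventPath h.normal h.isContour h.disjoint ∈ h.laurent I := by
  rw [h.resolventPath_eq]
  refine Submodule.add_mem _ (Submodule.neg_mem _ ?_)
    (h.regular_mem_laurent (Algebra.subset_adjoin (Or.inr rfl)))
  have := h.pole_mem_laurent hP 0
  rwa [zero_add, pow_one] at this

end IsolatedPoint

/-! ### Trace and rank of finite rank operators. -/

section Trace

variable {H : Type*} [NormedAddCommGroup H] [NormedSpace ℂ H]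

/-- The trace of a finite rank operator: the trace of its restriction to its range. -/
noncomputable def opTrace (T : H →L[ℂ] H) : ℂ :=
  LinearMap.trace ℂ T.range (T.toLinearMap.rangeRestrict ∘ₗ T.range.subtype)

/-- The trace of a finite rank operator is that of its restriction to any finite-dimensional
subspace containing the range. -/
theorem opTrace_eq_trace (T : H →L[ℂ] H) (V : Submodule ℂ H) [FiniteDimensional ℂ V]
    (hT : ∀ x, T x ∈ V) :
    opTrace T = LinearMap.trace ℂ V (T.toLinearMap.codRestrict V hT ∘ₗ V.subtype) := by
  have hle : T.range ≤ V := by rintro _ ⟨x, rfl⟩; exact hT x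
  have : FiniteDimensional ℂ T.range := Submodule.finiteDimensional_of_le hle
  have := LinearMap.trace_comp_comm' (Submodule.inclusion hle)
    (T.toLinearMap.rangeRestrict ∘ₗ V.subtype)
  exact this

/-- The ideal of the finite rank operators. -/
def finiteRank (H : Type*) [NormedAddCommGroup H] [NormedSpace ℂ H] : Submodule ℂ (H →L[ℂ] H) where
  carrier := {T | FiniteDimensional ℂ T.range}
  zero_mem' := by
    refine Submodule.finiteDimensional_of_le (S₂ := (⊥ : Submodule ℂ H)) ?_
    rintro _ ⟨x, rfl⟩
    exact (Submodule.mem_bot ℂ).2 rfl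
  add_mem' := by
    intro S T (hS : FiniteDimensional ℂ S.range) (hT : FiniteDimensional ℂ T.range)
    exact Submodule.finiteDimensional_of_le (LinearMap.range_add_le S.toLinearMap T.toLinearMap)
  smul_mem' := by
    intro c T (hT : FiniteDimensional ℂ T.range)
    refine Submodule.finiteDimensional_of_le (S₂ := T.range) ?_
    rintro _ ⟨x, rfl⟩
    exact T.range.smul_mem c ⟨x, rfl⟩

theorem mem_finiteRank_of_forall_mem {T : H →L[ℂ] H} (V : Submodule ℂ H) [FiniteDimensional ℂ V]
    (hT : ∀ x, T x ∈ V) : T ∈ finiteRank H :=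
  Submodule.finiteDimensional_of_le (S₂ := V) (by rintro _ ⟨x, rfl⟩; exact hT x)

theorem isTraceIdeal_finiteRank : IsTraceIdeal (finiteRank H) (opTrace (H := H)) where
  mul_left B T hT := by
    have : FiniteDimensional ℂ T.range := hT
    exact mem_finiteRank_of_forall_mem (T.range.map B.toLinearMap) fun x =>
      ⟨T x, ⟨x, rfl⟩, rfl⟩
  mul_right B T hT := by
    have : FiniteDimensional ℂ T.range := hT
    exact mem_finiteRank_of_forall_mem T.range fun x => ⟨B x, rfl⟩
  map_add {S T} hS hT := by
    have : FiniteDimensional ℂ S.range := hS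
    have : FiniteDimensional ℂ T.range := hT
    have h1 (x) : S x ∈ S.range ⊔ T.range := Submodule.mem_sup_left ⟨x, rfl⟩
    have h2 (x) : T x ∈ S.range ⊔ T.range := Submodule.mem_sup_right ⟨x, rfl⟩
    rw [opTrace_eq_trace S _ h1, opTrace_eq_trace T _ h2,
      opTrace_eq_trace (S + T) (S.range ⊔ T.range) fun x => Submodule.add_mem _ (h1 x) (h2 x),
      ← _root_.map_add]
    rfl
  map_smul c T hT := by
    have : FiniteDimensional ℂ T.range := hT
    rw [opTrace_eq_trace T T.range fun x => ⟨x, rfl⟩,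
      opTrace_eq_trace (c • T) T.range fun x => T.range.smul_mem c ⟨x, rfl⟩, ← smul_eq_mul,
      ← _root_.map_smul]
    rfl
  comm B T hT := by
    have : FiniteDimensional ℂ T.range := hT
    let V := T.range
    let W := T.range.map B.toLinearMap
    rw [opTrace_eq_trace (B * T) W fun x => ⟨T x, ⟨x, rfl⟩, rfl⟩,
      opTrace_eq_trace (T * B) V fun x => ⟨B x, rfl⟩]
    -- Both traces are those of the two composites of `B : V → W` and `T : W → V` between the
    -- finite-dimensional spaces `V = ran T` and `W = B V`.
    exact (LinearMap.trace_comp_comm'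
      ((B.toLinearMap ∘ₗ V.subtype).codRestrict W fun x => ⟨x, x.2, rfl⟩)
      (T.toLinearMap.rangeRestrict ∘ₗ W.subtype)).symm

/-- The operators of rank at most `N`. -/
def RankLE (N : ℕ) (T : H →L[ℂ] H) : Prop := T.toLinearMap.rank ≤ N

theorem RankLE.mem_finiteRank {N : ℕ} {T : H →L[ℂ] H} (h : RankLE N T) : T ∈ finiteRank H :=
  Module.rank_lt_aleph0_iff.1 (lt_of_le_of_lt h (Cardinal.natCast_lt_aleph0))

theorem RankLE.add {M N : ℕ} {S T : H →L[ℂ] H} (hS : RankLE M S) (hT : RankLE N T) :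
    RankLE (M + N) (S + T) := by
  refine (LinearMap.rank_add_le S.toLinearMap T.toLinearMap).trans ?_
  push_cast
  exact add_le_add hS hT

theorem RankLE.smul {N : ℕ} {T : H →L[ℂ] H} (hT : RankLE N T) (c : ℂ) : RankLE N (c • T) := by
  refine le_trans (Submodule.rank_mono ?_) hT
  rintro _ ⟨x, rfl⟩
  exact T.range.smul_mem c ⟨x, rfl⟩

theorem RankLE.sub {M N : ℕ} {S T : H →L[ℂ] H} (hS : RankLE M S) (hT : RankLE N T) :
    RankLE (M + N) (S - T) := by
  rw [sub_eq_add_neg, ← neg_one_smul ℂ T]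
  exact hS.add (hT.smul _)

/-- Rank is lower semicontinuous in the operator norm. This keeps limits of difference quotients
within the finite rank operators. -/
theorem isClosed_rankLE (N : ℕ) : IsClosed {T : H →L[ℂ] H | RankLE N T} := by
  have h : {T : H →L[ℂ] H | RankLE N T} = {T | ((N + 1 : ℕ) : Cardinal) ≤ T.toLinearMap.rank}ᶜ := by
    ext T
    change T.toLinearMap.rank ≤ N ↔ ¬ ((N + 1 : ℕ) : Cardinal) ≤ T.toLinearMap.rank
    rw [not_le, Nat.cast_add_one, ← Cardinal.succ_natCast, Order.lt_succ_iff]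
  rw [h]
  exact (isOpen_setOfPred_nat_le_rank (N + 1)).isClosed_compl

end Trace

/-! ### Continuity and differentiation of the trace at bounded rank. -/

section HilbertTrace

variable {H : Type*} [NormedAddCommGroup H] [InnerProductSpace ℂ H]

/-- In an orthonormal basis of the range the trace is a sum of at most `N` diagonal entries. A
uniform rank bound is thus what makes the trace continuous in the operator norm. -/
theorem norm_opTrace_le {N : ℕ} {T : H →L[ℂ] H} (h : RankLE N T) : ‖opTrace T‖ ≤ N * ‖T‖ := by
  have : FiniteDimensional ℂ T.range := h.mem_finiteRank
  have hN : Module.finrank ℂ T.range ≤ N := by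
    have : (Module.finrank ℂ T.range : Cardinal) ≤ N := by
      rw [Module.finrank_eq_rank]; exact h
    exact_mod_cast this
  rw [opTrace, LinearMap.trace_eq_sum_inner _ (stdOrthonormalBasis ℂ T.range)]
  refine (norm_sum_le _ _).trans ?_
  calc _ ≤ ∑ _i : Fin (Module.finrank ℂ T.range), ‖T‖ := by
        refine Finset.sum_le_sum fun i _ => ?_
        refine (norm_inner_le_norm _ _).trans ?_
        have hb := (stdOrthonormalBasis ℂ T.range).norm_eq_one i
        rw [hb, one_mul]
        refine (T.le_opNorm (stdOrthonormalBasis ℂ T.range i : H)).trans ?_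
        rw [Submodule.norm_coe, hb, mul_one]
    _ = Module.finrank ℂ T.range * ‖T‖ := by simp
    _ ≤ N * ‖T‖ := by gcongr

theorem HasDerivAt.rankLE {N : ℕ} {G : ℂ → H →L[ℂ] H} {G' : H →L[ℂ] H} {z : ℂ}
    (hG : HasDerivAt G G' z) (hN : ∀ᶠ w in nhds z, RankLE N (G w)) : RankLE (N + N) G' := by
  refine (isClosed_rankLE (N + N)).mem_of_tendsto (hasDerivAt_iff_tendsto_slope.1 hG) ?_
  filter_upwards [hN.filter_mono nhdsWithin_le_nhds] with w hw
  exact (hw.sub hN.self_of_nhds).smul _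

/-- The difference quotient and its limit both have rank at most `2N`, so their difference has rank
at most `4N` and its trace tends to zero together with its norm. -/
theorem HasDerivAt.opTrace {N : ℕ} {G : ℂ → H →L[ℂ] H} {G' : H →L[ℂ] H} {z : ℂ}
    (hG : HasDerivAt G G' z) (hN : ∀ᶠ w in nhds z, RankLE N (G w)) :
    HasDerivAt (fun w => opTrace (G w)) (opTrace G') z := by
  have hG' := HasDerivAt.rankLE hG hN
  have ht := isTraceIdeal_finiteRank (H := H)
  have hs := hasDerivAt_iff_tendsto_slope.1 hG
  rw [hasDerivAt_iff_tendsto_slope, tendsto_iff_norm_sub_tendsto_zero]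
  rw [tendsto_iff_norm_sub_tendsto_zero] at hs
  have hs' := hs.const_mul ((N + N + (N + N) : ℕ) : ℝ)
  rw [mul_zero] at hs'
  refine squeeze_zero' (Filter.Eventually.of_forall fun _ => norm_nonneg _) ?_ hs'
  filter_upwards [hN.filter_mono nhdsWithin_le_nhds] with w hw
  have hz := hN.self_of_nhds
  have h1 : slope (fun w => PhotonicCrystal.opTrace (G w)) z w =
      PhotonicCrystal.opTrace (slope G z w) := by
    simp only [slope, vsub_eq_sub]
    rw [ht.map_smul _ (hw.sub hz).mem_finiteRank, sub_eq_add_neg (G w), ← neg_one_smul ℂ (G z),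
      ht.map_add hw.mem_finiteRank (hz.smul _).mem_finiteRank, ht.map_smul _ hz.mem_finiteRank]
    simp [sub_eq_add_neg]
  have hr : RankLE (N + N) (slope G z w) := (hw.sub hz).smul _
  have h2 : PhotonicCrystal.opTrace (slope G z w) - PhotonicCrystal.opTrace G' =
      PhotonicCrystal.opTrace (slope G z w - G') := by
    rw [sub_eq_add_neg (slope G z w), ← neg_one_smul ℂ G', ht.map_add hr.mem_finiteRank
      (hG'.smul _).mem_finiteRank, ht.map_smul _ hG'.mem_finiteRank]
    ring
  rw [h1, h2]
  exact norm_opTrace_le (hr.sub hG')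

/-- The trace commutes with differentiation for families of operators of bounded rank. -/
theorem iteratedDeriv_opTrace [CompleteSpace H] (n : ℕ) {U : Set ℂ} (hU : IsOpen U) {N : ℕ} {G : ℂ → H →L[ℂ] H}
    (hG : DifferentiableOn ℂ G U) (hN : ∀ w ∈ U, RankLE N (G w)) {z : ℂ} (hz : z ∈ U) :
    iteratedDeriv n (fun w => opTrace (G w)) z = opTrace (iteratedDeriv n G z) ∧
      iteratedDeriv n G z ∈ finiteRank H := by
  induction n generalizing G N with
  | zero =>
    simp only [iteratedDeriv_zero]
    exact ⟨trivial, (hN z hz).mem_finiteRank⟩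
  | succ n ih =>
    have hd (w) (hw : w ∈ U) := (hG.differentiableAt (hU.mem_nhds hw)).hasDerivAt
    have hN' (w) (hw : w ∈ U) : ∀ᶠ w in nhds w, RankLE N (G w) :=
      (hU.eventually_mem hw).mono hN
    have h1 := ih (hG.deriv hU) fun w hw => HasDerivAt.rankLE (hd w hw) (hN' w hw)
    rw [iteratedDeriv_succ', iteratedDeriv_succ']
    refine ⟨?_, h1.2⟩
    rw [← h1.1]
    refine Filter.EventuallyEq.iteratedDeriv_eq n ?_
    filter_upwards [hU.mem_nhds hz] with w hw
    exact (HasDerivAt.opTrace (hd w hw) (hN' w hw)).deriv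

/-- `Q` is injective on the range of `P`: there a vector killed by `Q` is fixed by `P - Q`, which is
a strict contraction. -/
theorem rank_le_of_norm_sub_lt_one {P Q : H →L[ℂ] H} (hP : P * P = P) (h : ‖P - Q‖ < 1) :
    P.toLinearMap.rank ≤ Q.toLinearMap.rank := by
  refine LinearMap.rank_le_of_injective (Q.toLinearMap.rangeRestrict ∘ₗ P.range.subtype) ?_
  rw [injective_iff_map_eq_zero]
  rintro ⟨_, ⟨x, rfl⟩⟩ hx
  have hQ : Q (P x) = 0 := congrArg Subtype.val hx
  have hPP : P (P x) = P x := congrArg (fun T : H →L[ℂ] H => T x) hP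
  have h1 := (P - Q).le_opNorm (P x)
  rw [sub_apply, hQ, hPP, sub_zero] at h1
  have : ‖P x‖ = 0 := by
    by_contra hne
    have := (norm_nonneg (P x)).lt_of_ne' hne
    nlinarith
  exact Subtype.ext (norm_eq_zero.1 this)

end HilbertTrace

/-- The trace is the sum of the eigenvalues with algebraic multiplicity, so no diagonalizability is
needed. -/
theorem norm_trace_sub_le {V : Type*} [AddCommGroup V] [Module ℂ V] [FiniteDimensional ℂ V]
    (T : V →ₗ[ℂ] V) (β : ℂ) {δ : ℝ} (h : ∀ μ, Module.End.HasEigenvalue T μ → ‖μ - β‖ ≤ δ) :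
    ‖LinearMap.trace ℂ V T - Module.finrank ℂ V * β‖ ≤ Module.finrank ℂ V * δ := by
  have hs : (LinearMap.charpoly T).Splits := IsAlgClosed.splits _
  have hc : (LinearMap.charpoly T).roots.card = Module.finrank ℂ V := by
    rw [Polynomial.splits_iff_card_roots.1 hs, LinearMap.charpoly_natDegree]
  rw [Module.End.trace_eq_sum_roots_charpoly_of_splits hs, ← hc]
  have hm : ∀ μ ∈ (LinearMap.charpoly T).roots, ‖μ - β‖ ≤ δ := fun μ hμ =>
    h μ ((Module.End.hasEigenvalue_iff_isRoot_charpoly T μ).2 (Polynomial.isRoot_of_mem_roots hμ))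
  generalize (LinearMap.charpoly T).roots = s at hm
  induction s using Multiset.induction_on with
  | empty => simp
  | cons a s ih =>
    have h1 := hm a (by simp)
    have h2 := ih fun μ hμ => hm μ (by simp [hμ])
    simp only [Multiset.sum_cons, Multiset.card_cons]
    push_cast
    calc ‖a + s.sum - (s.card + 1) * β‖ = ‖(a - β) + (s.sum - s.card * β)‖ := by congr 1; ring
      _ ≤ ‖a - β‖ + ‖s.sum - s.card * β‖ := norm_add_le _ _
      _ ≤ (s.card + 1) * δ := by linarith

/-! ### Taylor coefficients of vector-valued functions. -/

section Taylor

/-- The `n`-th Taylor coefficient at the origin. -/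
noncomputable def taylorCoef {E : Type*} [NormedAddCommGroup E] [NormedSpace ℂ E] (n : ℕ) (f : ℂ → E) : E :=
  (n.factorial : ℂ)⁻¹ • iteratedDeriv n f 0

theorem taylorCoef_zero {E : Type*} [NormedAddCommGroup E] [NormedSpace ℂ E] (f : ℂ → E) :
    taylorCoef 0 f = f 0 := by
  simp [taylorCoef]

theorem taylorCoef_congr {E : Type*} [NormedAddCommGroup E] [NormedSpace ℂ E] (n : ℕ) {f g : ℂ → E}
    (h : f =ᶠ[nhds 0] g) : taylorCoef n f = taylorCoef n g := by
  rw [taylorCoef, taylorCoef, h.iteratedDeriv_eq]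

theorem taylorCoef_clm {E F : Type*} [NormedAddCommGroup E] [NormedSpace ℂ E]
    [NormedAddCommGroup F] [NormedSpace ℂ F] (L : E →L[ℂ] F) (n : ℕ) {f : ℂ → E}
    (hf : ContDiffAt ℂ ∞ f 0) : taylorCoef n (fun z => L (f z)) = L (taylorCoef n f) := by
  rw [taylorCoef, taylorCoef, map_smul]
  congr 1
  rw [iteratedDeriv_eq_iteratedFDeriv, iteratedDeriv_eq_iteratedFDeriv]
  have := L.iteratedFDeriv_comp_left (hf.of_le (n := ∞) (m := n) (by exact_mod_cast le_top)) (i := n) le_rfl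
  change iteratedFDeriv ℂ n (L ∘ f) 0 _ = _
  rw [this]
  rfl

theorem taylorCoef_const {E : Type*} [NormedAddCommGroup E] [NormedSpace ℂ E] (n : ℕ) (c : E) :
    taylorCoef (n + 1) (fun _ : ℂ => c) = 0 := by
  rw [taylorCoef, iteratedDeriv_const]
  simp

theorem taylorCoef_mul {A : Type*} [NormedRing A] [NormedAlgebra ℂ A] (n : ℕ) {f g : ℂ → A}
    (hf : ContDiffAt ℂ ∞ f 0) (hg : ContDiffAt ℂ ∞ g 0) :
    taylorCoef n (fun z => f z * g z) =
      ∑ i ∈ Finset.range (n + 1), taylorCoef i f * taylorCoef (n - i) g := by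
  have hf' : ContDiffAt ℂ n f 0 := hf.of_le (by exact_mod_cast le_top)
  have hg' : ContDiffAt ℂ n g 0 := hg.of_le (by exact_mod_cast le_top)
  rw [taylorCoef, iteratedDeriv_fun_mul hf' hg', Finset.smul_sum]
  refine Finset.sum_congr rfl fun i hi => ?_
  have hi : i ≤ n := Nat.lt_succ_iff.1 (Finset.mem_range.1 hi)
  rw [taylorCoef, taylorCoef, smul_mul_smul_comm, mul_assoc, ← nsmul_eq_mul, ← Nat.cast_smul_eq_nsmul ℂ,
    smul_smul]
  congr 1
  have h1 : (n.choose i * i.factorial * (n - i).factorial : ℂ) = n.factorial := by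
    exact_mod_cast Nat.choose_mul_factorial_mul_factorial hi
  have h2 : (n.factorial : ℂ) ≠ 0 := by exact_mod_cast n.factorial_ne_zero
  have h3 : (i.factorial : ℂ) ≠ 0 := by exact_mod_cast i.factorial_ne_zero
  have h4 : ((n - i).factorial : ℂ) ≠ 0 := by exact_mod_cast (n - i).factorial_ne_zero
  field_simp
  linear_combination h1

end Taylor

/-! ### Sums over compositions: removing the first block, and rotation. -/

section Compositions

/-- The composition with first block `k + 1` followed by a composition of the remainder. -/
def consComposition (n : ℕ) (p : (k : Fin (n + 1)) × Composition (n - k)) : Composition (n + 1) where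
  blocks := (p.1 + 1) :: p.2.blocks
  blocks_pos := by
    intro i hi
    rcases List.mem_cons.1 hi with rfl | hi
    · exact Nat.succ_pos _
    · exact p.2.blocks_pos hi
  blocks_sum := by
    have := p.1.2
    rw [List.sum_cons, p.2.blocks_sum]
    omega

theorem bijective_consComposition (n : ℕ) : Function.Bijective (consComposition n) := by
  constructor
  · rintro ⟨k, c⟩ ⟨k', c'⟩ h
    have h1 := congrArg Composition.blocks h
    simp only [consComposition, List.cons.injEq, add_left_inj] at h1
    obtain rfl : k = k' := Fin.ext h1.1
    obtain rfl : c = c' := Composition.ext h1.2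
    rfl
  · intro c
    rcases hb : c.blocks with _ | ⟨b, l⟩
    · have := c.blocks_sum
      rw [hb] at this
      simp at this
    · have hs := c.blocks_sum
      have hp : 0 < b := c.blocks_pos (by rw [hb]; simp)
      rw [hb, List.sum_cons] at hs
      refine ⟨⟨⟨b - 1, by omega⟩, ⟨l, fun hi => c.blocks_pos (by rw [hb]; simp [hi]), ?_⟩⟩, ?_⟩
      · change l.sum = n - (b - 1)
        omega
      · ext1
        refine Eq.trans ?_ hb.symm
        change (b - 1 + 1) :: l = b :: l
        rw [Nat.sub_add_cancel hp]

theorem sum_composition_succ {M : Type*} [AddCommMonoid M] (n : ℕ) (f : List ℕ → M) :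
    ∑ c : Composition (n + 1), f c.blocks =
      ∑ k : Fin (n + 1), ∑ c : Composition (n - k), f ((k + 1) :: c.blocks) := by
  rw [← Fintype.sum_sigma']
  exact (Fintype.sum_bijective _ (bijective_consComposition n) _ _ fun _ => rfl).symm

theorem sum_composition_zero {M : Type*} [AddCommMonoid M] (f : List ℕ → M) :
    ∑ c : Composition 0, f c.blocks = f [] := by
  have : ∀ c : Composition 0, c.blocks = [] := fun c => by
    by_contra h
    obtain ⟨b, hb⟩ := List.exists_mem_of_ne_nil _ h
    have h1 := c.blocks_pos hb
    have h2 := List.le_sum_of_mem hb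
    rw [c.blocks_sum] at h2
    omega
  simp [this, composition_card]

/-- The rotation of a composition. -/
def rotateComposition {n : ℕ} (j : ℕ) (c : Composition n) : Composition n where
  blocks := c.blocks.rotate j
  blocks_pos hi := c.blocks_pos (List.mem_rotate.1 hi)
  blocks_sum := by rw [(List.rotate_perm _ _).sum_eq, c.blocks_sum]

theorem bijective_rotateComposition {n : ℕ} (j : ℕ) :
    Function.Bijective (rotateComposition (n := n) j) :=
  Finite.injective_iff_bijective.1 fun _ _ h =>
    Composition.ext (List.rotate_injective j (congrArg Composition.blocks h))

/-- Averaging over the rotations of the blocks. -/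
theorem sum_composition_rotate {n : ℕ} (hn : n ≠ 0) (w : ℕ → ℂ) (f : List ℕ → ℂ) :
    ∑ c : Composition n, w c.length / c.length *
        ∑ j ∈ Finset.range c.length, f (c.blocks.rotate (j + 1)) =
      ∑ c : Composition n, w c.length * f c.blocks := by
  -- The index range is enlarged to one independent of `c`, so that the sums can be exchanged. For
  -- fixed `j`, rotation permutes the compositions and preserves their length.
  have h1 (c : Composition n) (g : ℕ → ℂ) : ∑ j ∈ Finset.range c.length, g j =
      ∑ j ∈ Finset.range n, if j < c.length then g j else 0 := by
    rw [← Finset.sum_filter]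
    refine Finset.sum_congr ?_ fun _ _ => rfl
    ext j
    have := c.length_le
    simp only [Finset.mem_range, Finset.mem_filter]
    omega
  have h2 : ∑ c : Composition n, w c.length / c.length *
        ∑ j ∈ Finset.range c.length, f (c.blocks.rotate (j + 1)) =
      ∑ j ∈ Finset.range n, ∑ c : Composition n,
        if j < c.length then w c.length / c.length * f (c.blocks.rotate (j + 1)) else 0 := by
    rw [Finset.sum_comm]
    refine Finset.sum_congr rfl fun c _ => ?_
    rw [Finset.mul_sum, h1]
  have h3 : ∑ c : Composition n, w c.length * f c.blocks =
      ∑ j ∈ Finset.range n, ∑ c : Composition n,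
        if j < c.length then w c.length / c.length * f c.blocks else 0 := by
    rw [Finset.sum_comm]
    refine Finset.sum_congr rfl fun c _ => ?_
    rw [← h1 c fun _ => w c.length / c.length * f c.blocks, Finset.sum_const, Finset.card_range,
      nsmul_eq_mul]
    have : (c.length : ℂ) ≠ 0 := by
      exact_mod_cast (c.length_pos_of_pos (Nat.pos_of_ne_zero hn)).ne'
    field_simp
  rw [h2, h3]
  refine Finset.sum_congr rfl fun j _ => ?_
  refine Fintype.sum_bijective _ (bijective_rotateComposition (j + 1)) _ _ fun c => ?_
  have : (rotateComposition (j + 1) c).length = c.length := List.length_rotate _ _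
  rw [this]
  rfl

/-- The alternating sum of words over the compositions of `n` satisfies the recursion of the
Neumann series. -/
theorem sum_composition_word_succ {A : Type*} [Ring A] [Algebra ℂ A] (X : ℕ → A) (n : ℕ) :
    ∑ c : Composition (n + 1), (-1 : ℂ) ^ c.length • (c.blocks.map X).prod =
      -∑ k ∈ Finset.range (n + 1), X (k + 1) *
        ∑ c : Composition (n - k), (-1 : ℂ) ^ c.length • (c.blocks.map X).prod := by
  have := sum_composition_succ n fun l => (-1 : ℂ) ^ l.length • (l.map X).prod
  refine this.trans ?_
  rw [Finset.sum_range fun k => X (k + 1) *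
        ∑ c : Composition (n - k), (-1 : ℂ) ^ c.length • (c.blocks.map X).prod,
    ← Finset.sum_neg_distrib]
  refine Finset.sum_congr rfl fun k _ => ?_
  rw [Finset.mul_sum, ← Finset.sum_neg_distrib]
  refine Finset.sum_congr rfl fun c _ => ?_
  rw [List.length_cons, pow_succ, List.map_cons, List.prod_cons, mul_smul_comm, mul_neg_one, neg_smul]

end Compositions

/-! ### Words in the resolvent and their derivatives. -/

section Words

theorem ringInverse_neg {R : Type*} [Ring R] (x : R) : Ring.inverse (-x) = -Ring.inverse x := by
  by_cases h : IsUnit x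
  · obtain ⟨u, rfl⟩ := h
    rw [← Units.val_neg, Ring.inverse_unit, Ring.inverse_unit]
    simp
  · rw [Ring.inverse_non_unit _ h, Ring.inverse_non_unit _ (by simpa using h), neg_zero]

variable {A : Type*} [CStarAlgebra A]

/-- The resolvent `(a - ζ)⁻¹`. -/
noncomputable def res (a : A) (ζ : ℂ) : A := Ring.inverse (a - algebraMap ℂ A ζ)

theorem hasDerivAt_res {a : A} {ζ : ℂ} (h : ζ ∉ spectrum ℂ a) :
    HasDerivAt (res a) (res a ζ * res a ζ) ζ := by
  have e : res a = fun ζ => -resolvent a ζ := by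
    ext ζ
    rw [res, resolvent, ← ringInverse_neg, neg_sub]
  have h1 := (spectrum.hasDerivAt_resolvent_const_left (𝕜 := ℂ) (a := a) (k := ζ) (by simpa [resolventSet, spectrum] using h)).neg
  rw [e]
  refine h1.congr_deriv ?_
  rw [neg_mul_neg, neg_neg, sq]

/-- The word `b₁ R(ζ) b₂ R(ζ) ⋯ b_q R(ζ)`. -/
noncomputable def resWord (a : A) (l : List A) (ζ : ℂ) : A := (l.map fun b => b * res a ζ).prod

/-- Since `R' = R²`, the product rule doubles one resolvent at a time, and the word is cut between
the two copies. -/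
theorem hasDerivAt_resWord {a : A} {ζ : ℂ} (h : ζ ∉ spectrum ℂ a) (l : List A) :
    HasDerivAt (resWord a l) (∑ i ∈ Finset.range l.length,
      resWord a (l.take (i + 1)) ζ * res a ζ * resWord a (l.drop (i + 1)) ζ) ζ := by
  induction l with
  | nil =>
    simp only [List.length_nil, Finset.range_zero, Finset.sum_empty]
    exact hasDerivAt_const ζ (1 : A)
  | cons b l ih =>
    have h1 := ((hasDerivAt_res h).const_mul b).mul ih
    have e : resWord a (b :: l) = (fun ζ => b * res a ζ) * resWord a l := by
      ext ζ; simp [resWord]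
    rw [e]
    refine h1.congr_deriv ?_
    rw [List.length_cons, Finset.sum_range_succ', add_comm, Finset.mul_sum]
    congr 1
    · refine Finset.sum_congr rfl fun i _ => ?_
      simp [resWord, mul_assoc]
    · simp [resWord, mul_assoc]

end Words

theorem ringInverse_eq_of_mul_eq_one {R : Type*} [Ring R] {x y : R} (h1 : x * y = 1) (h2 : y * x = 1) :
    Ring.inverse x = y :=
  Ring.inverse_unit ⟨x, y, h1, h2⟩

theorem isUnit_of_norm_sub_mul_lt_one {R : Type*} [NormedRing R] [CompleteSpace R] {x x' y : R}
    (h1 : x * x' = 1) (h2 : x' * x = 1) (h : ‖y - x‖ * ‖x'‖ < 1) : IsUnit y := by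
  have h3 : ‖(x - y) * x'‖ < 1 := by
    refine (norm_mul_le _ _).trans_lt ?_
    rwa [norm_sub_rev]
  have h4 := (Units.oneSub _ h3).isUnit.mul (⟨⟨x, x', h1, h2⟩, rfl⟩ : IsUnit x)
  convert h4 using 1
  rw [Units.val_oneSub, sub_mul, one_mul, mul_assoc, h2, mul_one, sub_sub_cancel]

/-! ### Contour integrals of words and Kato's rearrangement under the trace. -/

section

variable {A : Type*} [CStarAlgebra A]

theorem resolventPath_apply {a : A} (ha : IsStarNormal a) {γ : ℝ → ℂ} (hγ : IsContour γ)
    (hd : Disjoint (γ '' Set.Icc 0 1) (spectrum ℂ a)) (t : unitInterval) :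
    resolventPath ha hγ hd t = res a (γ t) :=
  (ringInverse_eq_of_mul_eq_one (congrArg (fun X : C(unitInterval, A) => X t)
    (sub_mul_resolventPath ha hγ hd)) (congrArg (fun X : C(unitInterval, A) => X t)
    (resolventPath_mul_sub ha hγ hd))).symm

/-- A single point counts as a contour, so the estimates along paths also serve pointwise. -/
theorem isContour_const (ζ : ℂ) : IsContour fun _ : ℝ => ζ where
  continuousOn := continuousOn_const
  closed := rfl
  piecewise := ⟨∅, fun _ _ => differentiableAt_const _, by simp [continuousOn_const],
    0, by simp⟩

/-- Points at distance at least `δ` from the spectrum of a normal element are not in the spectrum of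
elements at distance less than `δ`. -/
theorem notMem_spectrum_of_norm_sub_lt {a b : A} (ha : IsStarNormal a) {δ : ℝ} {ζ : ℂ}
    (hb : ‖b - a‖ < δ) (hζ : ∀ x ∈ spectrum ℂ a, δ ≤ ‖ζ - x‖) : ζ ∉ spectrum ℂ b := by
  have hδ : 0 < δ := (norm_nonneg _).trans_lt hb
  have hd : Disjoint ((fun _ : ℝ => ζ) '' Set.Icc 0 1) (spectrum ℂ a) := by
    rw [Set.disjoint_left]
    rintro _ ⟨_, _, rfl⟩ h
    have := hζ ζ h
    rw [sub_self, norm_zero] at this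
    linarith
  have hR := norm_resolventPath_le ha (isContour_const ζ) hd hδ fun _ _ => hζ
  have e1 := congrArg (fun X : C(unitInterval, A) => X 0) (sub_mul_resolventPath ha (isContour_const ζ) hd)
  have e2 := congrArg (fun X : C(unitInterval, A) => X 0) (resolventPath_mul_sub ha (isContour_const ζ) hd)
  have hu : IsUnit (b - algebraMap ℂ A ζ) := by
    refine isUnit_of_norm_sub_mul_lt_one e1 e2 ?_
    have h1 : ‖resolventPath ha (isContour_const ζ) hd 0‖ ≤ δ⁻¹ :=
      (ContinuousMap.norm_coe_le_norm _ _).trans hR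
    have h2 : b - algebraMap ℂ A ζ - (constPath a - scalarPath (isContour_const ζ).path :
        C(unitInterval, A)) 0 = b - a := by
      change b - algebraMap ℂ A ζ - (a - algebraMap ℂ A ζ) = b - a
      abel
    rw [h2]
    calc ‖b - a‖ * _ ≤ ‖b - a‖ * δ⁻¹ := by gcongr
      _ < δ * δ⁻¹ := by gcongr
      _ = 1 := mul_inv_cancel₀ hδ.ne'
  rw [spectrum.notMem_iff, ← neg_sub]
  exact hu.neg

/-- The constant paths, as a continuous linear map. -/
noncomputable def constPathCLM : A →L[ℂ] C(unitInterval, A) :=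
  LinearMap.mkContinuous (constPath (A := A)).toLinearMap 1 fun a => by
    rw [one_mul, ContinuousMap.norm_le _ (norm_nonneg _)]
    exact fun _ => le_rfl

theorem constPathCLM_apply (a : A) : constPathCLM a = constPath a := rfl

namespace IsolatedPoint

variable {a : A} {γ : ℝ → ℂ} {β : ℂ} {δ : ℝ} (h : IsolatedPoint γ β a δ)

/-- The resolvent of `a` along the contour. -/
noncomputable abbrev resolvent : C(unitInterval, A) := resolventPath h.normal h.isContour h.disjoint

/-- The word `b₁ R b₂ R ⋯ b_q R` along the contour. -/
noncomputable def word (l : List A) : C(unitInterval, A) :=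
  (l.map fun b => constPath b * h.resolvent).prod

theorem word_cons (b : A) (l : List A) : h.word (b :: l) = constPath b * h.resolvent * h.word l := by
  simp [word]

theorem word_append (l l' : List A) : h.word (l ++ l') = h.word l * h.word l' := by
  simp [word]

theorem word_apply (l : List A) (t : unitInterval) : h.word l t = resWord a l (γ t) := by
  induction l with
  | nil => simp [word, resWord]
  | cons b l ih =>
    rw [word_cons, ContinuousMap.mul_apply, ContinuousMap.mul_apply, ih, resolventPath_apply]
    simp [resWord]

/-- Integration by parts with the primitive `ζ - β` of `1`: the product of `ζ - β` and the word has
a derivative with vanishing integral. -/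
theorem contourCLM_word (l : List A) : contourCLM h.isContour (h.word l) =
    -∑ i ∈ Finset.range l.length, contourCLM h.isContour
      (h.word (l.take (i + 1)) * (scalarPath h.shift * h.resolvent * h.word (l.drop (i + 1)))) := by
  rw [eq_neg_iff_add_eq_zero, ← map_sum, ← map_add]
  have hP (t : unitInterval) : (h.word l + ∑ i ∈ Finset.range l.length, h.word (l.take (i + 1)) *
      (scalarPath h.shift * h.resolvent * h.word (l.drop (i + 1)))) t =
      (fun ζ => resWord a l ζ + (ζ - β) • ∑ i ∈ Finset.range l.length,
        resWord a (l.take (i + 1)) ζ * res a ζ * resWord a (l.drop (i + 1)) ζ) (γ t) := by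
    rw [ContinuousMap.add_apply, word_apply, ContinuousMap.sum_apply]
    beta_reduce
    rw [Finset.smul_sum]
    congr 1
    refine Finset.sum_congr rfl fun i _ => ?_
    simp only [ContinuousMap.mul_apply, word_apply, resolventPath_apply, scalarPath_apply]
    rw [← Algebra.smul_def, mul_assoc, smul_mul_assoc, mul_smul_comm]
    rfl
  rw [contourCLM_eq h.isContour (f := fun ζ => resWord a l ζ + (ζ - β) • ∑ i ∈ Finset.range l.length,
    resWord a (l.take (i + 1)) ζ * res a ζ * resWord a (l.drop (i + 1)) ζ) _ hP]
  refine contourIntegral_deriv_eq_zero h.isContour (f := fun ζ => (ζ - β) • resWord a l ζ)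
    (fun t ht => ?_) ?_
  · have hn : γ t ∉ spectrum ℂ a := Set.disjoint_left.1 h.disjoint ⟨t, ht, rfl⟩
    have h1 := ((hasDerivAt_id (γ t)).sub_const β).fun_smul (hasDerivAt_resWord hn l)
    refine h1.congr_deriv ?_
    simp only [id, one_smul]
    rw [add_comm]
  · rw [continuousOn_iff_continuous_domRestrict]
    refine (ContinuousMap.continuous _).congr hP

variable {I : Submodule ℂ A} {τ : A → ℂ}

theorem word_mem_laurent (ht : IsTraceIdeal I τ) (hP : h.proj ∈ I) (l : List A) :
    h.word l ∈ h.laurent I := by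
  induction l with
  | nil => simpa [word] using h.constPath_mem_laurent (I := I) 1
  | cons b l ih =>
    rw [word_cons]
    exact h.mul_mem_laurent ht (h.mul_mem_laurent ht (h.constPath_mem_laurent b)
      (h.resolventPath_mem_laurent hP)) ih

/-- This expresses `(ζ - β) R(ζ)` through constants and the resolvent alone, which places it among
the paths for which cyclicity is available. -/
theorem shift_mul_resolvent : scalarPath h.shift * h.resolvent =
    constPath (a - algebraMap ℂ A β) * h.resolvent - 1 := by
  rw [← sub_mul_resolventPath h.normal h.isContour h.disjoint, ← sub_mul]
  congr 1
  ext t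
  simp [shift, Algebra.algebraMap_eq_smul_one]

theorem shift_mul_resolvent_mem_laurent (ht : IsTraceIdeal I τ) (hP : h.proj ∈ I) :
    scalarPath h.shift * h.resolvent ∈ h.laurent I := by
  rw [shift_mul_resolvent]
  refine Submodule.sub_mem _ (h.mul_mem_laurent ht (h.constPath_mem_laurent _)
    (h.resolventPath_mem_laurent hP)) ?_
  simpa using h.constPath_mem_laurent (I := I) 1

/-- In each term of the integration by parts, cyclicity brings the part after the cut to the front.
The extra resolvent then leads a rotated word. -/
theorem trace_contourCLM_word (ht : IsTraceIdeal I τ) (hP : h.proj ∈ I) (l : List A) :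
    τ (contourCLM h.isContour (h.word l)) = -∑ i ∈ Finset.range l.length,
      τ (contourCLM h.isContour (scalarPath h.shift * h.resolvent * h.word (l.rotate (i + 1)))) := by
  have hs := h.shift_mul_resolvent_mem_laurent ht hP
  have hw := h.word_mem_laurent ht hP
  rw [contourCLM_word, ← neg_one_smul ℂ, ht.map_smul _ (Submodule.sum_mem _ fun i _ =>
    h.contourCLM_mem (h.mul_mem_laurent ht (hw _) (h.mul_mem_laurent ht hs (hw _)))),
    ht.map_sum _ _ fun i _ =>
    h.contourCLM_mem (h.mul_mem_laurent ht (hw _) (h.mul_mem_laurent ht hs (hw _))), neg_one_mul]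
  congr 1
  refine Finset.sum_congr rfl fun i hi => ?_
  rw [h.trace_contourCLM_mul_comm ht (hw _) (h.mul_mem_laurent ht hs (hw _)), mul_assoc,
    ← word_append, List.rotate_eq_drop_append_take (Finset.mem_range.1 hi)]

/-- The sum over the compositions of `n` of the words in the coefficients `B k`, with the resolvent
in front, is traded for the sum of the cyclic words. -/
theorem trace_sum_composition (ht : IsTraceIdeal I τ) (hP : h.proj ∈ I) (B : ℕ → A) {n : ℕ}
    (hn : n ≠ 0) :
    τ (contourCLM h.isContour (scalarPath h.shift * (h.resolvent *
      ∑ c : Composition n, (-1 : ℂ) ^ c.length • h.word (c.blocks.map B)))) =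
    -τ (∑ c : Composition n, ((-1 : ℂ) ^ c.length / c.length) •
      contourCLM h.isContour (h.word (c.blocks.map B))) := by
  have hs := h.shift_mul_resolvent_mem_laurent ht hP
  have hw := h.word_mem_laurent ht hP
  have hI (l) := h.contourCLM_mem (h.mul_mem_laurent ht hs (hw l))
  rw [← mul_assoc, Finset.mul_sum, map_sum]
  simp only [mul_smul_comm, map_smul]
  rw [ht.map_sum _ _ fun c _ => I.smul_mem _ (hI _),
    ht.map_sum _ _ fun c _ => I.smul_mem _ (h.contourCLM_mem (hw _))]
  have e1 (c : Composition n) := ht.map_smul ((-1 : ℂ) ^ c.length) (hI (c.blocks.map B))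
  have e2 (c : Composition n) := ht.map_smul ((-1 : ℂ) ^ c.length / c.length)
    (h.contourCLM_mem (hw (c.blocks.map B)))
  simp only [e1, e2]
  -- Averaging over the `q` rotations of a composition of length `q` gives the weight `1 / q`, and
  -- the `q` rotated terms are then recombined by parts.
  rw [← sum_composition_rotate hn (fun k => (-1 : ℂ) ^ k) fun l => τ (contourCLM h.isContour
    (scalarPath h.shift * h.resolvent * h.word (l.map B))), ← Finset.sum_neg_distrib]
  refine Finset.sum_congr rfl fun c _ => ?_
  rw [h.trace_contourCLM_word ht hP, mul_neg, neg_neg, List.length_map]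
  simp only [List.map_rotate]

end IsolatedPoint

end

/-! ### Resolvents and spectral projections of a holomorphic family. -/

/-- A holomorphic family `F` on the disc of radius `r`, self-adjoint at the real points, which stays
within distance `δ` of `F 0`, where `δ` bounds the gap between the contour and the spectrum of `F 0`. -/
structure HolomorphicFamily {A : Type*} [CStarAlgebra A] (F : ℂ → A) (γ : ℝ → ℂ) (β : ℂ) (δ r : ℝ) :
    Prop where
  isolated : IsolatedPoint γ β (F 0) δ
  gap : ∀ t ∈ Set.Icc (0 : ℝ) 1, ∀ x ∈ spectrum ℂ (F 0), δ ≤ ‖γ t - x‖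
  radius_pos : 0 < r
  differentiableOn : DifferentiableOn ℂ F (Metric.ball 0 r)
  norm_sub_lt : ∀ z ∈ Metric.ball (0 : ℂ) r, ‖F z - F 0‖ < δ
  isSelfAdjoint : ∀ x : ℝ, |x| < r → IsSelfAdjoint (F x)

namespace HolomorphicFamily

variable {A : Type*} [CStarAlgebra A] {F : ℂ → A} {γ : ℝ → ℂ} {β : ℂ} {δ r : ℝ}
  (h : HolomorphicFamily F γ β δ r)

/-- The path `t ↦ F z - γ t`. -/
noncomputable def pencil (z : ℂ) : C(unitInterval, A) :=
  constPath (F z) - scalarPath h.isolated.isContour.path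

/-- The path of resolvents `t ↦ (F z - γ t)⁻¹`. -/
noncomputable def resolvent (z : ℂ) : C(unitInterval, A) := Ring.inverse (h.pencil z)

/-- A Neumann series in the algebra of paths, about the resolvent of `F 0`. Inverting the whole path
at once gives the resolvent uniformly on the contour and makes it differentiable in `z`. -/
theorem isUnit_pencil {z : ℂ} (hz : z ∈ Metric.ball (0 : ℂ) r) : IsUnit (h.pencil z) := by
  have hi := h.isolated
  refine isUnit_of_norm_sub_mul_lt_one (sub_mul_resolventPath hi.normal hi.isContour hi.disjoint)
    (resolventPath_mul_sub hi.normal hi.isContour hi.disjoint) ?_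
  have h1 := norm_resolventPath_le hi.normal hi.isContour hi.disjoint hi.pos h.gap
  have h2 : ‖h.pencil z - (constPath (F 0) - scalarPath hi.isContour.path)‖ ≤ ‖F z - F 0‖ := by
    rw [ContinuousMap.norm_le _ (norm_nonneg _)]
    intro t
    refine le_of_eq ?_
    congr 1
    change F z - algebraMap ℂ A (γ t) - (F 0 - algebraMap ℂ A (γ t)) = _
    abel
  calc _ ≤ ‖F z - F 0‖ * δ⁻¹ := by gcongr
    _ < δ * δ⁻¹ := by
      have := h.norm_sub_lt z hz
      have := hi.pos
      gcongr
    _ = 1 := mul_inv_cancel₀ hi.pos.ne'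

theorem pencil_mul_resolvent {z : ℂ} (hz : z ∈ Metric.ball (0 : ℂ) r) :
    h.pencil z * h.resolvent z = 1 := Ring.mul_inverse_cancel _ (h.isUnit_pencil hz)

theorem resolvent_mul_pencil {z : ℂ} (hz : z ∈ Metric.ball (0 : ℂ) r) :
    h.resolvent z * h.pencil z = 1 := Ring.inverse_mul_cancel _ (h.isUnit_pencil hz)

theorem resolvent_apply {z : ℂ} (hz : z ∈ Metric.ball (0 : ℂ) r) (t : unitInterval) :
    h.resolvent z t = res (F z) (γ t) :=
  (ringInverse_eq_of_mul_eq_one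
    (congrArg (fun X : C(unitInterval, A) => X t) (h.pencil_mul_resolvent hz))
    (congrArg (fun X : C(unitInterval, A) => X t) (h.resolvent_mul_pencil hz))).symm

theorem zero_mem_ball (h : HolomorphicFamily F γ β δ r) : (0 : ℂ) ∈ Metric.ball (0 : ℂ) r := Metric.mem_ball_self h.radius_pos

theorem resolvent_zero : h.resolvent 0 = h.isolated.resolvent :=
  ringInverse_eq_of_mul_eq_one (sub_mul_resolventPath _ _ _) (resolventPath_mul_sub _ _ _)

theorem resolvent_eq_resolventPath {z : ℂ} (ha : IsStarNormal (F z))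
    (hd : Disjoint (γ '' Set.Icc 0 1) (spectrum ℂ (F z))) :
    h.resolvent z = resolventPath ha h.isolated.isContour hd :=
  ringInverse_eq_of_mul_eq_one (sub_mul_resolventPath _ _ _) (resolventPath_mul_sub _ _ _)

theorem differentiableOn_pencil : DifferentiableOn ℂ h.pencil (Metric.ball 0 r) :=
  ((constPathCLM (A := A)).differentiable.comp_differentiableOn h.differentiableOn).sub_const _

theorem differentiableOn_resolvent : DifferentiableOn ℂ h.resolvent (Metric.ball 0 r) := by
  intro z hz
  obtain ⟨u, hu⟩ := h.isUnit_pencil hz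
  have h1 := hasFDerivAt_ringInverse (𝕜 := ℂ) u
  rw [hu] at h1
  exact h1.differentiableAt.comp_differentiableWithinAt z (h.differentiableOn_pencil z hz)

theorem contDiffAt_of_differentiableOn {E : Type*} [NormedAddCommGroup E] [NormedSpace ℂ E]
    [CompleteSpace E] {f : ℂ → E} (hf : DifferentiableOn ℂ f (Metric.ball 0 r)) (hr : 0 < r) :
    ContDiffAt ℂ ∞ f 0 :=
  (hf.analyticAt (Metric.ball_mem_nhds 0 hr)).contDiffAt

/-- The Taylor coefficients of the resolvent. -/
theorem taylorCoef_resolvent (n : ℕ) : taylorCoef n h.resolvent = h.isolated.resolvent *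
    ∑ c : Composition n, (-1 : ℂ) ^ c.length •
      h.isolated.word (c.blocks.map fun k => taylorCoef k F) := by
  have hr := h.radius_pos
  set X : ℕ → C(unitInterval, A) := fun k => constPath (taylorCoef k F) * h.isolated.resolvent
  have hX (l : List ℕ) : h.isolated.word (l.map fun k => taylorCoef k F) = (l.map X).prod := by
    rw [IsolatedPoint.word, List.map_map]; rfl
  simp only [hX]
  induction n using Nat.strong_induction_on with
  | _ n ih =>
  rcases n with _ | n
  · have := sum_composition_zero fun l => (-1 : ℂ) ^ l.length • (l.map X).prod
    rw [taylorCoef_zero, resolvent_zero]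
    refine (mul_one _).symm.trans (congrArg _ ?_)
    refine Eq.symm (this.trans ?_)
    simp
  · have hM := contDiffAt_of_differentiableOn h.differentiableOn_pencil hr
    have hR := contDiffAt_of_differentiableOn h.differentiableOn_resolvent hr
    have hF := contDiffAt_of_differentiableOn h.differentiableOn hr
    -- Comparing coefficients in `pencil * resolvent = 1` gives a recursion, which is that of the
    -- alternating sums over compositions with the first block split off.
    have e0 : taylorCoef (n + 1) (fun z => h.pencil z * h.resolvent z) = 0 := by
      rw [← taylorCoef_const n (1 : C(unitInterval, A))]
      refine taylorCoef_congr _ ?_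
      filter_upwards [Metric.ball_mem_nhds (0 : ℂ) hr] with z hz
      exact h.pencil_mul_resolvent hz
    have e1 (k : ℕ) : taylorCoef (k + 1) h.pencil = constPath (taylorCoef (k + 1) F) := by
      rw [← constPathCLM_apply, ← taylorCoef_clm constPathCLM _ hF]
      simp only [taylorCoef]
      congr 1
      have e : h.pencil = fun z => -scalarPath h.isolated.isContour.path + constPathCLM (F z) := by
        ext z t
        simp [pencil, constPathCLM_apply, sub_eq_neg_add]
      rw [e, iteratedDeriv_const_add (Nat.succ_pos k)]
    rw [taylorCoef_mul _ hM hR, Finset.sum_range_succ', Nat.sub_zero, taylorCoef_zero] at e0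
    have e2 := congrArg (h.isolated.resolvent * ·) e0
    have e3 : h.isolated.resolvent * h.pencil 0 = 1 := resolventPath_mul_sub _ _ _
    simp only [mul_add, mul_zero, ← mul_assoc, e3, one_mul] at e2
    rw [eq_neg_of_add_eq_zero_right e2, sum_composition_word_succ]
    refine Eq.trans ?_ ((fun X Y : C(unitInterval, A) => mul_neg X Y) _ _).symm
    congr 2
    refine Finset.sum_congr rfl fun k hk => ?_
    rw [e1, Nat.add_sub_add_right, ih (n - k) (by omega), ← mul_assoc]

/-- The spectral projection `P(z)`. -/
noncomputable def proj (z : ℂ) : A :=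
  (-(2 * Real.pi * Complex.I)⁻¹ : ℂ) • contourCLM h.isolated.isContour (h.resolvent z)

theorem proj_zero : h.proj 0 = h.isolated.proj := by
  rw [proj, resolvent_zero]
  exact h.isolated.contourCLM_resolventPath

theorem differentiableOn_proj : DifferentiableOn ℂ h.proj (Metric.ball 0 r) :=
  ((contourCLM h.isolated.isContour).differentiable.comp_differentiableOn
    h.differentiableOn_resolvent).const_smul (-(2 * Real.pi * Complex.I)⁻¹ : ℂ)

/-- Points of the spectrum of `F z` are not enclosed, unless they are close to `β`. -/
theorem winding_of_mem_spectrum (h : HolomorphicFamily F γ β δ r) {z : ℂ} (hz : z ∈ Metric.ball (0 : ℂ) r) {w : ℂ}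
    (hw : w ∈ spectrum ℂ (F z)) :
    (windingNumber γ w = 1 ∧ ‖w - β‖ < δ) ∨ windingNumber γ w = 0 := by
  have hi := h.isolated
  by_contra! hc
  refine notMem_spectrum_of_norm_sub_lt hi.normal (h.norm_sub_lt z hz) (fun x hx => ?_) hw
  by_contra! hlt
  -- By normality of `F 0`, some point `x` of its spectrum lies within `δ` of `w`, so `w` inherits
  -- the winding number of `x`; it is nonzero only if `x = β`.
  have e := windingNumber_eq_of_dist_lt hi.isContour (fun t ht => h.gap t ht x hx) hlt
  by_cases hxβ : x = β
  · rw [hxβ, hi.inside] at e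
    have := hc.1 e
    rw [hxβ] at hlt
    linarith
  · rw [hi.outside x hx hxβ] at e
    exact hc.2 e

theorem disjoint (h : HolomorphicFamily F γ β δ r) {z : ℂ} (hz : z ∈ Metric.ball (0 : ℂ) r) :
    Disjoint (γ '' Set.Icc 0 1) (spectrum ℂ (F z)) := by
  rw [Set.disjoint_left]
  rintro _ ⟨t, ht, rfl⟩
  exact notMem_spectrum_of_norm_sub_lt h.isolated.normal (h.norm_sub_lt z hz) (h.gap t ht)

/-- At real points `F z` is self-adjoint, and `P(z)` is the functional calculus of a winding number
that takes only the values `0` and `1` on the spectrum. The identity theorem carries idempotency to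
the whole disc, so a second contour is not needed. -/
theorem proj_mul_proj {z : ℂ} (hz : z ∈ Metric.ball (0 : ℂ) r) :
    h.proj z * h.proj z = h.proj z := by
  have hr := h.radius_pos
  have hd : DifferentiableOn ℂ (fun z => h.proj z * h.proj z - h.proj z) (Metric.ball 0 r) :=
    (h.differentiableOn_proj.mul h.differentiableOn_proj).sub h.differentiableOn_proj
  have hreal (x : ℝ) (hx : |x| < r) : h.proj x * h.proj x - h.proj x = 0 := by
    have hxb : (x : ℂ) ∈ Metric.ball (0 : ℂ) r := by simpa using hx
    have ha : IsStarNormal (F x) := (h.isSelfAdjoint x hx).isStarNormal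
    obtain ⟨w, hw, e⟩ := PhotonicCrystal.contourCLM_resolventPath ha h.isolated.isContour
      (h.disjoint hxb)
    rw [proj, h.resolvent_eq_resolventPath ha (h.disjoint hxb), e, ← cfcCLM_mul, sub_eq_zero]
    congr 1
    ext y
    rw [ContinuousMap.mul_apply, hw]
    rcases h.winding_of_mem_spectrum hxb y.2 with h1 | h1
    · rw [h1.1, mul_one]
    · rw [h1, mul_zero]
  have hfreq : ∃ᶠ z in nhdsWithin (0 : ℂ) {0}ᶜ, h.proj z * h.proj z - h.proj z = 0 := by
    have ht : Filter.Tendsto (fun x : ℝ => (x : ℂ)) (nhdsWithin 0 {0}ᶜ) (nhdsWithin (0 : ℂ) {0}ᶜ) := by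
      refine tendsto_nhdsWithin_iff.2 ⟨?_, ?_⟩
      · refine Filter.Tendsto.mono_left ?_ nhdsWithin_le_nhds
        exact Complex.continuous_ofReal.tendsto' 0 0 Complex.ofReal_zero
      · filter_upwards [self_mem_nhdsWithin] with x hx
        simpa using hx
    refine ht.frequently (Filter.Eventually.frequently ?_)
    filter_upwards [nhdsWithin_le_nhds (Metric.ball_mem_nhds (0 : ℝ) hr)] with x hx
    exact hreal x (by simpa using hx)
  exact sub_eq_zero.1 ((hd.analyticOnNhd Metric.isOpen_ball).eqOn_zero_of_preconnected_of_frequently_eq_zero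
    (convex_ball 0 r).isPreconnected h.zero_mem_ball hfreq hz)

theorem mul_proj_comm {z : ℂ} (hz : z ∈ Metric.ball (0 : ℂ) r) :
    F z * h.proj z = h.proj z * F z := by
  rw [proj, mul_smul_comm, smul_mul_assoc, ← contourCLM_constPath_mul, ← contourCLM_mul_constPath]
  congr 2
  have e : constPath (F z) = h.pencil z + scalarPath h.isolated.isContour.path := by
    rw [pencil, sub_add_cancel]
  rw [e, add_mul, mul_add, h.pencil_mul_resolvent hz, h.resolvent_mul_pencil hz,
    scalarPath_mul_comm]

/-- `F z - β = (F z - ζ) + (ζ - β)`, and the first summand times the resolvent is the constant `1`,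
whose integral over a closed contour vanishes. -/
theorem sub_mul_proj {z : ℂ} (hz : z ∈ Metric.ball (0 : ℂ) r) :
    (F z - algebraMap ℂ A β) * h.proj z = (-(2 * Real.pi * Complex.I)⁻¹ : ℂ) •
      contourCLM h.isolated.isContour (scalarPath h.isolated.shift * h.resolvent z) := by
  rw [proj, mul_smul_comm, ← contourCLM_constPath_mul]
  congr 1
  have e : constPath (F z - algebraMap ℂ A β) = h.pencil z + scalarPath h.isolated.shift := by
    ext t
    simp [pencil, IsolatedPoint.shift, Algebra.algebraMap_eq_smul_one]
  rw [e, add_mul, h.pencil_mul_resolvent hz, map_add, contourCLM_one, zero_add]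

/-- The trace of the Taylor coefficients of `(F z - β) P(z)`. -/
theorem trace_taylorCoef {I : Submodule ℂ A} {τ : A → ℂ} (ht : IsTraceIdeal I τ)
    (hP : h.isolated.proj ∈ I) {n : ℕ} (hn : n ≠ 0) :
    τ (taylorCoef n fun z => (F z - algebraMap ℂ A β) * h.proj z) =
      (2 * Real.pi * Complex.I)⁻¹ * τ (∑ c : Composition n, ((-1 : ℂ) ^ c.length / c.length) •
        contourCLM h.isolated.isContour
          (h.isolated.word (c.blocks.map fun k => taylorCoef k F))) := by
  have hr := h.radius_pos
  have hR := contDiffAt_of_differentiableOn h.differentiableOn_resolvent hr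
  let L : C(unitInterval, A) →L[ℂ] A := (-(2 * Real.pi * Complex.I)⁻¹ : ℂ) •
    (contourCLM h.isolated.isContour).comp
      (ContinuousLinearMap.mul ℂ _ (scalarPath h.isolated.shift))
  have e : taylorCoef n (fun z => (F z - algebraMap ℂ A β) * h.proj z) =
      L (taylorCoef n h.resolvent) := by
    rw [← taylorCoef_clm L n hR]
    refine taylorCoef_congr _ ?_
    filter_upwards [Metric.ball_mem_nhds (0 : ℂ) hr] with z hz
    exact h.sub_mul_proj hz
  rw [e, taylorCoef_resolvent]
  change τ ((-(2 * Real.pi * Complex.I)⁻¹ : ℂ) • contourCLM h.isolated.isContour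
    (scalarPath h.isolated.shift * _)) = _
  have hm : ∀ X ∈ h.isolated.laurent I, contourCLM h.isolated.isContour X ∈ I :=
    fun X hX => h.isolated.contourCLM_mem hX
  rw [ht.map_smul, h.isolated.trace_sum_composition ht hP _ hn, neg_mul_neg]
  refine hm _ ?_
  rw [← mul_assoc, Finset.mul_sum]
  refine Submodule.sum_mem _ fun c _ => ?_
  rw [mul_smul_comm]
  exact Submodule.smul_mem _ _ (h.isolated.mul_mem_laurent ht
    (h.isolated.shift_mul_resolvent_mem_laurent ht hP) (h.isolated.word_mem_laurent ht hP _))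

end HolomorphicFamily

/-! ### Cauchy estimates and the Taylor remainder. -/

theorem norm_taylorCoef_le {f : ℂ → ℂ} {r d : ℝ} (hr : 0 < r)
    (hf : DifferentiableOn ℂ f (Metric.ball 0 r)) (hd : ∀ z ∈ Metric.ball (0 : ℂ) r, ‖f z‖ ≤ d)
    (n : ℕ) : ‖taylorCoef n f‖ ≤ d / r ^ n := by
  rw [le_div_iff₀ (by positivity)]
  have h1 (ρ : ℝ) (h0 : 0 < ρ) (hρ : ρ < r) : ‖taylorCoef n f‖ * ρ ^ n ≤ d := by
    have h2 := Complex.norm_iteratedDeriv_le_of_forall_mem_sphere_norm_le n (c := 0) (f := f) (C := d) h0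
      ((hf.mono (Metric.closedBall_subset_ball hρ)).diffContOnCl_ball (U := Metric.closedBall 0 ρ) subset_rfl)
      fun z hz => hd z (by
        rw [mem_sphere_zero_iff_norm] at hz
        rw [mem_ball_zero_iff, hz]; exact hρ)
    rw [taylorCoef, norm_smul, norm_inv, Complex.norm_natCast]
    have h3 : (0 : ℝ) < n.factorial := by exact_mod_cast n.factorial_pos
    rw [le_div_iff₀ (by positivity)] at h2
    rw [mul_assoc, inv_mul_le_iff₀ h3]
    exact h2
  -- The function is controlled only on the open disc, so the Cauchy estimate on radius `ρ < r` is
  -- passed to the limit.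
  have h4 : Filter.Tendsto (fun ρ : ℝ => ‖taylorCoef n f‖ * ρ ^ n) (nhdsWithin r (Set.Iio r))
      (nhds (‖taylorCoef n f‖ * r ^ n)) :=
    ((continuous_const.mul (continuous_pow n)).tendsto r).mono_left nhdsWithin_le_nhds
  refine le_of_tendsto h4 ?_
  filter_upwards [Ioo_mem_nhdsLT hr] with ρ hρ
  exact h1 ρ hρ.1 hρ.2

/-- The remainder of the Taylor series of a bounded holomorphic function on a disc. -/
theorem norm_sub_taylor_le {f : ℂ → ℂ} {r d : ℝ} (hr : 0 < r)
    (hf : DifferentiableOn ℂ f (Metric.ball 0 r)) (hd : ∀ z ∈ Metric.ball (0 : ℂ) r, ‖f z‖ ≤ d)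
    {z : ℂ} (hz : ‖z‖ < r) (p : ℕ) :
    ‖f z - ∑ n ∈ Finset.range (p + 1), z ^ n * taylorCoef n f‖ ≤
      d * ‖z‖ ^ (p + 1) / (r ^ p * (r - ‖z‖)) := by
  have hz' : z ∈ Metric.ball (0 : ℂ) r := mem_ball_zero_iff.2 hz
  have hs : HasSum (fun n => z ^ n * taylorCoef n f) (f z) := by
    have := Complex.hasSum_taylorSeries_on_ball hf hz'
    refine this.congr_fun fun n => ?_
    simp only [taylorCoef, sub_zero, smul_eq_mul]
    ring
  have hd0 : 0 ≤ d := (norm_nonneg _).trans (hd z hz')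
  have ht := (hasSum_nat_add_iff' (p + 1)).2 hs
  set q := ‖z‖ / r
  have hq0 : 0 ≤ q := by positivity
  have hq1 : q < 1 := (div_lt_one hr).2 hz
  have hg : HasSum (fun n : ℕ => d * q ^ (p + 1) * q ^ n) (d * q ^ (p + 1) * (1 - q)⁻¹) :=
    (hasSum_geometric_of_lt_one hq0 hq1).mul_left _
  have hle := ht.norm_le_of_bounded hg fun n => by
    rw [norm_mul, norm_pow]
    calc ‖z‖ ^ (n + (p + 1)) * ‖taylorCoef (n + (p + 1)) f‖
        ≤ ‖z‖ ^ (n + (p + 1)) * (d / r ^ (n + (p + 1))) := by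
          gcongr
          exact norm_taylorCoef_le hr hf hd _
      _ = d * q ^ (p + 1) * q ^ n := by
          simp only [q, div_pow, pow_add]
          field_simp
  refine hle.trans (le_of_eq ?_)
  have h1 : r - ‖z‖ ≠ 0 := (sub_pos.2 hz).ne'
  have h2 : (1 - q)⁻¹ = r / (r - ‖z‖) := by
    have : 1 - q = (r - ‖z‖) / r := by simp only [q]; field_simp
    rw [this, inv_div]
  rw [h2]
  simp only [q, div_pow]
  field_simp
  ring

theorem opTrace_of_mul_self {H : Type*} [NormedAddCommGroup H] [NormedSpace ℂ H] {P : H →L[ℂ] H}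
    (hP : P * P = P) (hf : P ∈ finiteRank H) : opTrace P = Module.finrank ℂ P.range := by
  have : FiniteDimensional ℂ P.range := hf
  rw [opTrace]
  have : P.toLinearMap.rangeRestrict ∘ₗ P.range.subtype = LinearMap.id := by
    ext ⟨_, ⟨x, rfl⟩⟩
    exact congrArg (fun T : H →L[ℂ] H => T x) hP
  rw [this, LinearMap.trace_id]

theorem mem_spectrum_of_apply_eq {H : Type*} [NormedAddCommGroup H] [NormedSpace ℂ H] {T : H →L[ℂ] H} {μ : ℂ} {v : H} (hv : v ≠ 0) (hT : T v = μ • v) :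
    μ ∈ spectrum ℂ T := by
  rw [spectrum.mem_iff]
  intro hu
  have h1 := Ring.inverse_mul_cancel _ hu
  have h2 := congrArg (fun S : H →L[ℂ] H => S v) h1
  have h3 : (algebraMap ℂ (H →L[ℂ] H) μ - T) v = 0 := by
    rw [Algebra.algebraMap_eq_smul_one, sub_apply, hT]
    exact sub_self _
  rw [mul_apply_eq_comp, h3, map_zero] at h2
  exact hv h2.symm

/-! ### The weighted mean of the eigenvalue group on a Hilbert space. -/

namespace HolomorphicFamily

variable {H : Type*} [NormedAddCommGroup H] [InnerProductSpace ℂ H] [CompleteSpace H]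
  {F : ℂ → H →L[ℂ] H} {γ : ℝ → ℂ} {β : ℂ} {δ r : ℝ} (h : HolomorphicFamily F γ β δ r)

/-- On an eigenvector every resolvent acts as a scalar, so the integral reduces to a scalar Cauchy
integral. Normality of `F z`, which may fail at non-real `z`, plays no role. -/
theorem proj_apply_of_apply_eq {z : ℂ} (hz : z ∈ Metric.ball (0 : ℂ) r) {μ : ℂ} {v : H} (hv : v ≠ 0)
    (hT : F z v = μ • v) : h.proj z v = windingNumber γ μ • v := by
  have hμ : μ ∉ γ '' Set.Icc 0 1 := fun hm =>
    Set.disjoint_left.1 (h.disjoint hz) hm (mem_spectrum_of_apply_eq hv hT)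
  have e1 := contourCLM_comp h.isolated.isContour (ContinuousLinearMap.apply ℂ H v) (h.resolvent z)
  have e2 := contourCLM_comp h.isolated.isContour (ContinuousLinearMap.toSpanSingleton ℂ v)
    (cauchyKernel h.isolated.isContour μ hμ)
  have e3 : ((ContinuousLinearMap.apply ℂ H v : (H →L[ℂ] H) →L[ℂ] H) : C(H →L[ℂ] H, H)).comp
      (h.resolvent z) = -(((ContinuousLinearMap.toSpanSingleton ℂ v : ℂ →L[ℂ] H) : C(ℂ, H)).comp
        (cauchyKernel h.isolated.isContour μ hμ)) := by
    ext t
    change h.resolvent z t v = -((γ t - μ)⁻¹ • v)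
    have h0 : γ t - μ ≠ 0 := fun h0 => hμ ⟨t, t.2, sub_eq_zero.1 h0⟩
    have h1 : h.pencil z t v = -((γ t - μ) • v) := by
      change F z v - algebraMap ℂ (H →L[ℂ] H) (γ t) v = _
      rw [hT, Algebra.algebraMap_eq_smul_one]
      change μ • v - γ t • v = _
      rw [sub_smul, neg_sub]
    have h2 : h.resolvent z t (h.pencil z t v) = v :=
      congrArg (fun X : C(unitInterval, H →L[ℂ] H) => X t v) (h.resolvent_mul_pencil hz)
    rw [h1, map_neg, map_smul] at h2
    have h3 := congrArg (fun w => -((γ t - μ)⁻¹ • w)) h2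
    simpa [smul_smul, h0] using h3
  rw [e3, map_neg, e2, contourCLM_cauchyKernel] at e1
  change (-(2 * Real.pi * Complex.I)⁻¹ : ℂ) •
    (ContinuousLinearMap.apply ℂ H v) (contourCLM h.isolated.isContour (h.resolvent z)) = _
  rw [← e1, neg_smul_neg, ContinuousLinearMap.toSpanSingleton_apply, smul_smul,
    inv_mul_cancel_left₀ Complex.two_pi_I_ne_zero]

/-- Nearby idempotents have equal rank, `P` is continuous, and the disc is connected. -/
theorem rank_proj {z : ℂ} (hz : z ∈ Metric.ball (0 : ℂ) r) :
    (h.proj z).toLinearMap.rank = (h.proj 0).toLinearMap.rank := by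
  refine (convex_ball (0 : ℂ) r).isPreconnected.induction₂
    (fun z w => (h.proj z).toLinearMap.rank = (h.proj w).toLinearMap.rank) (fun z hz => ?_)
    (fun _ _ _ _ _ _ => Eq.trans) (fun _ _ _ _ => Eq.symm) hz h.zero_mem_ball
  have hc := h.differentiableOn_proj.continuousOn z hz
  filter_upwards [hc.eventually (Metric.ball_mem_nhds _ one_pos), self_mem_nhdsWithin] with w hw hwb
  have hw : ‖h.proj w - h.proj z‖ < 1 := by rwa [← dist_eq_norm]
  exact le_antisymm (rank_le_of_norm_sub_lt_one (h.proj_mul_proj hz) (by rwa [norm_sub_rev]))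
    (rank_le_of_norm_sub_lt_one (h.proj_mul_proj hwb) hw)

theorem rankLE_proj (hf : h.isolated.proj ∈ finiteRank H) {z : ℂ} (hz : z ∈ Metric.ball (0 : ℂ) r) :
    RankLE (Module.finrank ℂ (h.proj 0).range) (h.proj z) := by
  rw [← h.proj_zero] at hf
  have : FiniteDimensional ℂ (h.proj 0).range := hf
  rw [RankLE, h.rank_proj hz, Module.finrank_eq_rank]

theorem finrank_range_proj {z : ℂ} (hz : z ∈ Metric.ball (0 : ℂ) r) :
    Module.finrank ℂ (h.proj z).range = Module.finrank ℂ (h.proj 0).range :=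
  congrArg Cardinal.toNat (h.rank_proj hz)

theorem rankLE_mul_proj (hf : h.isolated.proj ∈ finiteRank H) {z : ℂ}
    (hz : z ∈ Metric.ball (0 : ℂ) r) (B : H →L[ℂ] H) :
    RankLE (Module.finrank ℂ (h.proj 0).range) (B * h.proj z) :=
  (LinearMap.rank_comp_le_right (h.proj z).toLinearMap B.toLinearMap).trans (h.rankLE_proj hf hz)

theorem opTrace_sub_mul_proj (hf : h.isolated.proj ∈ finiteRank H) {z : ℂ}
    (hz : z ∈ Metric.ball (0 : ℂ) r) :
    opTrace ((F z - algebraMap ℂ (H →L[ℂ] H) β) * h.proj z) =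
      opTrace (F z * h.proj z) - Module.finrank ℂ (h.proj 0).range * β := by
  have ht := isTraceIdeal_finiteRank (H := H)
  have hP := (h.rankLE_proj hf hz).mem_finiteRank
  rw [sub_mul, sub_eq_add_neg, ← Algebra.smul_def, ← neg_smul,
    ht.map_add (h.rankLE_mul_proj hf hz _).mem_finiteRank ((finiteRank H).smul_mem _ hP),
    ht.map_smul _ hP, opTrace_of_mul_self (h.proj_mul_proj hz) hP, h.finrank_range_proj hz]
  ring

/-- The range of `P(z)` is invariant under `F z`. An eigenvector in it is fixed by `P(z)`, so its
eigenvalue cannot have winding number zero and must lie within `δ` of `β`. -/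
theorem norm_opTrace_sub_mul_proj_le (hf : h.isolated.proj ∈ finiteRank H) {z : ℂ}
    (hz : z ∈ Metric.ball (0 : ℂ) r) :
    ‖opTrace ((F z - algebraMap ℂ (H →L[ℂ] H) β) * h.proj z)‖ ≤
      Module.finrank ℂ (h.proj 0).range * δ := by
  have hP : FiniteDimensional ℂ (h.proj z).range := (h.rankLE_proj hf hz).mem_finiteRank
  have hV (x : H) : (F z * h.proj z) x ∈ (h.proj z).range := by
    rw [h.mul_proj_comm hz]
    exact ⟨F z x, rfl⟩
  rw [h.opTrace_sub_mul_proj hf hz, opTrace_eq_trace _ _ hV, ← h.finrank_range_proj hz]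
  refine norm_trace_sub_le _ _ fun μ hμ => ?_
  obtain ⟨⟨v, x, hx⟩, hv⟩ := hμ.exists_hasEigenvector
  have hPv : h.proj z v = v := by
    rw [← hx]
    exact congrArg (fun T : H →L[ℂ] H => T x) (h.proj_mul_proj hz)
  have hFv : F z v = μ • v := by
    have := congrArg Subtype.val hv.apply_eq_smul
    change F z (h.proj z v) = μ • v at this
    rwa [hPv] at this
  have hv0 : v ≠ 0 := fun h0 => hv.2 (Subtype.ext h0)
  rcases h.winding_of_mem_spectrum hz (mem_spectrum_of_apply_eq hv0 hFv) with hw | hw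
  · exact hw.2.le
  · have := h.proj_apply_of_apply_eq hz hv0 hFv
    rw [hPv, hw, zero_smul] at this
    exact absurd this hv0

/-- The coefficients of the power series of the weighted mean of the eigenvalue group. -/
noncomputable def meanCoef (n : ℕ) : ℂ :=
  if n = 0 then β else
    (2 * Real.pi * Complex.I * (Module.finrank ℂ (h.proj 0).range : ℂ))⁻¹ *
      opTrace (∑ c : Composition n, ((-1 : ℂ) ^ c.length / (c.length : ℂ)) •
        contourCLM h.isolated.isContour (h.isolated.word (c.blocks.map fun k => taylorCoef k F)))

/-- The error of the truncated power series of the weighted mean of the eigenvalue group. -/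
theorem norm_mean_sub_le (hf : h.isolated.proj ∈ finiteRank H)
    (hm : Module.finrank ℂ (h.proj 0).range ≠ 0) {z : ℂ} (hz : ‖z‖ < r) (p : ℕ) :
    ‖(Module.finrank ℂ (h.proj 0).range : ℂ)⁻¹ * opTrace (F z * h.proj z) -
        ∑ n ∈ Finset.range (p + 1), z ^ n * h.meanCoef n‖ ≤
      δ * ‖z‖ ^ (p + 1) / (r ^ p * (r - ‖z‖)) := by
  set m := Module.finrank ℂ (h.proj 0).range with hmdef
  have hr := h.radius_pos
  have hm' : (m : ℂ) ≠ 0 := Nat.cast_ne_zero.2 hm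
  set G := fun z => (F z - algebraMap ℂ (H →L[ℂ] H) β) * h.proj z
  have hG : DifferentiableOn ℂ G (Metric.ball 0 r) :=
    (h.differentiableOn.sub_const _).mul h.differentiableOn_proj
  have hN (w) (hw : w ∈ Metric.ball (0 : ℂ) r) : RankLE m (G w) := h.rankLE_mul_proj hf hw _
  set f := fun z => (m : ℂ)⁻¹ * opTrace (G z)
  -- The function `f` is the mean minus `β`. Subtracting `β` inside the trace is what makes `δ` the
  -- bound, with no term in `|β|`.
  have hfd : DifferentiableOn ℂ f (Metric.ball 0 r) := by
    intro w hw
    have hn := Metric.isOpen_ball.mem_nhds hw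
    have := HasDerivAt.opTrace (hG.differentiableAt hn).hasDerivAt
      (Filter.eventually_of_mem hn hN)
    exact (this.differentiableAt.const_mul _).differentiableWithinAt
  have hfb (w) (hw : w ∈ Metric.ball (0 : ℂ) r) : ‖f w‖ ≤ δ := by
    rw [norm_mul, norm_inv, Complex.norm_natCast, inv_mul_le_iff₀ (by positivity)]
    exact h.norm_opTrace_sub_mul_proj_le hf hw
  have hf0 : f 0 = 0 := by
    have : G 0 = 0 := by
      change (F 0 - algebraMap ℂ (H →L[ℂ] H) β) * h.proj 0 = 0
      rw [h.proj_zero, sub_mul, h.isolated.mul_proj, ← Algebra.smul_def, sub_self]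
    change (m : ℂ)⁻¹ * opTrace (G 0) = 0
    rw [this, (isTraceIdeal_finiteRank (H := H)).map_zero, mul_zero]
  have hcoef (n : ℕ) (hn : n ≠ 0) : taylorCoef n f = h.meanCoef n := by
    have h1 := iteratedDeriv_opTrace n Metric.isOpen_ball hG hN h.zero_mem_ball
    have h2 := h.trace_taylorCoef (isTraceIdeal_finiteRank (H := H)) hf hn
    rw [taylorCoef, (isTraceIdeal_finiteRank (H := H)).map_smul _ h1.2] at h2
    rw [meanCoef, if_neg hn, mul_inv, mul_right_comm, ← h2, ← h1.1, taylorCoef]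
    have h3 : iteratedDeriv n f 0 = (m : ℂ)⁻¹ * iteratedDeriv n (fun w => opTrace (G w)) 0 :=
      iteratedDeriv_const_mul_field _ _
    rw [h3, smul_eq_mul]
    ring
  have e : (m : ℂ)⁻¹ * opTrace (F z * h.proj z) = β + f z := by
    change _ = β + (m : ℂ)⁻¹ * opTrace ((F z - algebraMap ℂ (H →L[ℂ] H) β) * h.proj z)
    rw [h.opTrace_sub_mul_proj hf (mem_ball_zero_iff.2 hz), ← hmdef]
    field_simp
    ring
  have key := norm_sub_taylor_le hr hfd hfb hz p
  -- The constant terms are treated apart: it is `0` for `f` and `β` for the mean. The remaining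
  -- coefficients agree.
  rw [Finset.sum_range_succ', taylorCoef_zero, hf0, mul_zero, add_zero] at key
  rw [e, Finset.sum_range_succ']
  convert key using 2
  rw [meanCoef, if_pos rfl, pow_zero, one_mul, add_comm β, add_sub_add_right_eq_sub]
  congr 1
  exact Finset.sum_congr rfl fun n _ => by rw [hcoef _ n.succ_ne_zero]

end HolomorphicFamily

/-! ### Inverting the contrast operator near infinite contrast. -/

/-- A self-adjoint operator `0 ≤ E ≤ 1` together with the orthogonal projection `Q` onto a subspace of
its kernel, such that `E ≥ s` on the range of `1 - Q`. -/
structure GappedForm {K : Type*} [NormedAddCommGroup K] [InnerProductSpace ℂ K] [CompleteSpace K]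
    (E Q : K →L[ℂ] K) (s : ℝ) : Prop where
  isSelfAdjoint : IsSelfAdjoint E
  isSelfAdjoint_proj : IsSelfAdjoint Q
  proj_mul_proj : Q * Q = Q
  mul_proj : E * Q = 0
  le_one : ∀ u, RCLike.re ⟪E u, u⟫_ℂ ≤ ‖u‖ ^ 2
  gap : ∀ u, Q u = 0 → s * ‖u‖ ^ 2 ≤ RCLike.re ⟪E u, u⟫_ℂ
  pos : 0 < s
  lt_one : s < 1

namespace GappedForm

variable {K : Type*} [NormedAddCommGroup K] [InnerProductSpace ℂ K] [CompleteSpace K]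
  {E Q : K →L[ℂ] K} {s : ℝ}

theorem proj_mul (h : GappedForm E Q s) : Q * E = 0 := by
  have := congrArg star h.mul_proj
  rwa [star_mul, h.isSelfAdjoint.star_eq, h.isSelfAdjoint_proj.star_eq, star_zero] at this

variable (E Q) in
/-- The operator `E + z (1 - E)` with its restriction to the range of `Q` replaced by the identity. -/
noncomputable def pencil (z : ℂ) : K →L[ℂ] K := E + z • (1 - E - Q) + Q

variable (E Q) in
/-- The part of the inverse of `z⁻¹ E + (1 - E)` on the range of `1 - Q`, divided by `z`. -/
noncomputable def reduced (z : ℂ) : K →L[ℂ] K := Ring.inverse (pencil E Q z) * (1 - Q)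

/-- The pencil respects the splitting of `u` along `Q`. It is the identity on the range of `Q`,
where the constant is at most `1`, and `E + z (1 - E)` on the complement. -/
theorem le_re_inner_pencil (h : GappedForm E Q s) (z : ℂ) (u : K) :
    (s - ‖z‖ * (1 - s)) * ‖u‖ ^ 2 ≤ RCLike.re ⟪pencil E Q z u, u⟫_ℂ := by
  set q := Q u
  set v := u - q
  have hu : u = v + q := (sub_add_cancel u q).symm
  have hQQ : Q q = q := congrArg (fun T : K →L[ℂ] K => T u) h.proj_mul_proj
  have hQv : Q v = 0 := by rw [map_sub, hQQ, sub_self]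
  have hEq : E q = 0 := congrArg (fun T : K →L[ℂ] K => T u) h.mul_proj
  have hQs := ContinuousLinearMap.isSelfAdjoint_iff_isSymmetric.1 h.isSelfAdjoint_proj
  have hEs := ContinuousLinearMap.isSelfAdjoint_iff_isSymmetric.1 h.isSelfAdjoint
  have hvq : ⟪v, q⟫_ℂ = 0 := by
    have : ⟪Q v, q⟫_ℂ = ⟪v, Q q⟫_ℂ := hQs v q
    rwa [hQv, hQQ, inner_zero_left, eq_comm] at this
  have hqv : ⟪q, v⟫_ℂ = 0 := by rw [← inner_conj_symm, hvq, map_zero]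
  have hEvq : ⟪E v, q⟫_ℂ = 0 := by
    have : ⟪E v, q⟫_ℂ = ⟪v, E q⟫_ℂ := hEs v q
    rwa [hEq, inner_zero_right] at this
  have hp : pencil E Q z u = E v + z • (v - E v) + q := by
    have : pencil E Q z u = E u + z • (u - E u - Q u) + Q u := rfl
    rw [this, hu]
    simp only [map_add, hEq, hQv, hQQ]
    congr 3 <;> abel
  have hEr : ((RCLike.re ⟪E v, v⟫_ℂ : ℝ) : ℂ) = ⟪E v, v⟫_ℂ := by
    exact hEs.coe_re_inner_apply_self v
  have e : ⟪pencil E Q z u, u⟫_ℂ =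
      ⟪E v, v⟫_ℂ + (starRingEnd ℂ) z * (⟪v, v⟫_ℂ - ⟪E v, v⟫_ℂ) + ⟪q, q⟫_ℂ := by
    rw [hp, hu]
    simp only [inner_add_left, inner_add_right, inner_smul_left, inner_sub_left, hvq, hqv, hEvq]
    ring
  have hn : ‖u‖ ^ 2 = ‖v‖ ^ 2 + ‖q‖ ^ 2 := by
    rw [sq, sq, sq, hu]
    exact norm_add_sq_eq_norm_sq_add_norm_sq_of_inner_eq_zero v q hvq
  rw [e, ← hEr, inner_self_eq_norm_sq_to_K, inner_self_eq_norm_sq_to_K]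
  set a := RCLike.re ⟪E v, v⟫_ℂ
  have ha := h.gap v hQv
  have hb := h.le_one v
  have hre : RCLike.re ((a : ℂ) + (starRingEnd ℂ) z * (((‖v‖ : ℝ) : ℂ) ^ 2 - a) + ((‖q‖ : ℝ) : ℂ) ^ 2) =
      a + z.re * (‖v‖ ^ 2 - a) + ‖q‖ ^ 2 := by
    simp [← Complex.ofReal_pow, ← Complex.ofReal_sub]
  refine le_of_le_of_eq ?_ hre.symm
  have hz1 : -‖z‖ ≤ z.re := (abs_le.1 (Complex.abs_re_le_norm z)).1
  have h1 := mul_le_mul_of_nonneg_right hz1 (sub_nonneg.2 hb)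
  -- With `a = ⟪E v, v⟫`, the worst case is `a - |z| (‖v‖² - a) = (1 + |z|) a - |z| ‖v‖²`, and `a ≥
  -- s ‖v‖²` gives the constant `s - |z| (1 - s)`.
  have h2 := mul_le_mul_of_nonneg_left ha (by positivity : 0 ≤ 1 + ‖z‖)
  have h3 : (s - ‖z‖ * (1 - s)) * ‖q‖ ^ 2 ≤ 1 * ‖q‖ ^ 2 := by
    have := h.lt_one
    gcongr
    nlinarith [norm_nonneg z]
  rw [hn]
  nlinarith

theorem le_norm_pencil (h : GappedForm E Q s) (z : ℂ) (u : K) :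
    (s - ‖z‖ * (1 - s)) * ‖u‖ ≤ ‖pencil E Q z u‖ := by
  rcases eq_or_ne u 0 with rfl | hu
  · simp
  · have h1 := (h.le_re_inner_pencil z u).trans (RCLike.re_le_norm _)
    have h2 := norm_inner_le_norm (𝕜 := ℂ) (pencil E Q z u) u
    refine le_of_mul_le_mul_right ?_ (norm_pos_iff.2 hu)
    calc _ = (s - ‖z‖ * (1 - s)) * ‖u‖ ^ 2 := by ring
      _ ≤ _ := h1.trans h2

theorem isUnit_pencil (h : GappedForm E Q s) {z : ℂ} (hz : ‖z‖ * (1 - s) < s) :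
    IsUnit (pencil E Q z) := by
  refine ContinuousLinearMap.isUnit_of_forall_le_norm_inner_map _
    (c := ⟨s - ‖z‖ * (1 - s), (sub_pos.2 hz).le⟩) (sub_pos.2 hz) fun u => ?_
  rw [mul_comm]
  exact (h.le_re_inner_pencil z u).trans (RCLike.re_le_norm _)

theorem norm_reduced_le (h : GappedForm E Q s) {z : ℂ} (hz : ‖z‖ * (1 - s) < s) :
    ‖reduced E Q z‖ ≤ (s - ‖z‖ * (1 - s))⁻¹ := by
  have hκ := sub_pos.2 hz
  refine ContinuousLinearMap.opNorm_le_bound _ (inv_nonneg.2 hκ.le) fun u => ?_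
  rw [inv_mul_eq_div, le_div_iff₀ hκ, mul_comm]
  refine (h.le_norm_pencil z _).trans ?_
  have e : pencil E Q z (reduced E Q z u) = u - Q u := by
    have := Ring.mul_inverse_cancel _ (h.isUnit_pencil hz)
    exact congrArg (fun T : K →L[ℂ] K => T (u - Q u)) this
  rw [e]
  have hQs := ContinuousLinearMap.isSelfAdjoint_iff_isSymmetric.1 h.isSelfAdjoint_proj
  have h1 : ⟪u - Q u, Q u⟫_ℂ = 0 := by
    have h2 : ⟪Q u, Q u⟫_ℂ = ⟪u, Q (Q u)⟫_ℂ := hQs u (Q u)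
    have h3 : Q (Q u) = Q u := congrArg (fun T : K →L[ℂ] K => T u) h.proj_mul_proj
    rw [h3] at h2
    rw [inner_sub_left, h2, sub_self]
  have h2 := norm_add_sq_eq_norm_sq_add_norm_sq_of_inner_eq_zero _ _ h1
  rw [sub_add_cancel] at h2
  exact abs_le_of_sq_le_sq' (by nlinarith [mul_self_nonneg ‖Q u‖]) (norm_nonneg u) |>.2

theorem pencil_mul_proj (h : GappedForm E Q s) (z : ℂ) : pencil E Q z * Q = Q := by
  rw [pencil, add_mul, add_mul, smul_mul_assoc, sub_mul, sub_mul, h.mul_proj, h.proj_mul_proj]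
  simp

theorem proj_mul_pencil (h : GappedForm E Q s) (z : ℂ) : Q * pencil E Q z = Q := by
  rw [pencil, mul_add, mul_add, mul_smul_comm, mul_sub, mul_sub, h.proj_mul, h.proj_mul_proj]
  simp

theorem proj_mul_inverse (h : GappedForm E Q s) {z : ℂ} (hz : ‖z‖ * (1 - s) < s) :
    Q * Ring.inverse (pencil E Q z) = Q := by
  have := congrArg (· * Ring.inverse (pencil E Q z)) (h.proj_mul_pencil z)
  simp only [mul_assoc, Ring.mul_inverse_cancel _ (h.isUnit_pencil hz), mul_one] at this
  exact this.symm

theorem inverse_mul_proj (h : GappedForm E Q s) {z : ℂ} (hz : ‖z‖ * (1 - s) < s) :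
    Ring.inverse (pencil E Q z) * Q = Q := by
  have := congrArg (Ring.inverse (pencil E Q z) * ·) (h.pencil_mul_proj z)
  simp only [← mul_assoc, Ring.inverse_mul_cancel _ (h.isUnit_pencil hz), one_mul] at this
  exact this.symm

theorem reduced_eq (h : GappedForm E Q s) {z : ℂ} (hz : ‖z‖ * (1 - s) < s) :
    reduced E Q z = Ring.inverse (pencil E Q z) - Q := by
  rw [reduced, mul_sub, mul_one, h.inverse_mul_proj hz]

/-- The operator is the identity on the range of `Q` and `z⁻¹` times the pencil on its complement.
The right-hand side remains meaningful at `z = 0`, where it is `Q`. -/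
theorem ringInverse_contrast (h : GappedForm E Q s) {z : ℂ} (hz : ‖z‖ * (1 - s) < s) (hz0 : z ≠ 0) :
    Ring.inverse (z⁻¹ • E + (1 - E)) = Q + z • reduced E Q z := by
  have e : z⁻¹ • E + (1 - E) = z⁻¹ • (pencil E Q z + (z - 1) • Q) := by
    rw [pencil]
    simp only [smul_add, smul_sub, sub_smul, one_smul, smul_smul, inv_mul_cancel₀ hz0]
    abel
  have h1 := Ring.mul_inverse_cancel _ (h.isUnit_pencil hz)
  have h2 := Ring.inverse_mul_cancel _ (h.isUnit_pencil hz)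
  rw [e, h.reduced_eq hz]
  refine ringInverse_eq_of_mul_eq_one ?_ ?_
  · simp only [mul_add, add_mul, mul_sub, smul_mul_assoc, mul_smul_comm, h1, h.pencil_mul_proj,
      h.proj_mul_inverse hz, h.proj_mul_proj, smul_add, smul_sub, smul_smul]
    match_scalars <;> field_simp
    ring
  · simp only [mul_add, add_mul, sub_mul, smul_mul_assoc, mul_smul_comm, h2, h.proj_mul_pencil,
      h.inverse_mul_proj hz, h.proj_mul_proj, smul_add, smul_sub, smul_smul]
    match_scalars <;> field_simp
    ring

theorem differentiableAt_reduced (h : GappedForm E Q s) {z : ℂ} (hz : ‖z‖ * (1 - s) < s) :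
    DifferentiableAt ℂ (reduced E Q) z := by
  have h1 : DifferentiableAt ℂ (pencil E Q) z := by unfold pencil; fun_prop
  have h2 : DifferentiableAt ℂ (fun z => Ring.inverse (pencil E Q z)) z :=
    (differentiableAt_inverse (𝕜 := ℂ) (h.isUnit_pencil hz)).comp z h1
  exact h2.mul_const _

theorem isSelfAdjoint_reduced (h : GappedForm E Q s) {x : ℝ} (hx : |x| * (1 - s) < s) :
    IsSelfAdjoint (reduced E Q x) := by
  have hx' : ‖(x : ℂ)‖ * (1 - s) < s := by rwa [Complex.norm_real]
  have hp : IsSelfAdjoint (pencil E Q x) := by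
    refine (h.isSelfAdjoint.add (IsSelfAdjoint.smul ?_ ?_)).add h.isSelfAdjoint_proj
    · exact Complex.conj_ofReal x
    · exact ((IsSelfAdjoint.one _).sub h.isSelfAdjoint).sub h.isSelfAdjoint_proj
  rw [h.reduced_eq hx']
  refine IsSelfAdjoint.sub ?_ h.isSelfAdjoint_proj
  rw [IsSelfAdjoint, ← Ring.inverse_star, hp.star_eq]

end GappedForm

/-! ### Lower bounds from the spectrum of a compression. -/

section Compression

variable {K : Type*} [NormedAddCommGroup K] [InnerProductSpace ℂ K] [CompleteSpace K]

theorem le_re_inner_of_forall_le_spectrum {T : K →L[ℂ] K} (hT : IsSelfAdjoint T) {m : ℝ}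
    (h : ∀ x : ℝ, (x : ℂ) ∈ spectrum ℂ T → m ≤ x) (w : K) :
    m * ‖w‖ ^ 2 ≤ RCLike.re ⟪T w, w⟫_ℂ := by
  have h1 : algebraMap ℝ (K →L[ℂ] K) m ≤ T := by
    refine algebraMap_le_of_le_spectrum (fun x hx => ?_) hT
    rw [← spectrum.preimage_algebraMap ℂ] at hx
    exact h x hx
  have h2 := ((ContinuousLinearMap.le_def _ _).1 h1).re_inner_nonneg_left w
  have h4 : ⟪algebraMap ℝ (K →L[ℂ] K) m w, w⟫_ℂ = ((m * ‖w‖ ^ 2 : ℝ) : ℂ) := by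
    rw [IsScalarTower.algebraMap_apply ℝ ℂ (K →L[ℂ] K), Algebra.algebraMap_eq_smul_one,
      smul_apply, one_apply_eq_self, inner_smul_left, inner_self_eq_norm_sq_to_K]
    simp
  rw [sub_apply, inner_sub_left, h4, map_sub] at h2
  exact sub_nonneg.1 h2

theorem sInf_le_of_mem_spectrum {T : K →L[ℂ] K} {x : ℝ} (hx : (x : ℂ) ∈ spectrum ℂ T) :
    sInf {x : ℝ | (x : ℂ) ∈ spectrum ℂ T} ≤ x := by
  refine csInf_le ⟨-(‖T‖ * ‖(1 : K →L[ℂ] K)‖), fun y hy => ?_⟩ hx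
  have := spectrum.norm_le_norm_mul_of_mem (𝕜 := ℂ) hy
  rw [Complex.norm_real] at this
  exact (abs_le.1 this).1

/-- The compression of a self-adjoint operator is bounded below by the bottom of its spectrum. -/
theorem sInf_compression_le (S : K →L[ℂ] K) (hS : IsSelfAdjoint S) (W : Submodule ℂ K)
    [CompleteSpace W] (w : W) :
    sInf {x : ℝ | (x : ℂ) ∈ spectrum ℂ
      (W.orthogonalProjectionOnto.comp (S.comp W.subtypeL))} * ‖w‖ ^ 2 ≤
      RCLike.re ⟪S w, (w : K)⟫_ℂ := by
  set T := W.orthogonalProjectionOnto.comp (S.comp W.subtypeL)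
  have hi (u v : W) : ⟪T u, v⟫_ℂ = ⟪S u, (v : K)⟫_ℂ :=
    W.inner_orthogonalProjectionOnto_eq_of_mem_right v (S u)
  have hT : IsSelfAdjoint T := by
    refine ContinuousLinearMap.isSelfAdjoint_iff_isSymmetric.2 fun u v => ?_
    refine (hi u v).trans ?_
    rw [← inner_conj_symm (u : W)]
    refine Eq.trans ?_ (congrArg (starRingEnd ℂ) (hi v u).symm)
    rw [inner_conj_symm]
    exact ContinuousLinearMap.isSelfAdjoint_iff_isSymmetric.1 hS u v
  rw [← hi]
  exact le_re_inner_of_forall_le_spectrum hT (fun x hx => sInf_le_of_mem_spectrum hx) w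

/-- If `E - 1/2` is bounded below by `m` on the complement of `ker E ⊔ ker (1 - E)`, then `E` is bounded
below by `m + 1/2` on the complement of `ker E`. -/
theorem le_re_inner_of_compl {E : K →L[ℂ] K} (hE : IsSelfAdjoint E) {W₁ W₂ : Submodule ℂ K}
    [CompleteSpace W₁] (h1 : ∀ u ∈ W₁, E u = u) (h2 : ∀ u ∈ W₂, E u = 0) {s : ℝ} (hs : s ≤ 1)
    (h : ∀ w ∈ (W₁ ⊔ W₂)ᗮ, s * ‖w‖ ^ 2 ≤ RCLike.re ⟪E w, w⟫_ℂ) {u : K} (hu : u ∈ W₂ᗮ) :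
    s * ‖u‖ ^ 2 ≤ RCLike.re ⟪E u, u⟫_ℂ := by
  have hEs := ContinuousLinearMap.isSelfAdjoint_iff_isSymmetric.1 hE
  set p := W₁.starProjection u
  set w := u - p
  have hp : p ∈ W₁ := Submodule.starProjection_apply_mem _ _
  have hw1 : w ∈ W₁ᗮ := Submodule.sub_starProjection_mem_orthogonal u
  have hEp := h1 p hp
  -- Vectors fixed by the self-adjoint `E` are orthogonal to vectors killed by it, so removing the
  -- `W₁` component keeps `u` orthogonal to `W₂`. On that component `E` is the identity, and `s ≤ 1`
  -- suffices.
  have hpW : p ∈ W₂ᗮ := by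
    rw [Submodule.mem_orthogonal]
    intro q hq
    have : ⟪E q, p⟫_ℂ = ⟪q, E p⟫_ℂ := hEs q p
    rw [h2 q hq, hEp, inner_zero_left] at this
    exact this.symm
  have hw : w ∈ (W₁ ⊔ W₂)ᗮ := by
    rw [← Submodule.inf_orthogonal]
    exact ⟨hw1, W₂ᗮ.sub_mem hu hpW⟩
  have hpw : ⟪p, w⟫_ℂ = 0 := (Submodule.mem_orthogonal _ _).1 hw1 p hp
  have hwp : ⟪w, p⟫_ℂ = 0 := by rw [← inner_conj_symm, hpw, map_zero]
  have hEwp : ⟪E w, p⟫_ℂ = 0 := by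
    have : ⟪E w, p⟫_ℂ = ⟪w, E p⟫_ℂ := hEs w p
    rw [this, hEp, hwp]
  have hu' : u = p + w := (add_sub_cancel p u).symm
  have e : RCLike.re ⟪E u, u⟫_ℂ = ‖p‖ ^ 2 + RCLike.re ⟪E w, w⟫_ℂ := by
    rw [hu', map_add, hEp, inner_add_left, inner_add_right, inner_add_right, hpw, hEwp, add_zero,
      zero_add, map_add, inner_self_eq_norm_sq]
  have hn : ‖u‖ ^ 2 = ‖p‖ ^ 2 + ‖w‖ ^ 2 := by
    rw [sq, sq, sq]
    conv_lhs => rw [hu']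
    exact norm_add_sq_eq_norm_sq_add_norm_sq_of_inner_eq_zero p w hpw
  rw [e, hn]
  nlinarith [h w hw, sq_nonneg ‖p‖]

end Compression

theorem mul_starProjection_eq_zero {K : Type*} [NormedAddCommGroup K] [InnerProductSpace ℂ K] {E : K →L[ℂ] K} {W : Submodule ℂ K} [W.HasOrthogonalProjection]
    (h : ∀ u ∈ W, E u = 0) : E * W.starProjection = 0 := by
  ext1 u
  exact h _ (W.starProjection_apply_mem u)

/-! ### The energy forms of the crystal. -/

section Form

variable {D : Set R3} (α : BrillouinZone)

theorem inner_energyOp_left (S : Set R3) (u v : J α) :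
    ⟪energyOp α S u, v⟫_ℂ = ⟪curlOn α S u, curlOn α S v⟫_ℂ := by
  rw [energyOp, ContinuousLinearMap.comp_apply, ContinuousLinearMap.adjoint_inner_left]

theorem isSelfAdjoint_energyOp (S : Set R3) : IsSelfAdjoint (energyOp α S) := by
  refine ContinuousLinearMap.isSelfAdjoint_iff_isSymmetric.2 fun u v => ?_
  refine (inner_energyOp_left α S u v).trans ?_
  rw [← inner_conj_symm u]
  refine Eq.trans ?_ (congrArg (starRingEnd ℂ) (inner_energyOp_left α S v u).symm)
  rw [inner_conj_symm]

theorem re_inner_energyOp (S : Set R3) (u : J α) :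
    RCLike.re ⟪energyOp α S u, u⟫_ℂ = ‖curlOn α S u‖ ^ 2 := by
  rw [inner_energyOp_left, inner_self_eq_norm_sq]

theorem energyOp_eq_zero {S : Set R3} {u : J α} (h : curlOn α S u = 0) : energyOp α S u = 0 := by
  rw [energyOp, ContinuousLinearMap.comp_apply, h, map_zero]

/-- Host and inclusions partition the cell, and the inner product of `J` is the full curl energy.
Everything can therefore be expressed through the host operator alone. -/
theorem energyOp_add (hD : MeasurableSet D) (hDY : D ⊆ unitCell) :
    energyOp α (unitCell \ D) + energyOp α D = 1 := by
  ext1 u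
  refine ext_inner_left ℂ fun w => ?_
  rw [add_apply, inner_add_right, inner_energyOp, inner_energyOp]
  have hi : Integrable (fun x => ⟪J.curl α w x, J.curl α u x⟫_ℂ) cellMeasure :=
    L2.integrable_inner _ _
  have h1 := integral_inter_add_sdiff (s := unitCell) hD hi.integrableOn
  rw [Set.inter_eq_right.2 hDY, add_comm] at h1
  rw [h1, Measure.restrict_restrict measurableSet_unitCell, Set.inter_self]
  exact (L2.inner_def (𝕜 := ℂ) (J.curl α w) (J.curl α u)).symm

instance : CompleteSpace (W1 D α) := (curlOn α D).completeSpace_ker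

theorem energyOp_eq (hD : MeasurableSet D) (hDY : D ⊆ unitCell) :
    energyOp α D = 1 - energyOp α (unitCell \ D) :=
  eq_sub_of_add_eq' (energyOp_add α hD hDY)

theorem structuralOp_eq (hD : MeasurableSet D) (hDY : D ⊆ unitCell) :
    structuralOp D α = energyOp α (unitCell \ D) - (1 / 2 : ℂ) • 1 := by
  rw [structuralOp, energyOp_eq α hD hDY]
  match_scalars <;> ring

theorem isSelfAdjoint_structuralOp (hD : MeasurableSet D) (hDY : D ⊆ unitCell) :
    IsSelfAdjoint (structuralOp D α) := by
  rw [structuralOp_eq α hD hDY]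
  refine (isSelfAdjoint_energyOp α _).sub (IsSelfAdjoint.smul ?_ (IsSelfAdjoint.one _))
  rw [IsSelfAdjoint, show (1 / 2 : ℂ) = ((1 / 2 : ℝ) : ℂ) by norm_num]
  exact Complex.conj_ofReal _

theorem energyOp_comp_starProjection :
    energyOp α (unitCell \ D) * (W2 D α).starProjection = 0 :=
  mul_starProjection_eq_zero fun _ hu => energyOp_eq_zero α hu

theorem re_inner_energyOp_le (hD : MeasurableSet D) (hDY : D ⊆ unitCell) (u : J α) :
    RCLike.re ⟪energyOp α (unitCell \ D) u, u⟫_ℂ ≤ ‖u‖ ^ 2 := by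
  have h := congrArg (fun T : J α →L[ℂ] J α => RCLike.re ⟪T u, u⟫_ℂ) (energyOp_add α hD hDY)
  have h2 : RCLike.re ⟪(1 : J α →L[ℂ] J α) u, u⟫_ℂ = ‖u‖ ^ 2 := inner_self_eq_norm_sq u
  simp only [h2, add_apply, inner_add_left, map_add, re_inner_energyOp] at h ⊢
  nlinarith [sq_nonneg ‖curlOn α D u‖]

theorem energyOp_apply_of_mem_W1 (hD : MeasurableSet D) (hDY : D ⊆ unitCell) {u : J α}
    (hu : u ∈ W1 D α) : energyOp α (unitCell \ D) u = u := by
  have := congrArg (fun T : J α →L[ℂ] J α => T u) (energyOp_add α hD hDY)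
  rwa [add_apply, energyOp_eq_zero α (S := D) hu, add_zero] at this

theorem le_re_inner_energyOp_of_mem_W3 (hD : MeasurableSet D) (hDY : D ⊆ unitCell) {w : J α}
    (hw : w ∈ W3 D α) :
    (muMinus D α + 1 / 2) * ‖w‖ ^ 2 ≤ RCLike.re ⟪energyOp α (unitCell \ D) w, w⟫_ℂ := by
  have h3 : muMinus D α * ‖w‖ ^ 2 ≤ RCLike.re ⟪structuralOp D α w, w⟫_ℂ :=
    sInf_compression_le _ (isSelfAdjoint_structuralOp α hD hDY) (W3 D α) ⟨w, hw⟩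
  rw [structuralOp_eq α hD hDY, sub_apply, inner_sub_left, smul_apply, one_apply_eq_self,
    inner_smul_left, inner_self_eq_norm_sq_to_K] at h3
  have h4 : RCLike.re ((starRingEnd ℂ) (1 / 2 : ℂ) * ((‖w‖ : ℝ) : ℂ) ^ 2) = 1 / 2 * ‖w‖ ^ 2 := by
    rw [← Complex.ofReal_pow, show (1 / 2 : ℂ) = ((1 / 2 : ℝ) : ℂ) by norm_num, Complex.conj_ofReal,
      ← Complex.ofReal_mul]
    rfl
  rw [map_sub] at h3
  have h5 := h3.trans_eq (congrArg (_ - ·) h4)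
  linarith

theorem le_re_inner_energyOp (hD : MeasurableSet D) (hDY : D ⊆ unitCell)
    (hμ : muMinus D α < 1 / 2) {u : J α} (hu : u ∈ (W2 D α)ᗮ) :
    (muMinus D α + 1 / 2) * ‖u‖ ^ 2 ≤ RCLike.re ⟪energyOp α (unitCell \ D) u, u⟫_ℂ :=
  le_re_inner_of_compl (isSelfAdjoint_energyOp α _) (W₁ := W1 D α) (W₂ := W2 D α)
    (fun _ hu => energyOp_apply_of_mem_W1 α hD hDY hu) (fun _ hu => energyOp_eq_zero α hu)
    (by linarith) (fun _ hw => le_re_inner_energyOp_of_mem_W3 α hD hDY hw) hu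

/-- The structural operator is `E - 1/2`, so `μ⁻ + 1/2` bounds `E` from below on `W3`; on `W1` the
operator `E` is the identity. Together these cover the complement of `W2`, and the bounds on `μ⁻`
put the constant strictly between `0` and `1`. -/
theorem gappedForm (hD : MeasurableSet D) (hDY : D ⊆ unitCell) (hμ : -1 / 2 < muMinus D α)
    (hμ0 : muMinus D α < 1 / 2) :
    GappedForm (energyOp α (unitCell \ D)) (W2 D α).starProjection (muMinus D α + 1 / 2) where
  isSelfAdjoint := isSelfAdjoint_energyOp α _
  isSelfAdjoint_proj := isSelfAdjoint_starProjection _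
  proj_mul_proj := (W2 D α).isIdempotentElem_starProjection
  mul_proj := energyOp_comp_starProjection α
  le_one := re_inner_energyOp_le α hD hDY
  gap _ hu := le_re_inner_energyOp α hD hDY hμ0 ((Submodule.starProjection_apply_eq_zero_iff _).1 hu)
  pos := by linarith
  lt_one := by linarith

end Form

/-! ### The gap between contour and spectrum. -/

section ContourGap

theorem contourGap_le {γ : ℝ → ℂ} {σ : Set ℂ} {t : ℝ} (ht : t ∈ Set.Icc (0 : ℝ) 1) {x : ℂ} (hx : x ∈ σ) :
    contourGap γ σ ≤ ‖γ t - x‖ := by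
  rw [← dist_eq_norm]
  refine le_trans (csInf_le ?_ ⟨γ t, ⟨t, ht, rfl⟩, rfl⟩) (Metric.infDist_le_dist_of_mem hx)
  refine ⟨0, ?_⟩
  rintro _ ⟨ζ, -, rfl⟩
  exact Metric.infDist_nonneg

theorem contourGap_pos {γ : ℝ → ℂ} {σ : Set ℂ} (hγ : ContinuousOn γ (Set.Icc 0 1))
    (hσ : IsClosed σ) (hne : σ.Nonempty) (hd : Disjoint (γ '' Set.Icc 0 1) σ) :
    0 < contourGap γ σ := by
  have hc : IsCompact ((fun ζ => Metric.infDist ζ σ) '' (γ '' Set.Icc 0 1)) :=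
    (isCompact_Icc.image_of_continuousOn hγ).image (Metric.continuous_infDist_pt σ)
  obtain ⟨ζ, hζ, e⟩ := hc.sInf_mem
    (((Set.nonempty_Icc.2 zero_le_one).image γ).image _)
  rw [contourGap, ← e]
  exact (hσ.notMem_iff_infDist_pos hne).1 (Set.disjoint_left.1 hd hζ)

theorem isolatedPoint_of_isolates {A : Type*} [CStarAlgebra A] {a : A} (ha : IsStarNormal a)
    {γ : ℝ → ℂ} {β : ℂ} (hβ : β ∈ spectrum ℂ a) (hγ : Isolates γ β (spectrum ℂ a)) :
    IsolatedPoint γ β a (contourGap γ (spectrum ℂ a)) where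
  normal := ha
  mem := hβ
  pos := contourGap_pos hγ.isContour.continuousOn (spectrum.isClosed a) ⟨β, hβ⟩ hγ.disjoint
  isContour := hγ.isContour
  disjoint := hγ.disjoint
  inside := hγ.inside
  outside := hγ.outside
  isolated w hw hne := by
    by_contra! hlt
    -- A spectral point closer to `β` than the gap would share its winding number `1`, so the gap
    -- itself serves as isolation radius.
    have h := windingNumber_eq_of_dist_lt hγ.isContour (fun t ht => contourGap_le ht hβ) hlt
    rw [hγ.inside, hγ.outside w hw hne] at h
    exact zero_ne_one h

end ContourGap

/-! ### From the form to a holomorphic family on `L²`. -/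

section Sandwich

variable {K H : Type*} [NormedAddCommGroup K] [InnerProductSpace ℂ K] [CompleteSpace K]
  [NormedAddCommGroup H] [InnerProductSpace ℂ H] [CompleteSpace H]

/-- The map `T ↦ e T e*`. -/
noncomputable def sandwich (e : K →L[ℂ] H) : (K →L[ℂ] K) →L[ℂ] (H →L[ℂ] H) :=
  (ContinuousLinearMap.compL ℂ H K H e).comp
    ((ContinuousLinearMap.compL ℂ H K K).flip (ContinuousLinearMap.adjoint e))

theorem sandwich_apply (e : K →L[ℂ] H) (T : K →L[ℂ] K) :
    sandwich e T = e.comp (T.comp (ContinuousLinearMap.adjoint e)) := rfl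

theorem norm_sandwich_le (e : K →L[ℂ] H) (T : K →L[ℂ] K) : ‖sandwich e T‖ ≤ ‖e‖ ^ 2 * ‖T‖ := by
  rw [sandwich_apply]
  refine (e.opNorm_comp_le _).trans ?_
  have h := T.opNorm_comp_le (ContinuousLinearMap.adjoint e)
  rw [LinearIsometryEquiv.norm_map] at h
  nlinarith [norm_nonneg e]

theorem isSelfAdjoint_sandwich (e : K →L[ℂ] H) {T : K →L[ℂ] K} (hT : IsSelfAdjoint T) :
    IsSelfAdjoint (sandwich e T) := hT.conj_adjoint e

/-- The radius is the solution `x` of `c⁻¹ x / (s - x (1 - s)) = d`, the point where the bound on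
`‖F z - F 0‖` reaches the gap. It is smaller than `s / (1 - s)`, so the pencil stays invertible. -/
theorem GappedForm.holomorphicFamily {E Q : K →L[ℂ] K} {s : ℝ} (h : GappedForm E Q s)
    (e : K →L[ℂ] H) {c : ℝ} (hc : 0 < c) (he : ‖e‖ ^ 2 ≤ c⁻¹) {F : ℂ → H →L[ℂ] H}
    (hF : ∀ z : ℂ, ‖z‖ * (1 - s) < s → F z = sandwich e (Q + z • reduced E Q z))
    {γ : ℝ → ℂ} {β : ℂ} {d : ℝ} (hi : IsolatedPoint γ β (F 0) d)
    (hg : ∀ t ∈ Set.Icc (0 : ℝ) 1, ∀ x ∈ spectrum ℂ (F 0), d ≤ ‖γ t - x‖) :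
    HolomorphicFamily F γ β d (c * d * (s / (1 - s)) / (1 / (1 - s) + c * d)) := by
  have hd := hi.pos
  have hs0 := h.pos
  have hs1 := sub_pos.2 h.lt_one
  set r := c * d * (s / (1 - s)) / (1 / (1 - s) + c * d) with hr
  have hden : 0 < 1 / (1 - s) + c * d := by positivity
  have key {x : ℝ} (hx : x < r) : x < c * d * (s - x * (1 - s)) := by
    rw [hr, lt_div_iff₀ hden] at hx
    have h1 := mul_lt_mul_of_pos_right hx hs1
    have e1 : x * (1 / (1 - s) + c * d) * (1 - s) = x + x * (c * d) * (1 - s) := by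
      field_simp
    have e2 : c * d * (s / (1 - s)) * (1 - s) = c * d * s := by field_simp
    rw [e1, e2] at h1
    nlinarith
  have hlt {z : ℂ} (hz : ‖z‖ < r) : ‖z‖ * (1 - s) < s := by
    have h1 := key hz
    have h2 : 0 < c * d * (s - ‖z‖ * (1 - s)) := (norm_nonneg z).trans_lt h1
    exact sub_pos.1 (pos_of_mul_pos_right h2 (by positivity))
  refine ⟨hi, hg, by positivity, ?_, ?_, ?_⟩
  · intro z hz
    rw [mem_ball_zero_iff] at hz
    have h1 : DifferentiableAt ℂ (fun z => sandwich e (Q + z • reduced E Q z)) z :=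
      (sandwich e).differentiableAt.comp z
        ((differentiableAt_const Q).add (differentiableAt_id.smul (h.differentiableAt_reduced (hlt hz))))
    refine (h1.congr_of_eventuallyEq ?_).differentiableWithinAt
    filter_upwards [Metric.isOpen_ball.mem_nhds (mem_ball_zero_iff.2 hz)] with w hw
    exact hF w (hlt (mem_ball_zero_iff.1 hw))
  · intro z hz
    rw [mem_ball_zero_iff] at hz
    have hk := sub_pos.2 (hlt hz)
    rw [hF z (hlt hz), hF 0 (by simpa using hs0), zero_smul, add_zero, ← map_sub, add_sub_cancel_left]
    calc ‖sandwich e (z • reduced E Q z)‖ ≤ ‖e‖ ^ 2 * ‖z • reduced E Q z‖ := norm_sandwich_le _ _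
      _ ≤ c⁻¹ * (‖z‖ * (s - ‖z‖ * (1 - s))⁻¹) := by
          rw [norm_smul]
          gcongr
          exact h.norm_reduced_le (hlt hz)
      _ < d := by
          rw [inv_mul_lt_iff₀ hc, mul_inv_lt_iff₀ hk]
          exact key hz
  · intro x hx
    have hx' : ‖(x : ℂ)‖ < r := by rwa [Complex.norm_real]
    have hx'' := hlt hx'
    rw [hF x hx'']
    rw [Complex.norm_real] at hx''
    refine isSelfAdjoint_sandwich e (h.isSelfAdjoint_proj.add (IsSelfAdjoint.smul ?_ ?_))
    · exact Complex.conj_ofReal x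
    · exact h.isSelfAdjoint_reduced hx''

end Sandwich

/-! ### Finite multiplicity from Fourier series. -/

section Compactness

theorem finite_setOf_norm_sq_waveVec_le (α : R3) (R : ℝ) : {n | ‖waveVec α n‖ ^ 2 ≤ R}.Finite := by
  obtain ⟨N, hN⟩ := exists_nat_ge (√R + ‖α‖)
  refine (Set.finite_Icc (fun _ : Fin 3 => -(N : ℤ)) fun _ => (N : ℤ)).subset fun n hn => ?_
  have h1 : ‖waveVec α n‖ ≤ √R := Real.le_sqrt_of_sq_le hn
  have h2 (i : Fin 3) : |n i| ≤ (N : ℤ) := by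
    have h3 : ‖(waveVec α n) i‖ ≤ ‖waveVec α n‖ := PiLp.norm_apply_le _ _
    have h4 : ‖α i‖ ≤ ‖α‖ := PiLp.norm_apply_le _ _
    have h5 : (waveVec α n) i - α i = 2 * Real.pi * n i := by simp [waveVec, latticeVec]
    have h6 : |2 * Real.pi * (n i : ℝ)| ≤ N := by
      rw [← h5]
      refine (abs_sub _ _).trans (le_trans ?_ hN)
      exact add_le_add (h3.trans h1) h4
    rw [abs_mul, abs_of_pos Real.two_pi_pos] at h6
    have h7 : |(n i : ℝ)| ≤ N := by nlinarith [Real.pi_gt_three, abs_nonneg (n i : ℝ)]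
    exact_mod_cast h7
  exact ⟨fun i => (abs_le.1 (h2 i)).1, fun i => (abs_le.1 (h2 i)).2⟩

/-- The Fourier coefficient as a linear map. -/
noncomputable def fourierCoefₗ (α : R3) (n : Fin 3 → ℤ) : L2Cell →ₗ[ℂ] C3 where
  toFun := fourierCoef α n
  map_add' := fourierCoef_add α n
  map_smul' c u := by
    rw [fourierCoef, fourierCoef, RingHom.id_apply, ← integral_smul]
    refine integral_congr_ae ?_
    filter_upwards [Lp.coeFn_smul c u] with x hx
    rw [hx, Pi.smul_apply, smul_comm]

/-- A subspace of `L²` whose elements are fields of `J_#` with curl controlled by the `L²` norm is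
finite-dimensional. -/
theorem finiteDimensional_of_norm_curl_le (α : BrillouinZone) (V : Submodule ℂ L2Cell) (C : ℝ)
    (hV : ∀ v ∈ V, ∃ u : J α, J.toL2 α u = v ∧ ‖J.curl α u‖ ^ 2 ≤ C * ‖v‖ ^ 2) :
    FiniteDimensional ℂ V := by
  have hB := finite_setOf_norm_sq_waveVec_le α.1 (C + 1)
  have := hB.fintype
  -- The finitely many low-frequency coefficients determine an element of `V`: if they all vanish,
  -- then `(C + 1) ‖v‖² ≤ ‖curl u‖² ≤ C ‖v‖²`, which forces `v = 0`.
  let L : V →ₗ[ℂ] ({n | ‖waveVec α.1 n‖ ^ 2 ≤ C + 1} → C3) :=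
    LinearMap.pi fun n => fourierCoefₗ α.1 n ∘ₗ V.subtype
  refine FiniteDimensional.of_injective L ((injective_iff_map_eq_zero L).2 ?_)
  rintro ⟨v, hv⟩ hL
  obtain ⟨u, hu, hc⟩ := hV v hv
  have h1 : (C + 1) * ‖v‖ ^ 2 ≤ ‖J.curl α u‖ ^ 2 := by
    refine hasSum_le (fun n => ?_) ((parseval α.1 v).mul_left (C + 1)) (parseval α.1 (J.curl α u))
    have e := norm_sq_fourierCoef_curl (α := α.1) u n
    have e' : ‖fourierCoef α.1 n (J.curl α u)‖ ^ 2 = ‖waveVec α.1 n‖ ^ 2 * ‖fourierCoef α.1 n v‖ ^ 2 := by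
      rw [← hu]; exact e
    rw [e']
    by_cases hn : ‖waveVec α.1 n‖ ^ 2 ≤ C + 1
    · have : fourierCoef α.1 n v = 0 := congrFun hL ⟨n, hn⟩
      simp [this]
    · exact mul_le_mul_of_nonneg_right (not_le.1 hn).le (sq_nonneg _)
  have h2 : ‖v‖ ^ 2 = 0 := by nlinarith [sq_nonneg ‖v‖]
  exact Subtype.ext (norm_eq_zero.1 (pow_eq_zero_iff two_ne_zero |>.1 h2))

end Compactness

/-! ### The solution operators as a holomorphic family. -/

section SolutionOp

variable {D : Set R3} (α : BrillouinZone)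

theorem solutionOp_eq (hD : MeasurableSet D) (hDY : D ⊆ unitCell) {s : ℝ}
    (h : GappedForm (energyOp α (unitCell \ D)) (W2 D α).starProjection s) {z : ℂ}
    (hz : ‖z‖ * (1 - s) < s) :
    solutionOp D α z = sandwich (embedL2 α) ((W2 D α).starProjection +
      z • GappedForm.reduced (energyOp α (unitCell \ D)) (W2 D α).starProjection z) := by
  rw [solutionOp, sandwich_apply]
  split_ifs with h0
  · rw [h0, zero_smul, add_zero]; rfl
  · rw [← h.ringInverse_contrast hz h0, contrastOp, energyOp_eq α hD hDY]; rfl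

theorem norm_embedL2_sq_le : ‖embedL2 α‖ ^ 2 ≤ (poincareConst α)⁻¹ := by
  have hc := poincareConst_pos α.1
  have h : ‖embedL2 α‖ ≤ (√(poincareConst α))⁻¹ :=
    (embedL2 α).opNorm_le_bound (by positivity) (J.norm_toL2_le α)
  calc ‖embedL2 α‖ ^ 2 ≤ ((√(poincareConst α))⁻¹) ^ 2 := by gcongr
    _ = (poincareConst α)⁻¹ := by rw [inv_pow, Real.sq_sqrt hc.le]

theorem isSelfAdjoint_solutionOp_zero : IsSelfAdjoint (solutionOp D α 0) := by
  rw [solutionOp, if_pos rfl]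
  exact isSelfAdjoint_sandwich (embedL2 α) (T := (W2 D α).starProjection)
    (isSelfAdjoint_starProjection _)

/-- For `β ≠ 0` an eigenfield is `β⁻¹` times the image of a bounded map into `J`, so its curl is
controlled by its `L²` norm. This gives finite multiplicity without a compact embedding theorem. -/
theorem finiteDimensional_eigenspace {β : ℂ} (hβ : β ≠ 0) :
    FiniteDimensional ℂ (Module.End.eigenspace (solutionOp D α 0).toLinearMap β) := by
  set B : L2Cell →L[ℂ] J α := (W2 D α).starProjection.comp (invLaplacian α)
  refine finiteDimensional_of_norm_curl_le α _ ((‖β⁻¹‖ * ‖B‖) ^ 2) fun v hv => ?_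
  have h1 : solutionOp D α 0 v = β • v := Module.End.mem_eigenspace_iff.1 hv
  have h2 : solutionOp D α 0 = (embedL2 α).comp B := if_pos rfl
  refine ⟨β⁻¹ • B v, ?_, ?_⟩
  · have h3 : J.toL2 α (B v) = β • v := by rw [← h1, h2]; rfl
    rw [map_smul, h3, inv_smul_smul₀ hβ]
  · rw [← J.norm_def, ← mul_pow]
    gcongr
    rw [norm_smul, mul_assoc]
    gcongr
    exact B.le_opNorm v

theorem contourCLM_word_eq {γ : ℝ → ℂ} {β : ℂ} {δ : ℝ}
    (h : IsolatedPoint γ β (solutionOp D α 0) δ) (l : List (L2Cell →L[ℂ] L2Cell)) :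
    contourCLM h.isContour (h.word l) =
      contourIntegral γ fun ζ => (l.map fun b => b * resolventOp D α ζ 0).prod :=
  contourCLM_eq _ _ fun t => h.word_apply l t

theorem spectralProj_eq {γ : ℝ → ℂ} {β : ℂ} {δ r : ℝ}
    (h : HolomorphicFamily (solutionOp D α) γ β δ r) {z : ℂ} (hz : z ∈ Metric.ball (0 : ℂ) r) :
    spectralProj D α γ z = h.proj z := by
  rw [spectralProj, HolomorphicFamily.proj]
  congr 1
  exact (contourCLM_eq _ _ fun t => h.resolvent_apply hz t).symm

theorem groupDim_eq {γ : ℝ → ℂ} {β : ℂ} {δ r : ℝ}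
    (h : HolomorphicFamily (solutionOp D α) γ β δ r) :
    groupDim D α γ = Module.finrank ℂ (h.proj 0).range := by
  rw [groupDim, spectralProj_eq α h h.zero_mem_ball]

theorem seriesCoef_eq {γ : ℝ → ℂ} {β : ℂ} {δ r : ℝ}
    (h : HolomorphicFamily (solutionOp D α) γ β δ r) (n : ℕ) :
    seriesCoef D α β γ n = h.meanCoef n := by
  rw [seriesCoef, HolomorphicFamily.meanCoef, groupDim_eq α h]
  split_ifs with hn
  · rfl
  · congr 2
    refine Finset.sum_congr rfl fun c _ => ?_
    rw [contourCLM_word_eq]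
    congr 2
    funext ζ
    rw [List.map_map]
    rfl

end SolutionOp

/-! ### Assembly of the error estimate. -/

/-- The error estimate for the eigenvalue group, with the Poincaré constant in the radius. -/
theorem norm_weightedMean_sub_le (D : Set R3) (hD : MeasurableSet D) (hDY : D ⊆ unitCell)
    (α : BrillouinZone) (hμ : -1 / 2 < muMinus D α) (hμ0 : muMinus D α < 1 / 2)
    {β : ℂ} (hβ0 : β ≠ 0) (hβ : Module.End.HasEigenvalue (solutionOp D α 0).toLinearMap β)
    {γ : ℝ → ℂ} (hγ : Isolates γ β (spectrum ℂ (solutionOp D α 0))) {d r : ℝ}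
    (hd : d = contourGap γ (spectrum ℂ (solutionOp D α 0)))
    (hr : r = convRadius D α (poincareConst α) d) {z : ℂ} (hz : ‖z‖ < r) (p : ℕ) :
    ‖weightedMean D α γ z - ∑ n ∈ Finset.range (p + 1), z ^ n * seriesCoef D α β γ n‖ ≤
      d * ‖z‖ ^ (p + 1) / (r ^ p * (r - ‖z‖)) := by
  obtain ⟨v, hv⟩ := hβ.exists_hasEigenvector
  have hmem := mem_spectrum_of_apply_eq hv.2 hv.apply_eq_smul
  have hi := isolatedPoint_of_isolates (isSelfAdjoint_solutionOp_zero α).isStarNormal hmem hγ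
  have hg := gappedForm α hD hDY hμ hμ0
  have h := hg.holomorphicFamily (embedL2 α) (poincareConst_pos α.1) (norm_embedL2_sq_le α)
    (F := solutionOp D α) (fun z hz => solutionOp_eq α hD hDY hg hz) hi
    fun t ht x hx => contourGap_le ht hx
  -- With `s = μ⁻ + 1/2` one has `1 - s = 1/2 - μ⁻` and `s / (1 - s) = |z*|`.
  have hr' : poincareConst α * d * ((muMinus D α + 1 / 2) / (1 - (muMinus D α + 1 / 2))) /
      (1 / (1 - (muMinus D α + 1 / 2)) + poincareConst α * d) = r := by
    have e : 1 - (muMinus D α + 1 / 2) = 1 / 2 - muMinus D α := by ring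
    have e2 : |zStar D α| = (muMinus D α + 1 / 2) / (1 / 2 - muMinus D α) := by
      rw [zStar, abs_div, abs_of_pos (by linarith), abs_of_neg (by linarith), neg_sub]
    rw [hr, convRadius, e, e2]
  rw [← hd, hr'] at h
  -- An eigenvector for `β` is fixed by `P(0)`, so `m ≠ 0` and the mean is well defined.
  have hP0 : h.proj 0 v = v := by
    have := h.proj_apply_of_apply_eq h.zero_mem_ball hv.2 hv.apply_eq_smul
    rwa [hγ.inside, one_smul] at this
  have hf : h.isolated.proj ∈ finiteRank L2Cell := by
    have := finiteDimensional_eigenspace (D := D) α hβ0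
    refine mem_finiteRank_of_forall_mem (Module.End.eigenspace (solutionOp D α 0).toLinearMap β)
      fun x => Module.End.mem_eigenspace_iff.2 ?_
    exact congrArg (fun T : L2Cell →L[ℂ] L2Cell => T x) h.isolated.mul_proj
  have hm : Module.finrank ℂ (h.proj 0).range ≠ 0 := by
    have : FiniteDimensional ℂ (h.proj 0).range := (h.rankLE_proj hf h.zero_mem_ball).mem_finiteRank
    intro h0
    have := (Submodule.finrank_eq_zero.1 h0).le ⟨v, hP0⟩
    exact hv.2 ((Submodule.mem_bot ℂ).1 this)
  have key := h.norm_mean_sub_le hf hm hz p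
  simp only [← seriesCoef_eq α h] at key
  rw [← groupDim_eq α h, ← spectralProj_eq α h (mem_ball_zero_iff.2 hz)] at key
  exact key

end PhotonicCrystal

theorem mainTheorem11 (D : Set R3) (hD : MeasurableSet D) (hDY : D ⊆ unitCell)
    (α : BrillouinZone) (hμ : -1 / 2 < muMinus D α) (hμ0 : muMinus D α < 0)
    (β₀ : ℂ) (hβ₀ : β₀ ≠ 0)
    (hβ : Module.End.HasEigenvalue (solutionOp D α 0).toLinearMap β₀)
    (γ : ℝ → ℂ) (hγ : Isolates γ β₀ (spectrum ℂ (solutionOp D α 0)))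
    (d : ℝ) (hd : d = contourGap γ (spectrum ℂ (solutionOp D α 0))) :
    (α.1 ≠ 0 → ∀ r : ℝ, r = convRadius D α (‖α.1‖ ^ 2) d → ∀ z : ℂ, ‖z‖ < r → ∀ p : ℕ,
      ‖weightedMean D α γ z - ∑ n ∈ Finset.range (p + 1), z ^ n * seriesCoef D α β₀ γ n‖ ≤
        d * ‖z‖ ^ (p + 1) / (r ^ p * (r - ‖z‖))) ∧
    (α.1 = 0 → ∀ r : ℝ, r = convRadius D α (4 * Real.pi ^ 2) d → ∀ z : ℂ, ‖z‖ < r → ∀ p : ℕ,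
      ‖weightedMean D α γ z - ∑ n ∈ Finset.range (p + 1), z ^ n * seriesCoef D α β₀ γ n‖ ≤
        d * ‖z‖ ^ (p + 1) / (r ^ p * (r - ‖z‖))) := by
  refine ⟨fun hα r hr z hz p => ?_, fun hα r hr z hz p => ?_⟩
  · refine norm_weightedMean_sub_le D hD hDY α hμ (by linarith) hβ₀ hβ hγ hd ?_ hz p
    rw [poincareConst, if_neg hα, hr]
  · refine norm_weightedMean_sub_le D hD hDY α hμ (by linarith) hβ₀ hβ hγ hd ?_ hz p
    rw [poincareConst, if_pos hα, hr]
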